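/- **Conventions.** Let $A$ be a ring, $\Lambda$ a free abelian group of finite rank, and $R$ a $\Lambda$-graded $A$-algebra. A homogeneous $f\in R$ is *relevant* if the degrees of the homogeneous units of $R[f^{-1}]$ form a subgroup of finite index in $\Lambda$. $\operatorname{Proj}R$ is obtained by gluing the affine schemes $D(f)=\operatorname{Spec}(R[f^{-1}]_0)$, $f$ relevant, along $D(f)\cap D(g)=D(fg)$; $\mathcal O(a)$, $a\in\Lambda$, is the sheaf with $\Gamma(D(f),\mathcal O(a))=R[f^{-1}]_a$. The *standard locus* of $\operatorname{Proj}R$ is the union of those $D(f)$ for which every element of $\Lambda$ is the degree of a homogeneous unit of $R[f^{-1}]$; the sheaves $\mathcal O(a)$ are invertible there, and it is all of $\operatorname{Proj}R$ if the grading is standard. A *multi-projective space* over $A$ is $P=\operatorname{Proj}A[x_1,\dots,x_p]$, where each variable $x_k$ is homogeneous of some degree $d_k\in\Lambda$ and $\{d_1,\dots,d_p\}$ contains a basis of $\Lambda$. For a section $g$ of an invertible sheaf $L$ on $X$, $X_g\subseteq X$ is the open set where $g$ does not vanish, i.e. generates $L$. An immersion is a closed immersion followed by an open immersion. **Proposition.**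 Let $A$ be a Noetherian ring and $X$ a scheme of finite type over $A$. (1) Let $L_1,\dots,L_q$ be invertible sheaves on $X$ such that the affine ones among the open sets $X_g$, where $g$ is a section of $L_i^{\otimes n}$ for some $i$ and some $n\ge 1$, cover $X$. Then there is a subset $I\subseteq\{1,\dots,q\}$ such that $(L_i)_{i\in I}$ still has this property, a multi-projective space $P$ over $A$ with $\Lambda=\mathbb Z^I$, and an immersion $\iota:X\hookrightarrow P$ over $A$ with image in the standard locus of $P$, such that for each $i\in I$ there is an integer $n_i>0$ with $L_i^{\otimes n_i}\simeq\iota^*\mathcal O(e_i)$, where $e_i$ is the standard basis vector. (2) Conversely, let $q\ge 1$, let $P$ be a multi-projective space over $A$ with $\Lambda=\mathbb Z^q$, and let $\iota:X\hookrightarrow P$ be an immersion over $A$ with image in the standard locus of $P$. Then all the sheaves $\iota^*\mathcal O(a)$, $a\in\mathbb Z^q$, are invertible, in particular $L_i:=\iota^*\mathcal O(e_i)$, and $\iota^*\mathcal O(a)\otimes\iota^*\mathcal O(b)\simeq\iota^*\mathcal O(a+b)$ for all $a,b$, so that $\iota^*\mathcal O(a)\simeq L_1^{\otimes a_1}\otimes\cdots\otimes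 L_q^{\otimes a_q}$. Moreover $X$ is covered by the open sets $X_{\iota^*x_k}$ for those $k$ with $d_k\neq0$, where the coordinate $x_k$ is regarded as a section of $\mathcal O(d_k)$, so that $\iota^*x_k$ is a section of $\iota^*\mathcal O(d_k)\simeq L_1^{\otimes d_{k,1}}\otimes\cdots\otimes L_q^{\otimes d_{k,q}}$. -/

import Mathlib

open CategoryTheory AlgebraicGeometry HomogeneousLocalization

universe u

noncomputable section

namespace MultiProj

section Modules

variable {X : Scheme.{u}}

/-- Invertible sheaves: the sheaves of modules that are locally isomorphic to `𝒪_X`. -/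
def IsInvertibleSheaf (L : X.Modules) : Prop :=
  ∀ x : X, ∃ U : X.Opens, x ∈ U ∧
    Nonempty (L.restrict U.ι ≅ SheafOfModules.unit U.toScheme.ringCatSheaf)

/-- The tensor product of sheaves of modules: the sheafification of `U ↦ M(U) ⊗ N(U)`. -/
def tensorModules (M N : X.Modules) : X.Modules :=
  (PresheafOfModules.sheafification (𝟙 X.ringCatSheaf.obj)).obj
    (MonoidalCategoryStruct.tensorObj
      (C := PresheafOfModules.{u} (X.presheaf ⋙ forget₂ CommRingCat RingCat)) M.val N.val)

/-- The structure sheaf, as a sheaf of modules. -/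
def structureModule (X : Scheme.{u}) : X.Modules := SheafOfModules.unit X.ringCatSheaf

/-- The tensor powers of a sheaf of modules. -/
def tensorPower (L : X.Modules) : ℕ → X.Modules
  | 0 => structureModule X
  | n + 1 => tensorModules (tensorPower L n) L

/-- The open subset `X_g` where the section `g` generates `L` freely. For `L` invertible it is the
set of the points `x` with `g_x ∉ 𝔪_x L_x`. -/
def nonvanishingLocus (L : X.Modules) (g : Γ(L, ⊤)) : X.Opens where
  carrier := {x | ∃ U : X.Opens, x ∈ U ∧ ∀ V : X.Opens, V ≤ U → Function.Bijective
    fun r : Γ(X, V) ↦ r • (L.presheaf.map (homOfLE (le_top : V ≤ ⊤)).op).hom g}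
  is_open' := isOpen_iff_forall_mem_open.2
    fun _ ⟨U, hx, hU⟩ ↦ ⟨U, fun _ hy ↦ ⟨U, hy, hU⟩, U.2, hx⟩

/-- The open sets `X_g`, for sections `g` of the powers `L_i^{⊗ n}` with `n ≥ 1`, that are affine
cover `X`. -/
def IsAmpleFamily {I : Type*} (L : I → X.Modules) : Prop :=
  ∀ x : X, ∃ (i : I) (n : ℕ) (g : Γ(tensorPower (L i) n, ⊤)), 0 < n ∧
    x ∈ nonvanishingLocus _ g ∧ IsAffineOpen (nonvanishingLocus _ g)

/-- The pull-back of a global section. -/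
def pullbackSection {Y : Scheme.{u}} (φ : X ⟶ Y) {M : Y.Modules} (s : Γ(M, ⊤)) :
    Γ((Scheme.Modules.pullback φ).obj M, ⊤) :=
  ((Scheme.Modules.pullbackPushforwardAdjunction φ).unit.app M).app ⊤ s

end Modules

section GradedRing

variable {A : Type u} [CommRing A] {Λ : Type} [AddCommGroup Λ] [DecidableEq Λ]
  {R : Type u} [CommRing R] [Algebra A R] (𝒜 : Λ → Submodule A R) [GradedAlgebra 𝒜]

/-- The group of the degrees of the homogeneous units of `R[f⁻¹]`, for `f` homogeneous. The
homogeneous units are the quotients `b / f ^ n` with `b` homogeneous and invertible in `R[f⁻¹]`,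
and `f` itself is such a `b`, so this is the group generated by the degrees of all such `b`. -/
def unitDegrees (f : R) : AddSubgroup Λ :=
  AddSubgroup.closure {c | ∃ b ∈ 𝒜 c, IsUnit (algebraMap R (Localization.Away f) b)}

/-- The homogeneous elements `f` of `R` such that the degrees of the homogeneous units of
`R[f⁻¹]` form a subgroup of finite index. They generate the irrelevant ideal. -/
structure Relevant where
  elem : R
  homogeneous : SetLike.IsHomogeneousElem 𝒜 elem
  finiteIndex : (unitDegrees 𝒜 elem).FiniteIndex

variable {𝒜}

lemma exists_homogeneous_cofactor {f b r : R} {c d : Λ} (hb : b ∈ 𝒜 c) (hf : f ∈ 𝒜 d)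
    (h : b * r = f) : ∃ b' ∈ 𝒜 (d - c), b * b' = f := by
  refine ⟨_, (DirectSum.decompose 𝒜 r (d - c)).2, ?_⟩
  rw [← DirectSum.coe_decompose_mul_add_of_left_mem 𝒜 hb, h, add_sub_cancel,
    DirectSum.decompose_of_mem_same 𝒜 hf]

lemma exists_mul_eq_pow {f b : R} (h : IsUnit (algebraMap R (Localization.Away f) b)) :
    ∃ r n, b * r = f ^ n := by
  obtain ⟨z, hz⟩ := h.exists_right_inv
  obtain ⟨⟨r, ⟨_, n, rfl⟩⟩, hr⟩ := IsLocalization.surj (Submonoid.powers f) z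
  have : algebraMap R (Localization.Away f) (b * r) = algebraMap R _ (f ^ n) := by
    rw [map_mul, ← hr, ← mul_assoc, hz, one_mul]
  obtain ⟨⟨_, m, rfl⟩, hm⟩ := (IsLocalization.eq_iff_exists (Submonoid.powers f) _).1 this
  exact ⟨r * f ^ m, n + m, by
    rw [pow_add, mul_comm (f ^ n)]; rw [← mul_assoc, mul_comm]; simpa using hm⟩

lemma isUnit_of_mul_eq_pow {f b r : R} {n : ℕ} (h : b * r = f ^ n) :
    IsUnit (algebraMap R (Localization.Away f) b) := by
  have : IsUnit (algebraMap R (Localization.Away f) (b * r)) := by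
    rw [h, map_pow]
    exact (IsLocalization.Away.algebraMap_isUnit f).pow n
  rw [map_mul] at this
  exact isUnit_of_mul_isUnit_left this

lemma exists_unit_of_mem_unitDegrees {f : R} {d : Λ} (hf : f ∈ 𝒜 d) {x : Λ}
    (hx : x ∈ unitDegrees 𝒜 f) : ∃ n : ℕ, ∃ b ∈ 𝒜 (x + n • d),
      IsUnit (algebraMap R (Localization.Away f) b) := by
  induction hx using AddSubgroup.closure_induction with
  | mem x hx =>
    obtain ⟨b, hb, hu⟩ := hx
    exact ⟨0, b, by simpa using hb, hu⟩
  | zero => exact ⟨0, 1, by simpa using SetLike.GradedOne.one_mem, by simp⟩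
  | add x y hx hy h1 h2 =>
    obtain ⟨n, b, hb, hu⟩ := h1
    obtain ⟨m, c, hc, hv⟩ := h2
    refine ⟨n + m, b * c, ?_, by rw [map_mul]; exact hu.mul hv⟩
    convert SetLike.mul_mem_graded hb hc using 2
    rw [add_smul]; abel
  | neg x hx h =>
    obtain ⟨n, b, hb, hu⟩ := h
    obtain ⟨r, k, hr⟩ := exists_mul_eq_pow hu
    obtain ⟨b', hb', h'⟩ := exists_homogeneous_cofactor hb (SetLike.pow_mem_graded k hf) hr
    refine ⟨k, b' * f ^ n, ?_, ?_⟩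
    · convert SetLike.mul_mem_graded hb' (SetLike.pow_mem_graded n hf) using 2
      abel
    · rw [map_mul, map_pow]
      exact (isUnit_of_mul_eq_pow (r := b) (by rw [mul_comm, h'])).mul
        ((IsLocalization.Away.algebraMap_isUnit f).pow n)

set_option linter.unusedSectionVars false in
lemma unitDegrees_mono {f x : R} (h : f ∣ x) : unitDegrees 𝒜 f ≤ unitDegrees 𝒜 x := by
  refine AddSubgroup.closure_mono ?_
  rintro c ⟨b, hb, hu⟩
  obtain ⟨r, n, hr⟩ := exists_mul_eq_pow hu
  obtain ⟨y, rfl⟩ := h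
  exact ⟨b, hb, isUnit_of_mul_eq_pow (r := r * y ^ n) (n := n) (by
    rw [← mul_assoc, hr, mul_pow])⟩

/-- Auxiliary data: `h ^ N * c / f ^ n` has degree zero, where `N` is positive and `c` is a
homogeneous unit of `R[f⁻¹]`. -/
structure Denominator (f : R) (d : Λ) (h : R) (e : Λ) where
  N : ℕ
  n : ℕ
  c : R
  m : Λ
  pos : 0 < N
  mem : c ∈ 𝒜 m
  deg : N • e + m = n • d
  unit : IsUnit (algebraMap R (Localization.Away f) c)

lemma exists_denominator (f : Relevant 𝒜) {d : Λ} (hf : f.elem ∈ 𝒜 d) (h : R) (e : Λ) :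
    Nonempty (Denominator (𝒜 := 𝒜) f.elem d h e) := by
  obtain ⟨N, hN, -, hmem⟩ :=
    AddSubgroup.exists_nsmul_mem_of_index_ne_zero f.finiteIndex.index_ne_zero e
  obtain ⟨n, c, hc, hu⟩ := exists_unit_of_mem_unitDegrees hf (neg_mem hmem)
  exact ⟨⟨N, n, c, _, hN, hc, by abel, hu⟩⟩

/-- The element `h ^ N * c / f ^ n` of `R[f⁻¹]₀`. -/
def Denominator.elem {f h : R} {d e : Λ} (hf : f ∈ 𝒜 d) (hh : h ∈ 𝒜 e)
    (D : Denominator (𝒜 := 𝒜) f d h e) : Away 𝒜 f :=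
  Away.mk 𝒜 hf D.n (h ^ D.N * D.c) (by
    rw [← D.deg]; exact SetLike.mul_mem_graded (SetLike.pow_mem_graded _ hh) D.mem)

theorem Denominator.isLocalization {f h x : R} {d e : Λ} (hf : f ∈ 𝒜 d) (hh : h ∈ 𝒜 e)
    (hx : x = f * h) (D : Denominator (𝒜 := 𝒜) f d h e) :
    letI := (awayMap 𝒜 hh hx).toAlgebra
    IsLocalization.Away (D.elem hf hh) (Away 𝒜 x) := by
  let := (awayMap 𝒜 hh hx).toAlgebra
  obtain ⟨r, k, hr⟩ := exists_mul_eq_pow D.unit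
  obtain ⟨c', hc', hcc⟩ := exists_homogeneous_cofactor D.mem (SetLike.pow_mem_graded k hf) hr
  obtain ⟨N, n, c, m, hN, hc, hdeg, hu⟩ := D
  obtain ⟨N, rfl⟩ : ∃ N', N = N' + 1 := ⟨N - 1, by omega⟩
  dsimp only at hc' hcc hdeg
  have hm : m = n • d - (N + 1) • e := by rw [← hdeg]; abel
  subst hm
  subst hx
  constructor; constructor
  · rintro ⟨_, s, rfl⟩
    rw [map_pow, RingHom.algebraMap_toAlgebra]
    let z : Away 𝒜 (f * h) := Away.mk 𝒜 (SetLike.mul_mem_graded hf hh) (N + 1 + k)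
        (f ^ n * c' * f ^ (N + 1) * h ^ k) <| by
      convert SetLike.mul_mem_graded (SetLike.mul_mem_graded (SetLike.mul_mem_graded
        (SetLike.pow_mem_graded n hf) hc') (SetLike.pow_mem_graded (N + 1) hf))
        (SetLike.pow_mem_graded k hh) using 2
      simp only [smul_add, add_smul, one_smul]
      abel
    refine (isUnit_iff_exists_inv.mpr ⟨z, ?_⟩).pow _
    ext
    simp only [Denominator.elem, val_mul, val_one, awayMap_mk, Away.val_mk, z, Localization.mk_mul]
    rw [← Localization.mk_one, Localization.mk_eq_mk_iff, Localization.r_iff_exists]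
    refine ⟨1, ?_⟩
    simp only [OneMemClass.coe_one, one_mul, Submonoid.coe_mul, mul_one]
    linear_combination (h ^ (N + 1) * h ^ n * f ^ n * f ^ (N + 1) * h ^ k) * hcc
  · intro z
    obtain ⟨s, a, ha, rfl⟩ := Away.mk_surjective 𝒜 (SetLike.mul_mem_graded hf hh) z
    let t : Away 𝒜 f := Away.mk 𝒜 hf (s * (n + 1)) (a * h ^ (s * N) * c ^ s) <| by
      convert SetLike.mul_mem_graded (SetLike.mul_mem_graded ha
        (SetLike.pow_mem_graded (s * N) hh)) (SetLike.pow_mem_graded s hc) using 2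
      simp only [smul_add, smul_sub, add_smul, mul_smul, mul_add, one_smul, mul_one]
      abel
    refine ⟨⟨t, ⟨_, ⟨s, rfl⟩⟩⟩, ?_⟩
    ext
    simp only [Denominator.elem, RingHom.algebraMap_toAlgebra, map_pow, awayMap_mk, val_mul,
      Away.val_mk, val_pow, Localization.mk_pow, Localization.mk_mul, t]
    rw [Localization.mk_eq_mk_iff, Localization.r_iff_exists]
    refine ⟨1, ?_⟩
    simp only [OneMemClass.coe_one, one_mul, Submonoid.coe_mul, SubmonoidClass.coe_pow]
    ring
  · intro a b e'
    obtain ⟨p, a, ha, rfl⟩ := Away.mk_surjective 𝒜 hf a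
    obtain ⟨q, b, hb, rfl⟩ := Away.mk_surjective 𝒜 hf b
    replace e' := congr_arg val e'
    simp only [RingHom.algebraMap_toAlgebra, awayMap_mk, Away.val_mk,
      Localization.mk_eq_mk_iff, Localization.r_iff_exists] at e'
    obtain ⟨⟨_, k, rfl⟩, hc'⟩ := e'
    refine ⟨⟨_, k + p + q, rfl⟩, ?_⟩
    ext
    simp only [Denominator.elem, val_mul, val_pow, Away.val_mk, Localization.mk_pow,
      Localization.mk_eq_mk_iff, Localization.r_iff_exists, Submonoid.coe_mul, Localization.mk_mul,
      SubmonoidClass.coe_pow, Subtype.exists, exists_prop]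
    refine ⟨_, ⟨k, rfl⟩, ?_⟩
    simp only at hc' ⊢
    linear_combination (f ^ (n * (k + p + q)) * c ^ (k + p + q) *
      h ^ (N * (k + p + q))) * hc'

/-- `f ≤ g` when `g` divides `f`, so that `D(f) ⊆ D(g)`. -/
instance : Preorder (Relevant 𝒜) where
  le f g := ∃ e, ∃ h ∈ 𝒜 e, f.elem = g.elem * h
  le_refl f := ⟨0, 1, SetLike.GradedOne.one_mem, (mul_one _).symm⟩
  le_trans f g k := by
    rintro ⟨e, h, hh, h1⟩ ⟨e', h', hh', h2⟩
    exact ⟨e' + e, h' * h, SetLike.mul_mem_graded hh' hh, by rw [h1, h2, mul_assoc]⟩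

instance : Mul (Relevant 𝒜) where
  mul f g := ⟨f.elem * g.elem, f.homogeneous.mul g.homogeneous,
    have := f.finiteIndex
    AddSubgroup.finiteIndex_of_le (unitDegrees_mono (Dvd.intro _ rfl))⟩

lemma Relevant.mul_le_left (f g : Relevant 𝒜) : f * g ≤ f :=
  let ⟨e, he⟩ := g.homogeneous
  ⟨e, g.elem, he, rfl⟩

lemma Relevant.mul_le_right (f g : Relevant 𝒜) : f * g ≤ g :=
  let ⟨e, he⟩ := f.homogeneous
  ⟨e, f.elem, he, mul_comm _ _⟩

lemma isUnit_of_le {f g : Relevant 𝒜} (h : f ≤ g) :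
    IsUnit (algebraMap R (Localization.Away f.elem) g.elem) := by
  obtain ⟨e, k, hk, hfg⟩ := h
  exact isUnit_of_mul_eq_pow (r := k) (n := 1) (by rw [pow_one, hfg])

/-- For `g ∣ f`, the canonical homomorphism `R[g⁻¹] → R[f⁻¹]`. -/
def awayLE {f g : Relevant 𝒜} (h : f ≤ g) :
    Localization.Away g.elem →+* Localization.Away f.elem :=
  Localization.awayLift (algebraMap R (Localization.Away f.elem)) g.elem (isUnit_of_le h)

lemma awayLE_algebraMap {f g : Relevant 𝒜} (h : f ≤ g) (r : R) :
    awayLE h (algebraMap R _ r) = algebraMap R _ r :=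
  IsLocalization.Away.lift_eq (S := Localization.Away g.elem) g.elem (isUnit_of_le h) r

/-- For `g ∣ f`, the canonical homomorphism `R[g⁻¹]₀ → R[f⁻¹]₀`. -/
def awayZeroLE {f g : Relevant 𝒜} (h : f ≤ g) : Away 𝒜 g.elem →+* Away 𝒜 f.elem :=
  awayMap 𝒜 h.choose_spec.choose_spec.1 h.choose_spec.choose_spec.2

lemma val_awayZeroLE {f g : Relevant 𝒜} (h : f ≤ g) (z : Away 𝒜 g.elem) :
    (awayZeroLE h z).val = awayLE h z.val :=
  val_awayMap _ _ _ _

lemma awayLE_refl {f : Relevant 𝒜} (h : f ≤ f) : awayLE h = RingHom.id _ :=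
  IsLocalization.ringHom_ext (Submonoid.powers f.elem)
    (RingHom.ext fun r ↦ awayLE_algebraMap h r)

lemma awayLE_trans {f g k : Relevant 𝒜} (h : f ≤ g) (h' : g ≤ k) :
    awayLE (h.trans h') = (awayLE h).comp (awayLE h') :=
  IsLocalization.ringHom_ext (Submonoid.powers k.elem) (RingHom.ext fun r ↦ by
    simp only [RingHom.comp_apply, awayLE_algebraMap])

lemma awayZeroLE_refl {f : Relevant 𝒜} (h : f ≤ f) : awayZeroLE h = RingHom.id _ := by
  ext z
  simp [val_awayZeroLE, awayLE_refl]

lemma awayZeroLE_trans {f g k : Relevant 𝒜} (h : f ≤ g) (h' : g ≤ k) :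
    awayZeroLE (h.trans h') = (awayZeroLE h).comp (awayZeroLE h') := by
  ext z
  simp [val_awayZeroLE, awayLE_trans h h']

variable (𝒜)

/-- The diagram of the affine schemes `Spec R[f⁻¹]` and the open immersions between them. -/
def relevantDiagram : Relevant 𝒜 ⥤ Scheme.{u} where
  obj f := Spec (.of (Localization.Away f.elem))
  map h := Spec.map (CommRingCat.ofHom (awayLE h.le))
  map_id f := by
    rw [awayLE_refl]
    exact Spec.map_id _
  map_comp h h' := by
    rw [awayLE_trans h.le h'.le, CommRingCat.ofHom_comp, Spec.map_comp]

/-- The diagram of the affine schemes `Spec R[f⁻¹]₀` and the open immersions between them. -/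
def projDiagram : Relevant 𝒜 ⥤ Scheme.{u} where
  obj f := Spec (.of (Away 𝒜 f.elem))
  map h := Spec.map (CommRingCat.ofHom (awayZeroLE h.le))
  map_id f := by
    rw [awayZeroLE_refl]
    exact Spec.map_id _
  map_comp h h' := by
    rw [awayZeroLE_trans h.le h'.le, CommRingCat.ofHom_comp, Spec.map_comp]

/-- The open immersion `Spec R[f⁻¹] ⟶ Spec R`. -/
def relevantToSpec (f : Relevant 𝒜) : (relevantDiagram 𝒜).obj f ⟶ Spec (.of R) :=
  Spec.map (CommRingCat.ofHom (algebraMap R (Localization.Away f.elem)))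

instance (f : Relevant 𝒜) : IsOpenImmersion (relevantToSpec 𝒜 f) :=
  IsOpenImmersion.of_isLocalization f.elem

lemma relevantDiagram_map {f g : Relevant 𝒜} (h : f ⟶ g) :
    (relevantDiagram 𝒜).map h ≫ relevantToSpec 𝒜 g = relevantToSpec 𝒜 f := by
  dsimp only [relevantToSpec, relevantDiagram]
  rw [← Spec.map_comp, ← CommRingCat.ofHom_comp]
  congr 2
  ext r
  exact awayLE_algebraMap h.le r

instance {f g : Relevant 𝒜} (h : f ⟶ g) : IsOpenImmersion ((relevantDiagram 𝒜).map h) := by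
  have : IsOpenImmersion ((relevantDiagram 𝒜).map h ≫ relevantToSpec 𝒜 g) := by
    rw [relevantDiagram_map]; infer_instance
  exact IsOpenImmersion.of_comp _ (relevantToSpec 𝒜 g)

lemma range_relevantToSpec (f : Relevant 𝒜) :
    Set.range (relevantToSpec 𝒜 f) = (PrimeSpectrum.basicOpen f.elem : Set (PrimeSpectrum R)) :=
  PrimeSpectrum.localization_away_comap_range (Localization.Away f.elem) f.elem

instance : (relevantDiagram 𝒜 ⋙ Scheme.forget).IsLocallyDirected where
  cond := by
    intro f g k hf hg x y hxy
    replace hxy : (relevantDiagram 𝒜).map hf x = (relevantDiagram 𝒜).map hg y := hxy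
    have hxy' : relevantToSpec 𝒜 f x = relevantToSpec 𝒜 g y := by
      rw [← relevantDiagram_map 𝒜 hf, ← relevantDiagram_map 𝒜 hg,
        Scheme.Hom.comp_apply, Scheme.Hom.comp_apply, hxy]
    have hx : relevantToSpec 𝒜 f x ∈ Set.range (relevantToSpec 𝒜 (f * g)) := by
      have h1 : relevantToSpec 𝒜 f x ∈ Set.range (relevantToSpec 𝒜 f) := ⟨x, rfl⟩
      have h2 : relevantToSpec 𝒜 f x ∈ Set.range (relevantToSpec 𝒜 g) := ⟨y, hxy'.symm⟩
      rw [range_relevantToSpec] at h1 h2 ⊢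
      exact (PrimeSpectrum.basicOpen_mul f.elem g.elem).ge ⟨h1, h2⟩
    obtain ⟨z, hz⟩ := hx
    refine ⟨f * g, homOfLE (f.mul_le_left g), homOfLE (f.mul_le_right g), z, ?_, ?_⟩
    · apply (relevantToSpec 𝒜 f).isOpenEmbedding.injective
      change relevantToSpec 𝒜 f ((relevantDiagram 𝒜).map (homOfLE (f.mul_le_left g)) z) = _
      rw [← Scheme.Hom.comp_apply, relevantDiagram_map, hz]
    · apply (relevantToSpec 𝒜 g).isOpenEmbedding.injective
      change relevantToSpec 𝒜 g ((relevantDiagram 𝒜).map (homOfLE (f.mul_le_right g)) z) = _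
      rw [← Scheme.Hom.comp_apply, relevantDiagram_map, hz, hxy']

lemma projDiagram_map_aux {f g : Relevant 𝒜} (h : f ⟶ g) {d e : Λ} {k : R}
    (hg : g.elem ∈ 𝒜 d) (hk : k ∈ 𝒜 e) (hfg : f.elem = g.elem * k)
    (D : Denominator (𝒜 := 𝒜) g.elem d k e) :
    IsOpenImmersion ((projDiagram 𝒜).map h) ∧ Set.range ((projDiagram 𝒜).map h) =
      (PrimeSpectrum.basicOpen (D.elem hg hk) : Set (PrimeSpectrum (Away 𝒜 g.elem))) := by
  have heq : awayZeroLE h.le = awayMap 𝒜 hk hfg := by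
    ext z
    rw [val_awayZeroLE, val_awayMap]
    rfl
  let := (awayMap 𝒜 hk hfg).toAlgebra
  have := D.isLocalization hg hk hfg
  have hmap : (projDiagram 𝒜).map h = Spec.map (CommRingCat.ofHom (algebraMap _ _)) :=
    congr(Spec.map (CommRingCat.ofHom $heq))
  rw [hmap]
  exact ⟨IsOpenImmersion.of_isLocalization (D.elem hg hk),
    PrimeSpectrum.localization_away_comap_range (Away 𝒜 f.elem) (D.elem hg hk)⟩

instance {f g : Relevant 𝒜} (h : f ⟶ g) : IsOpenImmersion ((projDiagram 𝒜).map h) := by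
  obtain ⟨d, hd⟩ := g.homogeneous
  obtain ⟨e, k, hk, hfg⟩ := h.le
  obtain ⟨D⟩ := exists_denominator g hd k e
  exact (projDiagram_map_aux 𝒜 h hd hk hfg D).1

instance : (projDiagram 𝒜 ⋙ Scheme.forget).IsLocallyDirected where
  cond := by
    intro f g k hf hg x y hxy
    replace hxy : (projDiagram 𝒜).map hf x = (projDiagram 𝒜).map hg y := hxy
    have hx : (projDiagram 𝒜).map hf x ∈ Set.range
        ((projDiagram 𝒜).map (homOfLE (f.mul_le_left g) ≫ hf)) := by
      have h1 : (projDiagram 𝒜).map hf x ∈ Set.range ((projDiagram 𝒜).map hf) := ⟨x, rfl⟩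
      have h2 : (projDiagram 𝒜).map hf x ∈ Set.range ((projDiagram 𝒜).map hg) := ⟨y, hxy.symm⟩
      obtain ⟨d, hd⟩ := k.homogeneous
      obtain ⟨e, p, hp, hfp⟩ := hf.le
      obtain ⟨e', q, hq, hgq⟩ := hg.le
      obtain ⟨D⟩ := exists_denominator k hd p e
      obtain ⟨D'⟩ := exists_denominator k hd q e'
      let E : Denominator (𝒜 := 𝒜) k.elem d (p * k.elem * q) (e + d + e') :=
        { N := D.N * D'.N
          n := D'.N * D.n + D.N * D'.n + D.N * D'.N
          c := D.c ^ D'.N * D'.c ^ D.N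
          m := D'.N • D.m + D.N • D'.m
          pos := Nat.mul_pos D.pos D'.pos
          mem := SetLike.mul_mem_graded (SetLike.pow_mem_graded _ D.mem)
            (SetLike.pow_mem_graded _ D'.mem)
          deg := by
            have h1 := congr(D'.N • $(D.deg))
            have h2 := congr(D.N • $(D'.deg))
            simp only [add_smul, mul_smul, ← h1, ← h2, smul_add]
            rw [smul_comm D.N D'.N e]
            abel
          unit := by
            rw [map_mul, map_pow, map_pow]
            exact (D.unit.pow _).mul (D'.unit.pow _) }
      have hpq : p * k.elem * q ∈ 𝒜 (e + d + e') :=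
        SetLike.mul_mem_graded (SetLike.mul_mem_graded hp hd) hq
      have hE : E.elem hd hpq = D.elem hd hp ^ D'.N * D'.elem hd hq ^ D.N := by
        ext
        simp only [Denominator.elem, val_mul, val_pow, Away.val_mk, Localization.mk_pow,
          Localization.mk_mul, Localization.mk_eq_mk_iff, Localization.r_iff_exists]
        refine ⟨1, ?_⟩
        simp only [OneMemClass.coe_one, one_mul, Submonoid.coe_mul, SubmonoidClass.coe_pow, E]
        ring
      rw [(projDiagram_map_aux 𝒜 hf hd hp hfp D).2] at h1
      rw [(projDiagram_map_aux 𝒜 hg hd hq hgq D').2] at h2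
      rw [(projDiagram_map_aux 𝒜 _ hd hpq (by
        change f.elem * g.elem = _; rw [hfp, hgq]; ring) E).2, hE]
      rw [PrimeSpectrum.basicOpen_mul, PrimeSpectrum.basicOpen_pow _ _ D'.pos,
        PrimeSpectrum.basicOpen_pow _ _ D.pos]
      exact ⟨h1, h2⟩
    obtain ⟨z, hz⟩ := hx
    refine ⟨f * g, homOfLE (f.mul_le_left g), homOfLE (f.mul_le_right g), z, ?_, ?_⟩
    · apply ((projDiagram 𝒜).map hf).isOpenEmbedding.injective
      change (projDiagram 𝒜).map hf ((projDiagram 𝒜).map (homOfLE (f.mul_le_left g)) z) = _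
      rw [← Scheme.Hom.comp_apply, ← Functor.map_comp, hz]
    · apply ((projDiagram 𝒜).map hg).isOpenEmbedding.injective
      change (projDiagram 𝒜).map hg ((projDiagram 𝒜).map (homOfLE (f.mul_le_right g)) z) = _
      rw [← Scheme.Hom.comp_apply, ← Functor.map_comp, ← hxy, ← hz]
      congr 1

/-- The multi-Proj of `R`, obtained by gluing the affine schemes `Spec R[f⁻¹]₀`. -/
def multiProj : Scheme.{u} := Limits.colimit (projDiagram 𝒜)

/-- The relevant locus `Spec R - V(R_#)` in `Spec R`: the union of the open subschemes
`Spec R[f⁻¹]`. -/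
def relevantLocus : Scheme.{u} := Limits.colimit (relevantDiagram 𝒜)

/-- The open subscheme `Spec R[f⁻¹]₀` of `Proj R`. -/
def chart (f : Relevant 𝒜) : (projDiagram 𝒜).obj f ⟶ multiProj 𝒜 :=
  Limits.colimit.ι (projDiagram 𝒜) f

/-- The quotient morphism from the relevant locus to `Proj R`, which is given by
`R[f⁻¹]₀ → R[f⁻¹]` over the chart of `f`. -/
def quot : relevantLocus 𝒜 ⟶ multiProj 𝒜 :=
  Limits.colimMap
    { app f := Spec.map (CommRingCat.ofHom (algebraMap (Away 𝒜 f.elem)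
        (Localization.Away f.elem)))
      naturality f g h := by
        dsimp only [relevantDiagram, projDiagram]
        rw [← Spec.map_comp, ← Spec.map_comp, ← CommRingCat.ofHom_comp, ← CommRingCat.ofHom_comp]
        congr 2
        ext z
        exact (val_awayZeroLE h.le z).symm }

/-- The inclusion of the relevant locus in `Spec R`. -/
def relevantLocusι : relevantLocus 𝒜 ⟶ Spec (.of R) :=
  Limits.colimit.desc (relevantDiagram 𝒜) (Limits.Cocone.mk (Spec (.of R))
    { app f := relevantToSpec 𝒜 f
      naturality _ _ h :=
        (relevantDiagram_map 𝒜 h).trans (Category.comp_id _).symm })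

/-- The structure morphism of a chart. -/
def chartToSpec (f : Relevant 𝒜) : (projDiagram 𝒜).obj f ⟶ Spec (.of A) :=
  Spec.map (CommRingCat.ofHom
    ((fromZeroRingHom 𝒜 (Submonoid.powers f.elem)).comp (algebraMap A (𝒜 0))))

lemma projDiagram_map_chartToSpec {f g : Relevant 𝒜} (h : f ⟶ g) :
    (projDiagram 𝒜).map h ≫ chartToSpec 𝒜 g = chartToSpec 𝒜 f := by
  dsimp only [chartToSpec, projDiagram]
  rw [← Spec.map_comp, ← CommRingCat.ofHom_comp]
  congr 2
  refine RingHom.ext fun a ↦ ?_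
  exact awayMap_fromZeroRingHom 𝒜 h.le.choose_spec.choose_spec.1 h.le.choose_spec.choose_spec.2 _

/-- The structure morphism `Proj R ⟶ Spec A`. -/
def structureMorphism : multiProj 𝒜 ⟶ Spec (.of A) :=
  Limits.colimit.desc (projDiagram 𝒜) (Limits.Cocone.mk (Spec (.of A))
    { app f := chartToSpec 𝒜 f
      naturality _ _ h :=
        (projDiagram_map_chartToSpec 𝒜 h).trans (Category.comp_id _).symm })

/-- An element `r` of `R` as a function on the preimage of an open subset `W` of `Proj R` in the
relevant locus. -/
def toSection (W : (multiProj 𝒜).Opens) : R →+* Γ(relevantLocus 𝒜, quot 𝒜 ⁻¹ᵁ W) :=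
  ((Scheme.ΓSpecIso (.of R)).inv ≫
    (relevantLocusι 𝒜).appLE ⊤ (quot 𝒜 ⁻¹ᵁ W) ((le_top : _ ≤ ⊤).trans (Scheme.Hom.preimage_top _).ge)).hom

/-- The push-forward of the structure sheaf of the relevant locus to `Proj R`. -/
def ambient : (multiProj 𝒜).Modules :=
  (Scheme.Modules.pushforward (quot 𝒜)).obj (structureModule (relevantLocus 𝒜))

/-- The fractions `b / g` of degree `a` on the preimage of `W`, where `b` and `g` are homogeneous
elements of `R` and `g` is invertible on the preimage of `W`. -/
def fractions (a : Λ) (W : (multiProj 𝒜).Opens) : Set Γ(ambient 𝒜, W) :=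
  {t | ∃ e, ∃ g ∈ 𝒜 e, ∃ b ∈ 𝒜 (e + a), IsUnit (toSection 𝒜 W g) ∧
    toSection 𝒜 W g * (show Γ(relevantLocus 𝒜, quot 𝒜 ⁻¹ᵁ W) from t) = toSection 𝒜 W b}

lemma map_toSection {W V : (multiProj 𝒜).Opens} (h : W ≤ V) (r : R) :
    (relevantLocus 𝒜).presheaf.map (homOfLE ((quot 𝒜).preimage_mono h)).op (toSection 𝒜 V r) =
      toSection 𝒜 W r := by
  have := Scheme.Hom.appLE_map (relevantLocusι 𝒜) (U := ⊤) (V := quot 𝒜 ⁻¹ᵁ V) (V' := quot 𝒜 ⁻¹ᵁ W)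
    ((le_top : _ ≤ ⊤).trans (Scheme.Hom.preimage_top _).ge)
    (homOfLE ((quot 𝒜).preimage_mono h)).op
  exact congr($this ((Scheme.ΓSpecIso (.of R)).inv r))

lemma map_mem_span (a : Λ) {W V : (multiProj 𝒜).Opens} (h : W ≤ V) {s : Γ(ambient 𝒜, V)}
    (hs : s ∈ Submodule.span Γ(multiProj 𝒜, V) (fractions 𝒜 a V)) :
    (ambient 𝒜).presheaf.map (homOfLE h).op s ∈
      Submodule.span Γ(multiProj 𝒜, W) (fractions 𝒜 a W) := by
  induction hs using Submodule.span_induction with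
  | mem t ht =>
    refine Submodule.subset_span ?_
    obtain ⟨e, g, hg, b, hb, hu, hgb⟩ := ht
    refine ⟨e, g, hg, b, hb, ?_, ?_⟩
    · rw [← map_toSection 𝒜 h g]
      exact hu.map _
    · rw [← map_toSection 𝒜 h g, ← map_toSection 𝒜 h b, ← hgb, map_mul]
      rfl
  | zero => simp
  | add x y hx hy h1 h2 => rw [map_add]; exact add_mem h1 h2
  | smul r x hx h1 =>
    rw [Scheme.Modules.map_smul]
    exact Submodule.smul_mem _ _ h1

/-- The sections of `𝒪(a)`. -/
def twistSections (a : Λ) (V : (multiProj 𝒜).Opens) : Submodule Γ(multiProj 𝒜, V) Γ(ambient 𝒜, V) where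
  carrier := {s | ∀ x ∈ V, ∃ W : (multiProj 𝒜).Opens, ∃ h : W ≤ V, x ∈ W ∧
    (ambient 𝒜).presheaf.map (homOfLE h).op s ∈
      Submodule.span Γ(multiProj 𝒜, W) (fractions 𝒜 a W)}
  zero_mem' x hx := ⟨V, le_rfl, hx, by simp⟩
  add_mem' {s t} hs ht x hx := by
    obtain ⟨W, h, hxW, hW⟩ := hs x hx
    obtain ⟨W', h', hxW', hW'⟩ := ht x hx
    refine ⟨W ⊓ W', inf_le_left.trans h, ⟨hxW, hxW'⟩, ?_⟩
    have h1 := map_mem_span 𝒜 a (inf_le_left : W ⊓ W' ≤ W) hW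
    have h2 := map_mem_span 𝒜 a (inf_le_right : W ⊓ W' ≤ W') hW'
    rw [← ConcreteCategory.comp_apply, ← Functor.map_comp] at h1 h2
    rw [map_add]
    exact add_mem h1 h2
  smul_mem' r s hs x hx := by
    obtain ⟨W, h, hxW, hW⟩ := hs x hx
    refine ⟨W, h, hxW, ?_⟩
    rw [Scheme.Modules.map_smul]
    exact Submodule.smul_mem _ _ hW

lemma map_mem_twistSections (a : Λ) {W V : (multiProj 𝒜).Opens} (h : W ≤ V) {s : Γ(ambient 𝒜, V)}
    (hs : s ∈ twistSections 𝒜 a V) :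
    (ambient 𝒜).presheaf.map (homOfLE h).op s ∈ twistSections 𝒜 a W := by
  intro x hx
  obtain ⟨U, hU, hxU, hsU⟩ := hs x (h hx)
  refine ⟨U ⊓ W, inf_le_right, ⟨hxU, hx⟩, ?_⟩
  have := map_mem_span 𝒜 a (inf_le_left : U ⊓ W ≤ U) hsU
  rw [← ConcreteCategory.comp_apply, ← Functor.map_comp] at this ⊢
  exact this

/-- The subpresheaf of modules. -/
def twistPresheaf (a : Λ) : PresheafOfModules.Submodule (ambient 𝒜).val where
  obj V := twistSections 𝒜 a V.unop
  map h _ hs := map_mem_twistSections 𝒜 a h.unop.le hs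

lemma twistPresheaf_isSheaf (a : Λ) :
    TopCat.Presheaf.IsSheaf (X := (multiProj 𝒜).carrier) (twistPresheaf 𝒜 a).toPresheafOfModules.presheaf := by
  rw [TopCat.Presheaf.isSheaf_iff_isSheafUniqueGluing]
  intro I U sf hsf
  have hA := (TopCat.Presheaf.isSheaf_iff_isSheafUniqueGluing _).1 (ambient 𝒜).isSheaf
  obtain ⟨s, hs, huniq⟩ := hA U (fun i ↦ (sf i).1) fun i j ↦ congr_arg Subtype.val (hsf i j)
  have hmem : s ∈ twistSections 𝒜 a (iSup U) := by
    intro x hx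
    obtain ⟨i, hi⟩ := TopologicalSpace.Opens.mem_iSup.1 hx
    obtain ⟨W, hW, hxW, hsW⟩ := (sf i).2 x hi
    refine ⟨W, hW.trans (le_iSup U i), hxW, ?_⟩
    have h1 : (ambient 𝒜).presheaf.map (homOfLE (le_iSup U i)).op s = (sf i).1 := hs i
    have h2 : (ambient 𝒜).presheaf.map (homOfLE hW).op ((sf i).1) =
        (ambient 𝒜).presheaf.map (homOfLE (hW.trans (le_iSup U i))).op s := by
      rw [← h1, ← ConcreteCategory.comp_apply, ← Functor.map_comp]
      rfl
    rw [← h2]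
    exact hsW
  refine ⟨⟨s, hmem⟩, fun i ↦ Subtype.ext (hs i), fun t ht ↦ Subtype.ext ?_⟩
  exact huniq t.1 fun i ↦ congr_arg Subtype.val (ht i)

/-- The sheaf `𝒪(a)` on `Proj R`. Over the chart `Spec R[f⁻¹]₀` its sections are the elements of
degree `a` of `R[f⁻¹]`; it is the `𝒪`-submodule of the push-forward of the structure sheaf of the
relevant locus that is locally generated by the homogeneous fractions of degree `a`. -/
def twist (a : Λ) : (multiProj 𝒜).Modules where
  val := (twistPresheaf 𝒜 a).toPresheafOfModules
  isSheaf := twistPresheaf_isSheaf 𝒜 a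

/-- A homogeneous element of degree `a` as a global section of `𝒪(a)`. -/
def homogeneousSection {a : Λ} (r : R) (hr : r ∈ 𝒜 a) : Γ(twist 𝒜 a, ⊤) :=
  (⟨(toSection 𝒜 ⊤ r : Γ(relevantLocus 𝒜, quot 𝒜 ⁻¹ᵁ ⊤)), fun x hx ↦ ⟨⊤, le_rfl, hx, by
    have h : (ambient 𝒜).presheaf.map (homOfLE (le_refl ⊤)).op
        (toSection 𝒜 ⊤ r : Γ(relevantLocus 𝒜, quot 𝒜 ⁻¹ᵁ ⊤)) = toSection 𝒜 ⊤ r :=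
      map_toSection 𝒜 le_rfl r
    rw [h]
    exact Submodule.subset_span ⟨0, 1, SetLike.GradedOne.one_mem, r, by rwa [zero_add],
      by rw [map_one]; exact isUnit_one, by rw [map_one, one_mul]⟩⟩⟩ : twistSections 𝒜 a ⊤)

instance (f : Relevant 𝒜) : IsOpenImmersion (chart 𝒜 f) :=
  inferInstanceAs (IsOpenImmersion (Limits.colimit.ι (projDiagram 𝒜) f))

/-- The union of the charts `Spec R[f⁻¹]₀` such that every element of `Λ` is the degree of a
homogeneous unit of `R[f⁻¹]`. On this open subset the sheaves `𝒪(a)` are invertible. -/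
def standardLocus : (multiProj 𝒜).Opens :=
  ⨆ f : {f : Relevant 𝒜 // unitDegrees 𝒜 f.elem = ⊤}, (chart 𝒜 f.1).opensRange

end GradedRing

section MultiProjectiveSpace

attribute [local instance] MvPolynomial.weightedGradedAlgebra

variable (A : Type u) [CommRing A] {Λ : Type} [AddCommGroup Λ] [DecidableEq Λ] {p : ℕ}
  (d : Fin p → Λ)

/-- The degrees `d k` of the variables contain a basis of the grading group. -/
def ContainsBasis : Prop :=
  ∃ (κ : Type) (b : Module.Basis κ ℤ Λ), Set.range b ⊆ Set.range d

/-- The multi-Proj of the polynomial ring `A[x₁, …, x_p]` with `x_k` in degree `d k`. It is a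
multi-projective space when the degrees contain a basis of the grading group. -/
def multiProjectiveSpace : Scheme.{u} :=
  multiProj (MvPolynomial.weightedHomogeneousSubmodule A d)

namespace multiProjectiveSpace

/-- The structure morphism to `Spec A`. -/
def toSpec : multiProjectiveSpace A d ⟶ Spec (.of A) :=
  structureMorphism (MvPolynomial.weightedHomogeneousSubmodule A d)

/-- The sheaf `𝒪(a)`. -/
def 𝒪 (a : Λ) : (multiProjectiveSpace A d).Modules :=
  twist (MvPolynomial.weightedHomogeneousSubmodule A d) a

/-- The homogeneous coordinate `x_k`, as a global section of `𝒪(d k)`. -/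
def coordinate (k : Fin p) : Γ(𝒪 A d (d k), ⊤) :=
  homogeneousSection (MvPolynomial.weightedHomogeneousSubmodule A d) (MvPolynomial.X k)
    (MvPolynomial.isWeightedHomogeneous_X A d k)

/-- The standard locus; it is everything when the grading is standard. -/
def standard : (multiProjectiveSpace A d).Opens :=
  standardLocus (MvPolynomial.weightedHomogeneousSubmodule A d)

end multiProjectiveSpace

end MultiProjectiveSpace

end MultiProj

end

/-! Invertible sheaves are handled through local generators (`IsGen`): two sheaves with local
generators over the same cover and with the same transition functions are isomorphic
(`nonempty_iso_of_gens`), and generators are stable under tensor product and pull-back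
(`IsGen.tensorSection`, `IsGen.pullSec`).

For the converse part, let every degree be the degree of a homogeneous unit of `R[f⁻¹]`. Since `Λ`
is free, such units can be chosen multiplicatively in the degree, and dividing by them retracts
`R[f⁻¹]` onto `R[f⁻¹]₀` (`exists_away_retraction`). So the quotient morphism from the relevant locus
has a section over the chart of `f`, and a homogeneous unit of degree `a` generates `𝒪(a)` there
(`isGen_twist`). Products of such units give the tensor product isomorphisms. Since `Λ ≠ 0`, some
homogeneous unit has nonzero degree. At a point over the given one, a monomial of that unit is
invertible, and this monomial contains a variable of nonzero degree, which is invertible too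
(`exists_isUnit_X_of_isUnit`).

For the direct part, `I` can be everything and all `n_i` can be `1`. Trivialise all `L_i` on a
finite affine cover `U_k`. A section of degree `a ∈ ℤ^I` is a family of functions `g_k` on the `U_k`
with `g_l = u_kl(a) g_k`. Since `X` is Noetherian, anything defined on the locus of a section `g`
extends to `X` after multiplication by a power of `g` (`IsHomogeneous.exists_extension`). This has
three uses on an affine locus `V` of a section `g` of degree `b`: - `V` can be shrunk to lie in a
single `U_k`; - for each basis vector `e_i` there is a section of degree `e_i + M_i b` without zeros
on `V`, so that the degrees of the nonvanishing sections generate `ℤ^I`; - finitely many generators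
of `Γ(X, V)` over `A` are fractions of a section by a power of `g`.

Collect these sections for finitely many `V` that cover `X`, and take one variable for each. The
product of the variables that belong to `g` and to the nonvanishing sections defines a standard
chart of `Proj`. Substituting sections for variables gives homomorphisms to the rings `Γ(X, V)`,
which differ on overlaps only by the units `u`, so they glue to a morphism to `Proj`
(`LocalPresentation.exists_hom`). The preimage of the chart is `V`, and `R[f⁻¹]₀ → Γ(X, V)` is onto,
so the morphism is an immersion. The units `u` are also the transition functions of the sheaves
`L_i`, which identifies the pull-backs of the twisting sheaves
(`LocalPresentation.nonempty_pullback_twist_iso`). -/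

noncomputable section

namespace MultiProj

/-! ### Restriction maps and free local generators of a sheaf of modules. -/

section Restriction

variable {X : Scheme.{u}}

/-- The restriction of functions to a smaller open subset. -/
def res {U V : X.Opens} (h : V ≤ U) : Γ(X, U) →+* Γ(X, V) := (X.presheaf.map (homOfLE h).op).hom

/-- The restriction of sections of a sheaf of modules to a smaller open subset. -/
def resM (M : X.Modules) {U V : X.Opens} (h : V ≤ U) : Γ(M, U) →+ Γ(M, V) :=
  (M.presheaf.map (homOfLE h).op).hom

@[simp]
lemma res_res {U V W : X.Opens} (h : V ≤ U) (h' : W ≤ V) (r : Γ(X, U)) :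
    res h' (res h r) = res (h'.trans h) r := by
  simp only [res, ← CommRingCat.comp_apply, ← Functor.map_comp]
  rfl

@[simp]
lemma res_refl {U : X.Opens} (h : U ≤ U) (r : Γ(X, U)) : res h r = r := by
  simp [res]

variable (M : X.Modules)

@[simp]
lemma resM_resM {U V W : X.Opens} (h : V ≤ U) (h' : W ≤ V) (m : Γ(M, U)) :
    resM M h' (resM M h m) = resM M (h'.trans h) m := by
  simp only [resM, ← ConcreteCategory.comp_apply, ← Functor.map_comp]
  rfl

@[simp]
lemma resM_refl {U : X.Opens} (h : U ≤ U) (m : Γ(M, U)) : resM M h m = m := by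
  simp [resM]

@[simp]
lemma resM_smul {U V : X.Opens} (h : V ≤ U) (r : Γ(X, U)) (m : Γ(M, U)) :
    resM M h (r • m) = res h r • resM M h m :=
  Scheme.Modules.map_smul M (homOfLE h) r m

lemma resM_ext {V : X.Opens} {s t : Γ(M, V)}
    (H : ∀ x ∈ V, ∃ (W : X.Opens) (h : W ≤ V), x ∈ W ∧ resM M h s = resM M h t) : s = t := by
  choose W hW hx e using H
  refine TopCat.Sheaf.eq_of_locally_eq' (X := X.carrier) ⟨M.presheaf, M.isSheaf⟩
    (fun x : V ↦ W x.1 x.2) V (fun x ↦ homOfLE (hW x.1 x.2)) ?_ s t fun x ↦ e x.1 x.2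
  exact fun x hxV ↦ TopologicalSpace.Opens.mem_iSup.2 ⟨⟨x, hxV⟩, hx x hxV⟩

lemma res_ext {V : X.Opens} {s t : Γ(X, V)}
    (H : ∀ x ∈ V, ∃ (W : X.Opens) (h : W ≤ V), x ∈ W ∧ res h s = res h t) : s = t := by
  choose W hW hx e using H
  refine TopCat.Sheaf.eq_of_locally_eq' X.sheaf
    (fun x : V ↦ W x.1 x.2) V (fun x ↦ homOfLE (hW x.1 x.2)) ?_ s t fun x ↦ e x.1 x.2
  exact fun x hxV ↦ TopologicalSpace.Opens.mem_iSup.2 ⟨⟨x, hxV⟩, hx x hxV⟩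

lemma exists_glue_res {ι : Type*} (U : ι → X.Opens) {V : X.Opens} (hU : ∀ i, U i ≤ V)
    (hV : V ≤ iSup U) (s : ∀ i, Γ(X, U i))
    (H : ∀ i j, res (inf_le_left : U i ⊓ U j ≤ U i) (s i) = res inf_le_right (s j)) :
    ∃ t : Γ(X, V), ∀ i, res (hU i) t = s i := by
  obtain ⟨t, ht, -⟩ := TopCat.Sheaf.existsUnique_gluing' X.sheaf U V (fun i ↦ homOfLE (hU i)) hV s
    fun i j ↦ H i j
  exact ⟨t, ht⟩

lemma exists_glue_resM {ι : Type*} (U : ι → X.Opens) {V : X.Opens} (hU : ∀ i, U i ≤ V)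
    (hV : V ≤ iSup U) (s : ∀ i, Γ(M, U i))
    (H : ∀ i j, resM M (inf_le_left : U i ⊓ U j ≤ U i) (s i) = resM M inf_le_right (s j)) :
    ∃ t : Γ(M, V), ∀ i, resM M (hU i) t = s i := by
  obtain ⟨t, ht, -⟩ := TopCat.Sheaf.existsUnique_gluing' (X := X.carrier) ⟨M.presheaf, M.isSheaf⟩
    U V (fun i ↦ homOfLE (hU i)) hV s fun i j ↦ H i j
  exact ⟨t, ht⟩

/-- The section `m` generates `M` freely over `U`. -/
def IsGen {U : X.Opens} (m : Γ(M, U)) : Prop :=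
  ∀ (V : X.Opens) (h : V ≤ U), Function.Bijective fun r : Γ(X, V) ↦ r • resM M h m

variable {M}

lemma IsGen.resM {U V : X.Opens} {m : Γ(M, U)} (hm : IsGen M m) (h : V ≤ U) :
    IsGen M (resM M h m) := fun W hW ↦ by
  simpa using hm W (hW.trans h)

lemma IsGen.cancel {U V : X.Opens} {m : Γ(M, U)} (hm : IsGen M m) (h : V ≤ U) {r s : Γ(X, V)}
    (e : r • MultiProj.resM M h m = s • MultiProj.resM M h m) : r = s := (hm V h).1 e

lemma IsGen.exists_smul {U V : X.Opens} {m : Γ(M, U)} (hm : IsGen M m) (h : V ≤ U)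
    (t : Γ(M, V)) : ∃ r : Γ(X, V), t = r • MultiProj.resM M h m :=
  let ⟨r, hr⟩ := (hm V h).2 t
  ⟨r, hr.symm⟩

lemma IsGen.smul {U : X.Opens} {m : Γ(M, U)} (hm : IsGen M m) {r : Γ(X, U)} (hr : IsUnit r) :
    IsGen M (r • m) := fun V hV ↦ by
  have h1 := hm V hV
  have h2 : IsUnit (res hV r) := hr.map _
  simp only [resM_smul, smul_smul]
  exact h1.comp ((IsUnit.isUnit_iff_mulRight_bijective).1 h2)

/-- Coefficients that exist only locally agree on overlaps, because they are unique on every open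
subset, and so they glue. The criterion suits modules whose sections are known only locally, such as
sheafifications and `𝒪(a)`. -/
lemma isGen_of_local {U : X.Opens} {m : Γ(M, U)}
    (h1 : ∀ (V : X.Opens) (h : V ≤ U) (r : Γ(X, V)), r • resM M h m = 0 → r = 0)
    (h2 : ∀ (V : X.Opens) (h : V ≤ U) (t : Γ(M, V)), ∀ x ∈ V, ∃ (W : X.Opens) (hW : W ≤ V),
      x ∈ W ∧ ∃ r : Γ(X, W), resM M hW t = r • resM M (hW.trans h) m) : IsGen M m := by
  intro V hV
  have inj : ∀ (V : X.Opens) (h : V ≤ U) (r s : Γ(X, V)),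
      r • resM M h m = s • resM M h m → r = s := fun V h r s e ↦
    sub_eq_zero.1 (h1 V h _ (by rw [sub_smul, e, sub_self]))
  refine ⟨fun r s e ↦ inj V hV r s e, fun t ↦ ?_⟩
  choose W hW hx r hr using h2 V hV t
  obtain ⟨s, hs⟩ := exists_glue_res (fun x : V ↦ W x.1 x.2) (fun x ↦ hW x.1 x.2)
    (fun x hxV ↦ TopologicalSpace.Opens.mem_iSup.2 ⟨⟨x, hxV⟩, hx x hxV⟩) (fun x ↦ r x.1 x.2)
    fun x y ↦ by
      refine inj _ (inf_le_left.trans ((hW x.1 x.2).trans hV)) _ _ ?_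
      have e1 := congr(resM M (inf_le_left : W x.1 x.2 ⊓ W y.1 y.2 ≤ _) $(hr x.1 x.2))
      have e2 := congr(resM M (inf_le_right : W x.1 x.2 ⊓ W y.1 y.2 ≤ _) $(hr y.1 y.2))
      simp only [resM_smul, resM_resM] at e1 e2
      rw [← e1, ← e2]
  refine ⟨s, resM_ext M fun x hxV ↦ ⟨W x hxV, hW x hxV, hx x hxV, ?_⟩⟩
  simp only [resM_smul, resM_resM]
  rw [hs ⟨x, hxV⟩, hr x hxV]

lemma IsGen.isUnit_of_smul {U : X.Opens} {m : Γ(M, U)} (hm : IsGen M m) {r : Γ(X, U)}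
    (h : IsGen M (r • m)) : IsUnit r := by
  obtain ⟨s, hs⟩ := h.exists_smul le_rfl m
  simp only [resM_refl, smul_smul] at hs
  refine isUnit_iff_exists_inv'.2 ⟨s, hm.cancel le_rfl ?_⟩
  simp [← hs]

lemma mem_nonvanishingLocus {g : Γ(M, ⊤)} {x : X} : x ∈ nonvanishingLocus M g ↔
    ∃ U : X.Opens, x ∈ U ∧ IsGen M (resM M (le_top : U ≤ ⊤) g) := by
  refine exists_congr fun U ↦ and_congr_right fun _ ↦ forall₂_congr fun V hV ↦ ?_
  rw [resM_resM]
  rfl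

/-- Near a point where `g` generates, `r` is the ratio of two generators and hence a unit;
conversely `r` is a unit on its basic open set, so that `g` generates there. -/
lemma mem_nonvanishingLocus_iff {U : X.Opens} {m : Γ(M, U)} (hm : IsGen M m) {g : Γ(M, ⊤)}
    {r : Γ(X, U)} (e : resM M le_top g = r • m) {x : X} (hx : x ∈ U) :
    x ∈ nonvanishingLocus M g ↔ x ∈ X.basicOpen r := by
  rw [mem_nonvanishingLocus]
  constructor
  · rintro ⟨V, hxV, hV⟩
    have h1 := hV.resM (inf_le_left : V ⊓ U ≤ V)
    have h2 := congr(resM M (inf_le_right : V ⊓ U ≤ U) $e)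
    simp only [resM_resM, resM_smul] at h1 h2
    rw [h2] at h1
    have h3 := (hm.resM _).isUnit_of_smul h1
    rw [Scheme.mem_basicOpen _ _ _ hx]
    have h4 := h3.map (X.presheaf.germ (V ⊓ U) x ⟨hxV, hx⟩).hom
    rwa [show (X.presheaf.germ (V ⊓ U) x ⟨hxV, hx⟩).hom (res inf_le_right r) =
      X.presheaf.germ U x hx r from X.presheaf.germ_res_apply _ _ _ _] at h4
  · intro h
    refine ⟨X.basicOpen r, h, ?_⟩
    have h2 := congr(resM M (X.basicOpen_le r) $e)
    simp only [resM_resM, resM_smul] at h2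
    rw [h2]
    exact (hm.resM _).smul (RingedSpace.isUnit_res_basicOpen _ r)

end Restriction

/-! ### Isomorphisms from equal transition functions. -/

section Gluing

variable {X : Scheme.{u}} {M N : X.Modules} {ι : Type*} {U : ι → X.Opens}

/-- The sections `s` and `t` have the same coordinates with respect to the local generators `m`
and `n`. -/
def SameCoords (m : ∀ i, Γ(M, U i)) (n : ∀ i, Γ(N, U i)) {V : X.Opens} (s : Γ(M, V))
    (t : Γ(N, V)) : Prop :=
  ∀ i, ∃ r : Γ(X, V ⊓ U i), resM M inf_le_left s = r • resM M inf_le_right (m i) ∧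
    resM N inf_le_left t = r • resM N inf_le_right (n i)

variable {m : ∀ i, Γ(M, U i)} {n : ∀ i, Γ(N, U i)}

lemma SameCoords.unique (hU : ∀ x, ∃ i, x ∈ U i) (hm : ∀ i, IsGen M (m i)) {V : X.Opens}
    {s : Γ(M, V)} {t t' : Γ(N, V)}
    (h : SameCoords m n s t) (h' : SameCoords m n s t') : t = t' := by
  refine resM_ext N fun x hx ↦ ?_
  obtain ⟨i, hi⟩ := hU x
  obtain ⟨r, h1, h2⟩ := h i
  obtain ⟨r', h3, h4⟩ := h' i
  refine ⟨V ⊓ U i, inf_le_left, ⟨hx, hi⟩, ?_⟩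
  rw [h2, h4, (hm i).cancel inf_le_right (h1.symm.trans h3)]

/-- The coordinates of `s` change by the transition functions of `m`. As `n` has the same ones, the
local sections with these coordinates agree on overlaps. -/
lemma SameCoords.exists (hU : ∀ x, ∃ i, x ∈ U i) (hm : ∀ i, IsGen M (m i))
    (hmn : ∀ i j, ∃ r : Γ(X, U i ⊓ U j),
      resM M inf_le_left (m i) = r • resM M inf_le_right (m j) ∧
      resM N inf_le_left (n i) = r • resM N inf_le_right (n j)) {V : X.Opens}
    (s : Γ(M, V)) : ∃ t : Γ(N, V), SameCoords m n s t := by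
  choose r hr using fun i ↦ (hm i).exists_smul (inf_le_right : V ⊓ U i ≤ U i) (resM M inf_le_left s)
  obtain ⟨t, ht⟩ := exists_glue_resM N (fun i ↦ V ⊓ U i) (V := V) (fun i ↦ inf_le_left)
    (fun x hx ↦ by
      obtain ⟨i, hi⟩ := hU x
      exact TopologicalSpace.Opens.mem_iSup.2 ⟨i, hx, hi⟩)
    (fun i ↦ r i • resM N inf_le_right (n i)) fun i j ↦ by
      obtain ⟨u, h1, h2⟩ := hmn i j
      have hle : V ⊓ U i ⊓ (V ⊓ U j) ≤ U i ⊓ U j := inf_le_inf inf_le_right inf_le_right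
      replace h1 := congr(resM M hle $h1)
      replace h2 := congr(resM N hle $h2)
      have e1 := congr(resM M (inf_le_left : V ⊓ U i ⊓ (V ⊓ U j) ≤ _) $(hr i))
      have e2 := congr(resM M (inf_le_right : V ⊓ U i ⊓ (V ⊓ U j) ≤ _) $(hr j))
      simp only [resM_smul, resM_resM] at h1 h2 e1 e2 ⊢
      rw [h1, smul_smul, e2] at e1
      rw [h2, smul_smul, (hm j).cancel _ e1]
  exact ⟨t, fun i ↦ ⟨r i, hr i, ht i⟩⟩

lemma SameCoords.symm {V : X.Opens} {s : Γ(M, V)} {t : Γ(N, V)} (h : SameCoords m n s t) :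
    SameCoords n m t s := fun i ↦ let ⟨r, h1, h2⟩ := h i; ⟨r, h2, h1⟩

lemma SameCoords.add {V : X.Opens} {s s' : Γ(M, V)} {t t' : Γ(N, V)} (h : SameCoords m n s t)
    (h' : SameCoords m n s' t') : SameCoords m n (s + s') (t + t') := fun i ↦ by
  obtain ⟨r, h1, h2⟩ := h i
  obtain ⟨r', h1', h2'⟩ := h' i
  exact ⟨r + r', by rw [map_add, add_smul, h1, h1'], by rw [map_add, add_smul, h2, h2']⟩

lemma SameCoords.smul {V : X.Opens} {s : Γ(M, V)} {t : Γ(N, V)} (h : SameCoords m n s t)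
    (c : Γ(X, V)) : SameCoords m n (c • s) (c • t) := fun i ↦ by
  obtain ⟨r, h1, h2⟩ := h i
  exact ⟨res inf_le_left c * r, by rw [resM_smul, h1, smul_smul],
    by rw [resM_smul, h2, smul_smul]⟩

lemma SameCoords.resM {V W : X.Opens} {s : Γ(M, V)} {t : Γ(N, V)} (h : SameCoords m n s t)
    (hW : W ≤ V) : SameCoords m n (resM M hW s) (resM N hW t) := fun i ↦ by
  obtain ⟨r, h1, h2⟩ := h i
  have hle : W ⊓ U i ≤ V ⊓ U i := inf_le_inf_right _ hW
  replace h1 := congr(MultiProj.resM M hle $h1)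
  replace h2 := congr(MultiProj.resM N hle $h2)
  simp only [resM_resM, resM_smul] at h1 h2 ⊢
  exact ⟨_, h1, h2⟩

/-- A morphism of sheaves of modules from linear maps on sections. -/
def homMk (f : ∀ V : X.Opens, Γ(M, V) → Γ(N, V))
    (add : ∀ V s t, f V (s + t) = f V s + f V t)
    (smul : ∀ V (r : Γ(X, V)) s, f V (r • s) = r • f V s)
    (nat : ∀ (V W : X.Opens) (h : W ≤ V) s, f W (resM M h s) = resM N h (f V s)) : M ⟶ N :=
  SheafOfModules.Hom.mk (PresheafOfModules.homMk
    { app V := AddCommGrpCat.ofHom (AddMonoidHom.mk' (f V.unop) (add V.unop))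
      naturality V W h := by
        ext s
        exact nat V.unop W.unop h.unop.le s }
    fun V r s ↦ smul V.unop r s)

/-- Sheaves of modules with local generators that have the same transition functions are
isomorphic. -/
lemma nonempty_iso_of_gens (hU : ∀ x, ∃ i, x ∈ U i) (hm : ∀ i, IsGen M (m i))
    (hn : ∀ i, IsGen N (n i))
    (hmn : ∀ i j, ∃ r : Γ(X, U i ⊓ U j),
      resM M inf_le_left (m i) = r • resM M inf_le_right (m j) ∧
      resM N inf_le_left (n i) = r • resM N inf_le_right (n j)) : Nonempty (M ≅ N) := by
  choose f hf using fun V : X.Opens ↦ fun s : Γ(M, V) ↦ SameCoords.exists hU hm hmn s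
  choose g hg using fun V : X.Opens ↦ fun s : Γ(N, V) ↦ SameCoords.exists (M := N) (N := M)
    (m := n) (n := m) hU hn (fun i j ↦ let ⟨r, h⟩ := hmn i j; ⟨r, h.symm⟩) s
  have uf : ∀ {V : X.Opens} {s : Γ(M, V)} {t t' : Γ(N, V)}, SameCoords m n s t →
    SameCoords m n s t' → t = t' := SameCoords.unique hU hm
  have ug : ∀ {V : X.Opens} {s : Γ(N, V)} {t t' : Γ(M, V)}, SameCoords n m s t →
    SameCoords n m s t' → t = t' := SameCoords.unique hU hn
  refine ⟨⟨homMk f (fun V s t ↦ uf (hf V _) ((hf V s).add (hf V t)))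
    (fun V r s ↦ uf (hf V _) ((hf V s).smul r)) (fun V W h s ↦ uf (hf W _) ((hf V s).resM h)),
    homMk g (fun V s t ↦ ug (hg V _) ((hg V s).add (hg V t)))
    (fun V r s ↦ ug (hg V _) ((hg V s).smul r)) (fun V W h s ↦ ug (hg W _) ((hg V s).resM h)),
    ?_, ?_⟩⟩
  · ext V s
    exact ug (hg V (f V s)) (hf V s).symm
  · ext V s
    exact uf (hf V (g V s)) (hg V s).symm

end Gluing

/-! ### Invertible sheaves in terms of local generators. -/

section Invertible

variable {X : Scheme.{u}}

lemma isGen_one : IsGen (structureModule X) (U := ⊤) (1 : Γ(X, ⊤)) := fun V hV ↦ by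
  have : (fun r : Γ(X, V) ↦ r • resM (structureModule X) hV (1 : Γ(X, ⊤))) = id := by
    funext r
    change r * res hV 1 = r
    rw [map_one, mul_one]
  rw [this]
  exact Function.bijective_id

lemma nonempty_iso_unit_of_isGen {L : X.Modules} {m : Γ(L, ⊤)} (hm : IsGen L m) :
    Nonempty (L ≅ SheafOfModules.unit X.ringCatSheaf) :=
  nonempty_iso_of_gens (N := structureModule X) (ι := Unit) (U := fun _ ↦ ⊤) (m := fun _ ↦ m)
    (n := fun _ ↦ (1 : Γ(X, ⊤))) (fun _ ↦ ⟨(), trivial⟩) (fun _ ↦ hm) (fun _ ↦ isGen_one)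
    fun _ _ ↦ ⟨1, by simp, by simp⟩

lemma isGen_of_iso {M N : X.Modules} (e : M ≅ N) {U : X.Opens} {m : Γ(M, U)} (hm : IsGen M m) :
    IsGen N (e.hom.app U m) := fun V hV ↦ by
  have h : (fun r : Γ(X, V) ↦ r • resM N hV (e.hom.app U m)) =
      e.hom.app V ∘ fun r ↦ r • resM M hV m := by
    funext r
    have : resM N hV (e.hom.app U m) = e.hom.app V (resM M hV m) :=
      (ConcreteCategory.congr_hom (e.hom.mapPresheaf.naturality (homOfLE hV).op) m).symm
    rw [Function.comp_apply, Scheme.Modules.Hom.app_smul, this]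
  rw [h]
  exact (ConcreteCategory.bijective_of_isIso (e.hom.app V)).comp (hm V hV)

lemma isGen_restrict {L : X.Modules} {Y : Scheme.{u}} (f : Y ⟶ X) [IsOpenImmersion f] {W : Y.Opens}
    (m : Γ(L.restrict f, W)) :
    IsGen (L.restrict f) m ↔ IsGen L (U := f ''ᵁ W) m := by
  constructor
  · intro h V hV
    obtain ⟨V, rfl⟩ : ∃ V', f ''ᵁ V' = V := ⟨f ⁻¹ᵁ V, by
      rw [f.image_preimage_eq_opensRange_inf]
      exact inf_eq_right.2 (hV.trans (f.image_le_opensRange _))⟩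
    have hV' : V ≤ W := (f.image_le_image_iff ..).1 hV
    have h1 := h V hV'
    have : (fun r : Γ(X, f ''ᵁ V) ↦ r • resM L hV m) =
        (fun r : Γ(Y, V) ↦ r • resM (L.restrict f) hV' m) ∘ (f.appIso V).hom := by
      funext r
      have : ((f.appIso V).inv ((f.appIso V).hom r)) = r := by simp
      conv_lhs => rw [← this]
      rfl
    rw [this]
    exact h1.comp (ConcreteCategory.bijective_of_isIso (f.appIso V).hom)
  · intro h V hV
    have h1 := h (f ''ᵁ V) (f.image_mono hV)
    exact h1.comp (ConcreteCategory.bijective_of_isIso (f.appIso V).inv)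

/-- A trivialisation over `U` carries the section `1` to a generator, and a generator is the image
of `1` under a trivialisation. -/
lemma isInvertibleSheaf_iff {L : X.Modules} : IsInvertibleSheaf L ↔
    ∀ x : X, ∃ U : X.Opens, x ∈ U ∧ ∃ m : Γ(L, U), IsGen L m := by
  refine forall_congr' fun x ↦ ⟨?_, ?_⟩
  · rintro ⟨U, hx, ⟨e⟩⟩
    have h1 := (isGen_restrict _ _).1 (isGen_of_iso e.symm isGen_one)
    exact ⟨_, by simpa using hx, _, h1⟩
  · rintro ⟨U, hx, m, hm⟩
    refine ⟨U, hx, ?_⟩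
    have hU : U.ι ''ᵁ ⊤ ≤ U := by simp
    exact nonempty_iso_unit_of_isGen ((isGen_restrict U.ι _).2 (hm.resM hU))

end Invertible

/-! ### Generators of tensor products and tensor powers. -/

section Tensor

open TensorProduct

variable {X : Scheme.{u}} (M N : X.Modules)

/-- The presheaf `U ↦ M(U) ⊗ N(U)`. -/
def tensorPresheaf : PresheafOfModules.{u} X.ringCatSheaf.obj :=
  MonoidalCategoryStruct.tensorObj
    (C := PresheafOfModules.{u} (X.presheaf ⋙ forget₂ CommRingCat RingCat)) M.val N.val

/-- The underlying map of presheaves of the sheafification. -/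
abbrev tensorToSheafify : (tensorPresheaf M N).presheaf ⟶
    CategoryTheory.sheafify (Opens.grothendieckTopology X) (tensorPresheaf M N).presheaf :=
  CategoryTheory.toSheafify (Opens.grothendieckTopology X) (tensorPresheaf M N).presheaf

/-- The canonical map from the presheaf tensor product to the tensor product. -/
def toTensor (U : X.Opens) : Γ(M, U) ⊗[Γ(X, U)] Γ(N, U) →ₗ[Γ(X, U)] Γ(tensorModules M N, U) :=
  ((PresheafOfModules.toSheafify (𝟙 X.ringCatSheaf.obj) (tensorToSheafify M N)).app (.op U)).hom

/-- The restriction map of the presheaf tensor product. -/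
def tensorRes {U V : X.Opens} (h : V ≤ U) :
    Γ(M, U) ⊗[Γ(X, U)] Γ(N, U) →+ Γ(M, V) ⊗[Γ(X, V)] Γ(N, V) :=
  ((tensorPresheaf M N).presheaf.map (homOfLE h).op).hom

variable {M N}

lemma tensorRes_tmul {U V : X.Opens} (h : V ≤ U) (m : Γ(M, U)) (n : Γ(N, U)) :
    tensorRes M N h (m ⊗ₜ n) = resM M h m ⊗ₜ resM N h n := rfl

lemma resM_toTensor {U V : X.Opens} (h : V ≤ U) (t : Γ(M, U) ⊗[Γ(X, U)] Γ(N, U)) :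
    resM (tensorModules M N) h (toTensor M N U t) = toTensor M N V (tensorRes M N h t) :=
  (ConcreteCategory.congr_hom ((tensorToSheafify M N).naturality (homOfLE h).op) t).symm

/-- Sheafification kills only what is locally zero. Together with local surjectivity and naturality
this is all that is used about sections of the tensor product. -/
lemma toTensor_locally_injective {U : X.Opens} {t : Γ(M, U) ⊗[Γ(X, U)] Γ(N, U)}
    (ht : toTensor M N U t = 0) : ∀ x ∈ U, ∃ (W : X.Opens) (h : W ≤ U), x ∈ W ∧
      tensorRes M N h t = 0 := by
  intro x hx
  have h0 : (tensorToSheafify M N).app (.op U) t = (tensorToSheafify M N).app (.op U) 0 :=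
    Eq.trans ht (map_zero (toTensor M N U)).symm
  obtain ⟨W, f, hf, hxW⟩ := Presheaf.equalizerSieve_mem (Opens.grothendieckTopology X)
    (tensorToSheafify M N) (X := .op U) t 0 h0 x hx
  exact ⟨W, f.le, hxW, Eq.trans hf (map_zero (tensorRes M N f.le))⟩

lemma toTensor_locally_surjective {U : X.Opens} (s : Γ(tensorModules M N, U)) :
    ∀ x ∈ U, ∃ (W : X.Opens) (h : W ≤ U), x ∈ W ∧ ∃ t,
      resM (tensorModules M N) h s = toTensor M N W t := by
  intro x hx
  obtain ⟨W, f, ⟨t, ht⟩, hxW⟩ := Presheaf.imageSieve_mem (Opens.grothendieckTopology X)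
    (tensorToSheafify M N) (U := .op U) s x hx
  exact ⟨W, f.le, hxW, t, ht.symm⟩

/-- The tensor product of two sections. -/
def tensorSection {U : X.Opens} (m : Γ(M, U)) (n : Γ(N, U)) : Γ(tensorModules M N, U) :=
  toTensor M N U (m ⊗ₜ n)

lemma resM_tensorSection {U V : X.Opens} (h : V ≤ U) (m : Γ(M, U)) (n : Γ(N, U)) :
    resM _ h (tensorSection m n) = tensorSection (resM M h m) (resM N h n) := by
  rw [tensorSection, resM_toTensor, tensorRes_tmul, tensorSection]

lemma tensorSection_smul_smul {U : X.Opens} (r s : Γ(X, U)) (m : Γ(M, U)) (n : Γ(N, U)) :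
    tensorSection (r • m) (s • n) = (r * s) • tensorSection m n := by
  rw [tensorSection, TensorProduct.smul_tmul_smul, map_smul, tensorSection]

lemma bijective_smul_tmul {R P Q : Type*} [CommRing R] [AddCommGroup P] [Module R P]
    [AddCommGroup Q] [Module R Q] {p : P} {q : Q} (hp : Function.Bijective fun r : R ↦ r • p)
    (hq : Function.Bijective fun r : R ↦ r • q) :
    Function.Bijective fun r : R ↦ r • (p ⊗ₜ[R] q) := by
  let e := LinearEquiv.ofBijective (LinearMap.toSpanSingleton R P p) hp
  let e' := LinearEquiv.ofBijective (LinearMap.toSpanSingleton R Q q) hq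
  convert ((TensorProduct.lid R R).symm ≪≫ₗ TensorProduct.congr e e').bijective using 1
  funext r
  have h1 : e 1 = p := one_smul R p
  have h2 : e' r = r • q := rfl
  simp [h1, h2]

/-- Over each small open set the presheaf tensor product is free on `m ⊗ n`, and its sheafification
is locally the same, so `isGen_of_local` applies. -/
lemma IsGen.tensorSection {U : X.Opens} {m : Γ(M, U)} {n : Γ(N, U)} (hm : IsGen M m)
    (hn : IsGen N n) : IsGen _ (tensorSection m n) := by
  refine isGen_of_local (fun V hV r hr ↦ ?_) (fun V hV t x hx ↦ ?_)
  · refine res_ext fun x hx ↦ ?_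
    rw [resM_tensorSection, MultiProj.tensorSection, ← map_smul] at hr
    obtain ⟨W, hW, hxW, e⟩ := toTensor_locally_injective hr x hx
    refine ⟨W, hW, hxW, (bijective_smul_tmul (hm W (hW.trans hV)) (hn W (hW.trans hV))).1 ?_⟩
    rw [TensorProduct.smul_tmul', tensorRes_tmul, resM_smul, ← TensorProduct.smul_tmul', resM_resM,
      resM_resM] at e
    simpa using e
  · obtain ⟨W, hW, hxW, t', ht'⟩ := toTensor_locally_surjective t x hx
    obtain ⟨r, rfl⟩ := (bijective_smul_tmul (hm W (hW.trans hV)) (hn W (hW.trans hV))).2 t'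
    refine ⟨W, hW, hxW, r, ?_⟩
    rw [ht', resM_tensorSection, map_smul, MultiProj.tensorSection]

variable {L : X.Modules}

/-- The powers of a section. -/
def sectionPow {U : X.Opens} (m : Γ(L, U)) : ∀ n : ℕ, Γ(tensorPower L n, U)
  | 0 => (1 : Γ(X, U))
  | n + 1 => MultiProj.tensorSection (sectionPow m n) m

lemma resM_sectionPow {U V : X.Opens} (h : V ≤ U) (m : Γ(L, U)) (n : ℕ) :
    resM _ h (sectionPow m n) = sectionPow (resM L h m) n := by
  induction n with
  | zero => exact map_one (res h)
  | succ n ih => exact (resM_tensorSection h _ _).trans (by rw [ih]; rfl)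

lemma sectionPow_smul {U : X.Opens} (r : Γ(X, U)) (m : Γ(L, U)) (n : ℕ) :
    sectionPow (r • m) n = r ^ n • sectionPow m n := by
  induction n with
  | zero => rw [pow_zero, one_smul]; rfl
  | succ n ih =>
    rw [sectionPow, ih, tensorSection_smul_smul, ← pow_succ]
    rfl

lemma IsGen.sectionPow {U : X.Opens} {m : Γ(L, U)} (hm : IsGen L m) (n : ℕ) :
    IsGen _ (sectionPow m n) := by
  induction n with
  | zero =>
    have h := IsGen.resM (isGen_one (X := X)) (le_top : U ≤ ⊤)
    have e : MultiProj.resM (structureModule X) (le_top : U ≤ ⊤) (1 : Γ(X, ⊤)) = (1 : Γ(X, U)) :=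
      map_one (res le_top)
    rw [e] at h
    exact h
  | succ n ih => exact ih.tensorSection hm

end Tensor

/-! ### Generators of pull-backs. -/

section Pullback

variable {X Y : Scheme.{u}} (φ : X ⟶ Y)

/-- The pull-back of a section. -/
def pullSec {M : Y.Modules} {W : Y.Opens} (m : Γ(M, W)) :
    Γ((Scheme.Modules.pullback φ).obj M, φ ⁻¹ᵁ W) :=
  ((Scheme.Modules.pullbackPushforwardAdjunction φ).unit.app M).app W m

lemma resM_pullSec {M : Y.Modules} {V W : Y.Opens} (h : V ≤ W) (m : Γ(M, W)) :
    resM _ (φ.preimage_mono h) (pullSec φ m) = pullSec φ (resM M h m) :=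
  (ConcreteCategory.congr_hom (((Scheme.Modules.pullbackPushforwardAdjunction φ).unit.app
    M).mapPresheaf.naturality (homOfLE h).op) m).symm

lemma pullSec_smul {M : Y.Modules} {W : Y.Opens} (r : Γ(Y, W)) (m : Γ(M, W)) :
    pullSec φ (r • m) = φ.app W r • pullSec φ m :=
  Scheme.Modules.Hom.app_smul ((Scheme.Modules.pullbackPushforwardAdjunction φ).unit.app M) r m

lemma pullSec_map {M N : Y.Modules} (e : M ⟶ N) {W : Y.Opens} (m : Γ(M, W)) :
    pullSec φ (e.app W m) = ((Scheme.Modules.pullback φ).map e).app (φ ⁻¹ᵁ W) (pullSec φ m) :=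
  congr(Scheme.Modules.Hom.app $((Scheme.Modules.pullbackPushforwardAdjunction φ).unit.naturality e)
    W m)

/-- The morphism given by a global section. -/
def homOfSection {M : Y.Modules} (m : Γ(M, ⊤)) : structureModule Y ⟶ M :=
  homMk (fun V (r : Γ(Y, V)) ↦ r • resM M le_top m) (fun V s t ↦ add_smul _ _ _)
    (fun V r s ↦ mul_smul _ _ _) (fun V W h (s : Γ(Y, V)) ↦ by
      rw [resM_smul, resM_resM]
      rfl)

lemma isIso_homOfSection {M : Y.Modules} {m : Γ(M, ⊤)} (hm : IsGen M m) :
    IsIso (homOfSection m) := by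
  rw [Scheme.Modules.Hom.isIso_iff_isIso_app]
  intro V
  rw [ConcreteCategory.isIso_iff_bijective]
  exact hm V le_top

/-- The unit section of the structure sheaf. -/
def oneSection (Y : Scheme.{u}) : Γ(structureModule Y, ⊤) := (1 : Γ(Y, ⊤))

instance : (SheafOfModules.pushforward.{u} φ.toRingCatSheafHom).IsRightAdjoint :=
  inferInstanceAs (Scheme.Modules.pushforward φ).IsRightAdjoint

/-- Every open subset of `X` lies in the preimage of `⊤`. Finality is what makes the pull-back of
the structure sheaf the structure sheaf. -/
instance : (TopologicalSpace.Opens.map φ.base).Final :=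
  Functor.final_of_exists_of_isFiltered _ (fun _ ↦ ⟨⊤, ⟨homOfLE le_top⟩⟩) fun _ _ ↦ ⟨_, 𝟙 _, rfl⟩

lemma isGen_pullSec_one : IsGen _ (pullSec φ (oneSection Y)) := by
  let p : (Scheme.Modules.pullback φ).obj (structureModule Y) ⟶ structureModule X :=
    SheafOfModules.pullbackObjUnitToUnit φ.toRingCatSheafHom
  have : IsIso p := SheafOfModules.instIsIsoPullbackObjUnitToUnitOfFinal φ.toRingCatSheafHom
  have h := SheafOfModules.pullbackPushforwardAdjunction_homEquiv_pullbackObjUnitToUnit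
    φ.toRingCatSheafHom
  have h2 : p.app ⊤ (pullSec φ (oneSection Y)) = oneSection X := by
    rw [Adjunction.homEquiv_unit] at h
    have h3 := congr(Scheme.Modules.Hom.app (M := structureModule Y) $h ⊤ (oneSection Y))
    exact h3.trans (map_one (φ.app ⊤).hom)
  have h4 := isGen_of_iso (asIso p).symm (isGen_one (X := X))
  have h5 : (asIso p).symm.hom.app ⊤ (oneSection X) = pullSec φ (oneSection Y) := by
    rw [← h2]
    exact congr(Scheme.Modules.Hom.app $(IsIso.hom_inv_id p) ⊤ (pullSec φ (oneSection Y)))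
  exact h5 ▸ h4

/-- A global generator is an isomorphism from the structure sheaf, which reduces the claim to the
section `1`. -/
lemma isGen_pullSec_top {M : Y.Modules} {m : Γ(M, ⊤)} (hm : IsGen M m) :
    IsGen _ (pullSec φ m) := by
  have := isIso_homOfSection hm
  have h : (homOfSection m).app ⊤ (oneSection Y) = m := by
    change (1 : Γ(Y, ⊤)) • resM M le_top m = m
    simp
  rw [← h, pullSec_map]
  exact isGen_of_iso (asIso ((Scheme.Modules.pullback φ).map (homOfSection m)))
    (isGen_pullSec_one φ)

variable (W : Y.Opens)

/-- The pull-back commutes with the restriction to an open subset. -/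
def pullbackRestrictIso : Scheme.Modules.restrictFunctor W.ι ⋙ Scheme.Modules.pullback (φ ∣_ W) ≅
    Scheme.Modules.pullback φ ⋙ Scheme.Modules.restrictFunctor (φ ⁻¹ᵁ W).ι :=
  -- Both functors are left adjoint to the push-forward along one side of the square `(φ ∣_ W) ≫ W.ι
  -- = (φ ⁻¹ᵁ W).ι ≫ φ`.
  (conjugateIsoEquiv ((Scheme.Modules.pullbackPushforwardAdjunction φ).comp
      (Scheme.Modules.restrictAdjunction (φ ⁻¹ᵁ W).ι))
    ((Scheme.Modules.restrictAdjunction W.ι).comp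
      (Scheme.Modules.pullbackPushforwardAdjunction (φ ∣_ W)))).symm
    (Scheme.Modules.pushforwardComp _ _ ≪≫
      Scheme.Modules.pushforwardCongr (morphismRestrict_ι φ W).symm ≪≫
      (Scheme.Modules.pushforwardComp _ _).symm)

/-- The isomorphism comes from uniqueness of left adjoints, so it matches the units of the two
adjunctions, and pulling back a section is applying the unit. -/
lemma pullbackRestrictIso_pullSec (M : Y.Modules) (m : Γ(M, W)) :
    ((pullbackRestrictIso φ W).hom.app M).app ((φ ∣_ W) ⁻¹ᵁ W.ι ⁻¹ᵁ W)
      (pullSec (φ ∣_ W) (M := M.restrict W.ι) (W := W.ι ⁻¹ᵁ W)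
        (resM M (V := W.ι ''ᵁ W.ι ⁻¹ᵁ W) (W.ι.image_preimage_le W) m)) =
    resM ((Scheme.Modules.pullback φ).obj M) (V := (φ ⁻¹ᵁ W).ι ''ᵁ (φ ∣_ W) ⁻¹ᵁ W.ι ⁻¹ᵁ W)
      (by simp) (pullSec φ m) := by
  have h := unit_conjugateEquiv_symm ((Scheme.Modules.pullbackPushforwardAdjunction φ).comp
      (Scheme.Modules.restrictAdjunction (φ ⁻¹ᵁ W).ι))
    ((Scheme.Modules.restrictAdjunction W.ι).comp
      (Scheme.Modules.pullbackPushforwardAdjunction (φ ∣_ W))) (Scheme.Modules.pushforwardComp _ _ ≪≫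
      Scheme.Modules.pushforwardCongr (morphismRestrict_ι φ W).symm ≪≫
      (Scheme.Modules.pushforwardComp _ _).symm).hom M
  have h2 := congr(Scheme.Modules.Hom.app $h W m)
  rw [Adjunction.comp_unit_app, Adjunction.comp_unit_app] at h2
  refine Eq.trans h2.symm ?_
  have hle : (φ ∣_ W) ⁻¹ᵁ W.ι ⁻¹ᵁ W ≤ (φ ⁻¹ᵁ W).ι ⁻¹ᵁ φ ⁻¹ᵁ W := by
    rw [(φ ⁻¹ᵁ W).ι_preimage_self]
    exact fun _ _ ↦ trivial
  exact resM_resM ((Scheme.Modules.pullback φ).obj M)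
    (W := (φ ⁻¹ᵁ W).ι ''ᵁ (φ ∣_ W) ⁻¹ᵁ W.ι ⁻¹ᵁ W) (U := φ ⁻¹ᵁ W) (V := (φ ⁻¹ᵁ W).ι ''ᵁ (φ ⁻¹ᵁ W).ι ⁻¹ᵁ φ ⁻¹ᵁ W)
    ((φ ⁻¹ᵁ W).ι.image_preimage_le _) (Scheme.Hom.image_mono _ hle) (pullSec φ m)

/-- The pull-back of a local generator is a local generator. -/
lemma IsGen.pullSec {M : Y.Modules} {W : Y.Opens} {m : Γ(M, W)} (hm : IsGen M m) :
    IsGen _ (pullSec φ m) := by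
  have hW : W.ι ⁻¹ᵁ W = ⊤ := by simp
  have h1 : IsGen (M.restrict W.ι) (U := W.ι ⁻¹ᵁ W)
      (MultiProj.resM M (V := W.ι ''ᵁ W.ι ⁻¹ᵁ W) (W.ι.image_preimage_le W) m) :=
    (isGen_restrict W.ι _).2 (hm.resM _)
  -- The variable `V` allows `⊤` to be substituted in the type of the section.
  have h2 : ∀ (V : W.toScheme.Opens) (hV : V = ⊤) (m : Γ(M.restrict W.ι, V)),
      IsGen _ m → IsGen _ (MultiProj.pullSec (φ ∣_ W) m) := by
    rintro V rfl m hm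
    exact isGen_pullSec_top _ hm
  have h3 := isGen_of_iso ((pullbackRestrictIso φ W).app M) (h2 _ hW _ h1)
  have h4 := pullbackRestrictIso_pullSec φ W M m
  have h5 : IsGen ((Scheme.Modules.pullback φ).obj M)
      (U := (φ ⁻¹ᵁ W).ι ''ᵁ (φ ∣_ W) ⁻¹ᵁ W.ι ⁻¹ᵁ W) (MultiProj.resM _ (by simp)
        (MultiProj.pullSec φ m)) := by
    rw [← h4]
    exact (isGen_restrict _ _).1 h3
  have h6 := h5.resM (V := φ ⁻¹ᵁ W) (by
    rw [hW, Scheme.Hom.preimage_top]; simp)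
  simpa using h6

end Pullback

/-! ### Evaluation of functions along morphisms from affine schemes. -/

section SpecPoints

/-- The value of a function along a morphism from an affine scheme. -/
def evalSpec {Y : Scheme.{u}} {B : CommRingCat.{u}} (g : Spec B ⟶ Y) (W : Y.Opens)
    (h : ⊤ ≤ g ⁻¹ᵁ W) : Γ(Y, W) →+* B :=
  (g.appLE W ⊤ h ≫ (Scheme.ΓSpecIso B).hom).hom

variable {Y Z : Scheme.{u}} {B C : CommRingCat.{u}}

lemma evalSpec_app {g : Spec B ⟶ Y} {q : Y ⟶ Z} {g' : Spec B ⟶ Z} (e : g ≫ q = g') (W : Z.Opens)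
    (h : ⊤ ≤ g ⁻¹ᵁ q ⁻¹ᵁ W) (w : Γ(Z, W)) :
    evalSpec g (q ⁻¹ᵁ W) h (q.app W w) = evalSpec g' W (by subst e; exact h) w := by
  subst e
  have e := Scheme.Hom.comp_appLE g q W ⊤ h
  simp only [evalSpec]
  rw [e]
  rfl

lemma evalSpec_congr {g g' : Spec B ⟶ Y} (e : g = g') (W : Y.Opens) (h : ⊤ ≤ g ⁻¹ᵁ W)
    (w : Γ(Y, W)) : evalSpec g W h w = evalSpec g' W (e ▸ h) w := by
  subst e; rfl

lemma evalSpec_specMap (φ : C ⟶ B) (g : Spec C ⟶ Y) (W : Y.Opens) (h : ⊤ ≤ g ⁻¹ᵁ W)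
    (w : Γ(Y, W)) : evalSpec (Spec.map φ ≫ g) W (fun _ _ ↦ h trivial) w =
      φ (evalSpec g W h w) := by
  simp only [evalSpec, ← CommRingCat.comp_apply]
  rw [← Scheme.Hom.appLE_comp_appLE (Spec.map φ) g W ⊤ ⊤ h le_top, Category.assoc, Category.assoc,
    ← Scheme.ΓSpecIso_naturality, Scheme.Hom.appTop, Scheme.Hom.app_eq_appLE]
  rfl

lemma evalSpec_res (g : Spec B ⟶ Y) {W V : Y.Opens} (hV : V ≤ W) (h : ⊤ ≤ g ⁻¹ᵁ V)
    (w : Γ(Y, W)) : evalSpec g V h (res hV w) = evalSpec g W (h.trans (g.preimage_mono hV)) w := by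
  simp only [evalSpec, res, ← CommRingCat.comp_apply, ← Category.assoc]
  rw [Scheme.Hom.map_appLE]

lemma bijective_evalSpec (g : Spec B ⟶ Y) [IsOpenImmersion g] :
    Function.Bijective (evalSpec g g.opensRange (by simp)) := by
  have h : IsIso (g.appLE g.opensRange ⊤ (by simp)) := by
    have : g.appLE g.opensRange ⊤ (by simp) = Y.presheaf.map (eqToHom g.image_top_eq_opensRange).op
      ≫ (g.appIso ⊤).hom := by
        rw [Scheme.Hom.appIso_hom', Scheme.Hom.map_appLE]
    rw [this]
    infer_instance
  exact ConcreteCategory.bijective_of_isIso (g.appLE g.opensRange ⊤ _ ≫ (Scheme.ΓSpecIso B).hom)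

lemma evalSpec_top (φ : C ⟶ B) (c : C) :
    evalSpec (Spec.map φ) ⊤ (by simp) ((Scheme.ΓSpecIso C).inv c) = φ c := by
  have h := evalSpec_specMap φ (𝟙 _) ⊤ (by simp) ((Scheme.ΓSpecIso C).inv c)
  have e : evalSpec (𝟙 (Spec C)) ⊤ (by simp) ((Scheme.ΓSpecIso C).inv c) = c := by
    have h2 : (Spec C).presheaf.map (homOfLE (le_refl ⊤)).op = 𝟙 _ := (Spec C).presheaf.map_id _
    simp [evalSpec, Scheme.Hom.appLE, h2]
  rw [e] at h
  rw [← h]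
  exact evalSpec_congr (Category.comp_id _).symm _ _ _

end SpecPoints

/-! ### Charts of `Proj R` and of the relevant locus. -/

section Proj

variable {A : Type u} [CommRing A] {Λ : Type} [AddCommGroup Λ] [DecidableEq Λ]
  {R : Type u} [CommRing R] [Algebra A R] (𝒜 : Λ → Submodule A R) [GradedAlgebra 𝒜]

/-- The open subscheme `Spec R[f⁻¹]` of the relevant locus. -/
def relChart (f : Relevant 𝒜) : Spec (.of (Localization.Away f.elem)) ⟶ relevantLocus 𝒜 :=
  Limits.colimit.ι (relevantDiagram 𝒜) f

instance (f : Relevant 𝒜) : IsOpenImmersion (relChart 𝒜 f) :=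
  inferInstanceAs (IsOpenImmersion (Limits.colimit.ι (relevantDiagram 𝒜) f))

/-- The open immersion `Spec R[f⁻¹]₀ ⟶ Proj R`. -/
abbrev projChart (f : Relevant 𝒜) : Spec (.of (Away 𝒜 f.elem)) ⟶ multiProj 𝒜 := chart 𝒜 f

/-- The homomorphism `R[f⁻¹]₀ → R[f⁻¹]`. -/
def awayVal (f : Relevant 𝒜) :
    CommRingCat.of (Away 𝒜 f.elem) ⟶ CommRingCat.of (Localization.Away f.elem) :=
  CommRingCat.ofHom (algebraMap (Away 𝒜 f.elem) (Localization.Away f.elem))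

lemma relChart_quot (f : Relevant 𝒜) :
    relChart 𝒜 f ≫ quot 𝒜 = Spec.map (awayVal 𝒜 f) ≫ projChart 𝒜 f :=
  Limits.ι_colimMap _ _

lemma relChart_ι (f : Relevant 𝒜) : relChart 𝒜 f ≫ relevantLocusι 𝒜 = relevantToSpec 𝒜 f :=
  Limits.colimit.ι_desc _ _

lemma relChart_w {f g : Relevant 𝒜} (h : f ⟶ g) :
    (relevantDiagram 𝒜).map h ≫ relChart 𝒜 g = relChart 𝒜 f :=
  Limits.colimit.w _ _

lemma chart_w {f g : Relevant 𝒜} (h : f ⟶ g) :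
    (projDiagram 𝒜).map h ≫ chart 𝒜 g = chart 𝒜 f :=
  Limits.colimit.w _ _

lemma chart_structureMorphism (f : Relevant 𝒜) :
    chart 𝒜 f ≫ structureMorphism 𝒜 = chartToSpec 𝒜 f :=
  Limits.colimit.ι_desc _ _

lemma exists_relChart (z : relevantLocus 𝒜) : ∃ f p, relChart 𝒜 f p = z :=
  Scheme.IsLocallyDirected.ι_jointly_surjective _ z

/-- The chart of `f` as an open subset of `Proj R`. -/
abbrev chartOpen (f : Relevant 𝒜) : (multiProj 𝒜).Opens := (chart 𝒜 f).opensRange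

/-- A point of `Spec R[g⁻¹]` lies over the smaller chart `D(f)` of `D(g)` precisely when it lies in
`Spec R[f⁻¹]`. -/
lemma specMap_awayVal_mem_range {f g : Relevant 𝒜} (h : f ⟶ g)
    (p : Spec (.of (Localization.Away g.elem))) :
    Spec.map (awayVal 𝒜 g) p ∈ Set.range ((projDiagram 𝒜).map h) ↔
      p ∈ Set.range ((relevantDiagram 𝒜).map h) := by
  constructor
  · intro hp
    obtain ⟨d, hd⟩ := g.homogeneous
    obtain ⟨e, k, hk, hfk⟩ := h.le
    obtain ⟨D⟩ := exists_denominator g hd k e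
    rw [(projDiagram_map_aux 𝒜 h hd hk hfk D).2] at hp
    have hp' : (D.elem hd hk).val ∉ p.asIdeal := hp
    -- `k` divides `k ^ N * c / g ^ n` because `N` is positive, and this fraction cuts out the
    -- smaller chart.
    have hk' : algebraMap R _ k ∉ p.asIdeal := by
      intro hkp
      refine hp' ?_
      have : (D.elem hd hk).val = algebraMap R _ k ^ D.N *
          Localization.mk D.c (⟨g.elem ^ D.n, D.n, rfl⟩ : Submonoid.powers g.elem) := by
        rw [Denominator.elem, Away.val_mk, ← map_pow, ← Localization.mk_one_eq_algebraMap,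
          Localization.mk_mul, one_mul]
      rw [this]
      exact p.asIdeal.mul_mem_right _ (p.asIdeal.pow_mem_of_mem hkp _ D.pos)
    have hf' : algebraMap R _ f.elem ∉ p.asIdeal := by
      rw [hfk, map_mul]
      intro h
      rcases p.isPrime.mem_or_mem h with h | h
      · exact p.isPrime.ne_top (Ideal.eq_top_of_isUnit_mem _ h
          (IsLocalization.Away.algebraMap_isUnit g.elem))
      · exact hk' h
    have hr : relevantToSpec 𝒜 g p ∈ Set.range (relevantToSpec 𝒜 f) := by
      rw [range_relevantToSpec]
      exact hf'
    obtain ⟨z, hz⟩ := hr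
    refine ⟨z, (relevantToSpec 𝒜 g).isOpenEmbedding.injective ?_⟩
    rw [← hz, ← relevantDiagram_map 𝒜 h]
    rfl
  · rintro ⟨z, rfl⟩
    refine ⟨Spec.map (awayVal 𝒜 f) z, ?_⟩
    have e : Spec.map (awayVal 𝒜 f) ≫ (projDiagram 𝒜).map h =
        (relevantDiagram 𝒜).map h ≫ Spec.map (awayVal 𝒜 g) := by
      dsimp only [relevantDiagram, projDiagram, awayVal]
      rw [← Spec.map_comp, ← Spec.map_comp, ← CommRingCat.ofHom_comp, ← CommRingCat.ofHom_comp]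
      congr 2
      ext z
      exact val_awayZeroLE h.le z
    exact congr($e z)

/-- Points of two charts are identified in `Proj R` only if they come from a common smaller chart,
and by `specMap_awayVal_mem_range` a point over a smaller chart already lies in the smaller
localisation. -/
lemma preimage_quot_chartOpen (f : Relevant 𝒜) :
    quot 𝒜 ⁻¹ᵁ chartOpen 𝒜 f = (relChart 𝒜 f).opensRange := by
  ext z
  obtain ⟨g, p, rfl⟩ := exists_relChart 𝒜 z
  have hq : ∀ (f : Relevant 𝒜) p, quot 𝒜 (relChart 𝒜 f p) = chart 𝒜 f (Spec.map (awayVal 𝒜 f) p) :=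
    fun f p ↦ congr($(relChart_quot 𝒜 f) p)
  constructor
  · rintro ⟨q, hq'⟩
    rw [hq g p] at hq'
    obtain ⟨k, hkf, hkg, y, h1, h2⟩ := (Scheme.IsLocallyDirected.ι_eq_ι_iff (projDiagram 𝒜)).1 hq'
    obtain ⟨z, hz⟩ := (specMap_awayVal_mem_range 𝒜 hkg p).1 ⟨y, h2⟩
    refine ⟨(relevantDiagram 𝒜).map hkf z, ?_⟩
    rw [← hz]
    exact congr($((relChart_w 𝒜 hkf).trans (relChart_w 𝒜 hkg).symm) z)
  · rintro ⟨q, hq'⟩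
    exact ⟨Spec.map (awayVal 𝒜 f) q, by rw [← hq, ← hq']⟩

variable {𝒜}

/-- Elements of `R` come from `Spec R`, so only the composite with the inclusion in `Spec R`
matters. -/
lemma evalSpec_toSection_of_eq {B : CommRingCat.{u}} {g : Spec B ⟶ relevantLocus 𝒜}
    {φ : CommRingCat.of R ⟶ B} (e : g ≫ relevantLocusι 𝒜 = Spec.map φ)
    {W : (multiProj 𝒜).Opens} (h) (r : R) :
    evalSpec g (quot 𝒜 ⁻¹ᵁ W) h (toSection 𝒜 W r) = φ r := by
  have h1 : toSection 𝒜 W r = res ((le_top : _ ≤ ⊤).trans (Scheme.Hom.preimage_top _).ge)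
      ((relevantLocusι 𝒜).app ⊤ ((Scheme.ΓSpecIso (.of R)).inv r)) := by
    simp only [toSection, res, ← CommRingCat.comp_apply]
    rfl
  rw [h1, evalSpec_res, evalSpec_app e]
  exact evalSpec_top φ r

lemma evalSpec_toSection (f : Relevant 𝒜) {W : (multiProj 𝒜).Opens} (h) (r : R) :
    evalSpec (relChart 𝒜 f) (quot 𝒜 ⁻¹ᵁ W) h (toSection 𝒜 W r) = algebraMap R _ r :=
  evalSpec_toSection_of_eq (relChart_ι 𝒜 f) h r

lemma evalSpec_quot (f : Relevant 𝒜) {W : (multiProj 𝒜).Opens} (h) (h') (w : Γ(multiProj 𝒜, W)) :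
    evalSpec (relChart 𝒜 f) (quot 𝒜 ⁻¹ᵁ W) h ((quot 𝒜).app W w) =
      algebraMap (Away 𝒜 f.elem) _ (evalSpec (projChart 𝒜 f) W h' w) := by
  rw [evalSpec_app (relChart_quot 𝒜 f)]
  exact evalSpec_specMap (awayVal 𝒜 f) (projChart 𝒜 f) W h' w

end Proj

/-! ### Homogeneous units and the retraction `R[f⁻¹] → R[f⁻¹]₀`. -/

section Retraction

variable {A : Type u} [CommRing A] {Λ : Type} [AddCommGroup Λ] [DecidableEq Λ]
  {R : Type u} [CommRing R] [Algebra A R] (𝒜 : Λ → Submodule A R) [GradedAlgebra 𝒜]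

/-- The elements of degree `a` of `R[f⁻¹]`, where `f` has degree `d`. -/
def IsAwayHomogeneous (f : R) (d a : Λ) (z : Localization.Away f) : Prop :=
  ∃ n : ℕ, ∃ c ∈ 𝒜 (a + n • d), algebraMap R _ f ^ n * z = algebraMap R _ c

variable {𝒜} {f : R} {d : Λ}

lemma isAwayHomogeneous_algebraMap {a : Λ} {r : R} (hr : r ∈ 𝒜 a) :
    IsAwayHomogeneous 𝒜 f d a (algebraMap R _ r) :=
  ⟨0, r, by simpa using hr, by simp⟩

lemma IsAwayHomogeneous.mul {a b : Λ} {z w : Localization.Away f}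
    (hz : IsAwayHomogeneous 𝒜 f d a z) (hw : IsAwayHomogeneous 𝒜 f d b w) :
    IsAwayHomogeneous 𝒜 f d (a + b) (z * w) := by
  obtain ⟨n, c, hc, e⟩ := hz
  obtain ⟨m, c', hc', e'⟩ := hw
  refine ⟨n + m, c * c', ?_, ?_⟩
  · convert SetLike.mul_mem_graded hc hc' using 2
    rw [add_smul]; abel
  · rw [map_mul, ← e, ← e']; ring

/-- The numerator of a homogeneous unit divides a power of `f`, and the cofactor may be taken
homogeneous; it serves as numerator of the inverse. -/
lemma IsAwayHomogeneous.inv (hf : f ∈ 𝒜 d) {a : Λ} {z : (Localization.Away f)ˣ}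
    (hz : IsAwayHomogeneous 𝒜 f d a z) : IsAwayHomogeneous 𝒜 f d (-a) (z⁻¹).1 := by
  obtain ⟨n, c, hc, e⟩ := hz
  have hu : IsUnit (algebraMap R (Localization.Away f) c) :=
    e ▸ ((IsLocalization.Away.algebraMap_isUnit f).pow n).mul z.isUnit
  obtain ⟨r, k, hr⟩ := exists_mul_eq_pow hu
  obtain ⟨c', hc', h'⟩ := exists_homogeneous_cofactor hc (SetLike.pow_mem_graded k hf) hr
  refine ⟨k, f ^ n * c', ?_, ?_⟩
  · convert SetLike.mul_mem_graded (SetLike.pow_mem_graded n hf) hc' using 2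
    abel
  · rw [← map_pow, ← h', map_mul, map_mul, map_pow, ← e, mul_right_comm, Units.mul_inv_cancel_right]

lemma isAwayHomogeneous_zero_iff (hf : f ∈ 𝒜 d) {z : Localization.Away f} :
    IsAwayHomogeneous 𝒜 f d 0 z ↔ z ∈ (algebraMap (Away 𝒜 f) (Localization.Away f)).range := by
  constructor
  · rintro ⟨n, c, hc, e⟩
    rw [zero_add] at hc
    refine ⟨Away.mk 𝒜 hf n c hc, ?_⟩
    refine ((IsLocalization.Away.algebraMap_isUnit f).pow n).mul_left_cancel ?_
    rw [e]
    change _ * (Away.mk 𝒜 hf n c hc).val = _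
    rw [Away.val_mk, ← map_pow, ← Localization.mk_one_eq_algebraMap, Localization.mk_mul,
      ← Localization.mk_one_eq_algebraMap, Localization.mk_eq_mk_iff, Localization.r_iff_exists]
    exact ⟨1, by simp⟩
  · rintro ⟨w, rfl⟩
    obtain ⟨n, c, hc, rfl⟩ := Away.mk_surjective 𝒜 hf w
    refine ⟨n, c, by rwa [zero_add], ?_⟩
    change _ * (Away.mk 𝒜 hf n c hc).val = _
    rw [Away.val_mk, ← map_pow, ← Localization.mk_one_eq_algebraMap, Localization.mk_mul,
      ← Localization.mk_one_eq_algebraMap, Localization.mk_eq_mk_iff, Localization.r_iff_exists]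
    exact ⟨1, by simp⟩

/-- Units are chosen freely for the elements of a basis of `Λ` and extended multiplicatively. -/
lemma exists_homogeneous_units [Module.Free ℤ Λ] (hf : f ∈ 𝒜 d) (h : unitDegrees 𝒜 f = ⊤) :
    ∃ V : Λ →+ Additive (Localization.Away f)ˣ,
      ∀ a, IsAwayHomogeneous 𝒜 f d a (V a).toMul.1 := by
  let b := Module.Free.chooseBasis ℤ Λ
  have H : ∀ a : Λ, ∃ u : (Localization.Away f)ˣ, IsAwayHomogeneous 𝒜 f d a u.1 := by
    intro a
    obtain ⟨n, c, hc, hu⟩ := exists_unit_of_mem_unitDegrees hf (h ▸ AddSubgroup.mem_top a)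
    obtain ⟨v, hv⟩ := hu
    obtain ⟨w, hw⟩ := (IsLocalization.Away.algebraMap_isUnit (S := Localization.Away f) f).pow n
    exact ⟨w⁻¹ * v, n, c, hc, by rw [← hw, Units.val_mul, Units.mul_inv_cancel_left, hv]⟩
  choose u hu using H
  let V := (b.constr ℤ fun i ↦ Additive.ofMul (u (b i))).toAddMonoidHom
  -- The degrees `a` for which `V a` really has degree `a` form a subgroup containing the basis.
  let S : AddSubgroup Λ :=
    { carrier := {a | IsAwayHomogeneous 𝒜 f d a (V a).toMul.1}
      zero_mem' := by
        have := isAwayHomogeneous_algebraMap (f := f) (d := d)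
          (SetLike.GradedOne.one_mem : (1 : R) ∈ 𝒜 0)
        simpa using this
      add_mem' := fun ha hb ↦ by
        simpa using ha.mul hb
      neg_mem' := fun ha ↦ by
        simpa using ha.inv hf }
  have hS : AddSubgroup.toIntSubmodule S = ⊤ := by
    rw [← top_le_iff, ← b.span_eq, Submodule.span_le]
    rintro _ ⟨i, rfl⟩
    change IsAwayHomogeneous 𝒜 f d (b i) (V (b i)).toMul.1
    have : V (b i) = Additive.ofMul (u (b i)) := b.constr_basis ℤ _ i
    rw [this]
    exact hu (b i)
  refine ⟨V, fun a ↦ ?_⟩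
  have : a ∈ AddSubgroup.toIntSubmodule S := hS ▸ Submodule.mem_top
  exact this

/-- If every element of `Λ` is the degree of a homogeneous unit, then `R[f⁻¹]₀ → R[f⁻¹]` has a
retraction. -/
lemma exists_away_retraction [Module.Free ℤ Λ] (hf : f ∈ 𝒜 d) (h : unitDegrees 𝒜 f = ⊤) :
    ∃ ρ : Localization.Away f →+* Away 𝒜 f, ρ.comp (algebraMap (Away 𝒜 f) _) = RingHom.id _ := by
  obtain ⟨V, hV⟩ := exists_homogeneous_units hf h
  let S := (algebraMap (Away 𝒜 f) (Localization.Away f)).range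
  have hmem : ∀ {a : Λ} {r : R}, r ∈ 𝒜 a →
      algebraMap R (Localization.Away f) r * (V (-a)).toMul.1 ∈ S := fun {a r} hr ↦
    (isAwayHomogeneous_zero_iff hf).1 (by
      simpa using (isAwayHomogeneous_algebraMap (f := f) (d := d) hr).mul (hV (-a)))
  -- An element `r` of degree `a` is sent to `r * V (-a)`, of degree zero; additivity of `V` makes
  -- this multiplicative.
  let g : ∀ a, 𝒜 a →+ S := fun a ↦ AddMonoidHom.mk' (fun r ↦ ⟨_, hmem r.2⟩) fun r s ↦
    Subtype.ext (by simp [add_mul])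
  let ρ₀ : R →+* S := (DirectSum.toSemiring g
    (Subtype.ext (by simp [g])) (fun {a b} r s ↦ Subtype.ext (by
      change algebraMap R _ (r.1 * s.1) * _ =
        (algebraMap R _ r.1 * (V (-a)).toMul.1) * (algebraMap R _ s.1 * (V (-b)).toMul.1)
      rw [neg_add, map_add, map_mul, toMul_add, Units.val_mul]
      ring))).comp
    (DirectSum.decomposeRingEquiv 𝒜).toRingHom
  have hρ₀ : ∀ {a : Λ} {r : R}, r ∈ 𝒜 a → (ρ₀ r).1 = algebraMap R _ r * (V (-a)).toMul.1 := by
    intro a r hr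
    lift r to 𝒜 a using hr
    have : (DirectSum.decomposeRingEquiv 𝒜).toRingHom r.1 = DirectSum.of (fun i ↦ 𝒜 i) a r :=
      DirectSum.decompose_coe 𝒜 r
    rw [RingHom.comp_apply, this, DirectSum.toSemiring_of]
    rfl
  -- The inverse of `f * V (-d)` is `f⁻¹ * V d`, again of degree zero.
  have hfu : IsUnit (ρ₀ f) := by
    obtain ⟨w, hw⟩ := IsLocalization.Away.algebraMap_isUnit (S := Localization.Away f) f
    have h1 : IsAwayHomogeneous 𝒜 f d d w := by
      rw [hw]; exact isAwayHomogeneous_algebraMap hf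
    have h2 : IsAwayHomogeneous 𝒜 f d 0 ((w⁻¹).1 * (V d).toMul.1) := by
      simpa using (h1.inv hf).mul (hV d)
    refine isUnit_iff_exists_inv.2 ⟨⟨_, (isAwayHomogeneous_zero_iff hf).1 h2⟩, Subtype.ext ?_⟩
    change (ρ₀ f).1 * ((w⁻¹).1 * (V d).toMul.1) = 1
    rw [hρ₀ hf, ← hw, map_neg, toMul_neg, ← Units.val_mul, ← Units.val_mul, ← Units.val_mul,
      mul_mul_mul_comm]
    simp
  let ρ₁ : Localization.Away f →+* S := Localization.awayLift ρ₀ f hfu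
  have hinj : Function.Injective (algebraMap (Away 𝒜 f) (Localization.Away f)) :=
    val_injective _
  let e : Away 𝒜 f ≃+* S := RingEquiv.ofBijective _
    ⟨fun x y hxy ↦ hinj (congr_arg Subtype.val hxy), (algebraMap (Away 𝒜 f)
      (Localization.Away f)).rangeRestrict_surjective⟩
  refine ⟨e.symm.toRingHom.comp ρ₁, RingHom.ext fun z ↦ e.injective ?_⟩
  obtain ⟨n, c, hc, rfl⟩ := Away.mk_surjective 𝒜 hf z
  have h1 : algebraMap (Away 𝒜 f) (Localization.Away f) (Away.mk 𝒜 hf n c hc) *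
      algebraMap R _ f ^ n = algebraMap R _ c := by
    change (Away.mk 𝒜 hf n c hc).val * _ = _
    rw [Away.val_mk, ← map_pow, ← Localization.mk_one_eq_algebraMap, Localization.mk_mul,
      ← Localization.mk_one_eq_algebraMap, Localization.mk_eq_mk_iff, Localization.r_iff_exists]
    exact ⟨1, by simp [mul_comm]⟩
  have hρ₁ : ∀ r, ρ₁ (algebraMap R _ r) = ρ₀ r := fun r ↦
    IsLocalization.Away.lift_eq (S := Localization.Away f) f hfu r
  have h2 := congr(ρ₁ $h1)
  rw [map_mul, map_pow, hρ₁, hρ₁] at h2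
  -- For `c / f ^ n` of degree zero the correction factors `V (-(n • d))` and `V (-d) ^ n` cancel.
  have h3 : e (e.symm (ρ₁ (algebraMap (Away 𝒜 f) (Localization.Away f) (Away.mk 𝒜 hf n c hc)))) *
      ρ₀ f ^ n = e (Away.mk 𝒜 hf n c hc) * ρ₀ f ^ n := by
    rw [RingEquiv.apply_symm_apply, h2]
    refine Subtype.ext ?_
    change _ = algebraMap (Away 𝒜 f) (Localization.Away f) (Away.mk 𝒜 hf n c hc) * (ρ₀ f).1 ^ n
    rw [hρ₀ hc, hρ₀ hf, mul_pow, ← mul_assoc, h1, ← smul_neg, map_nsmul, toMul_nsmul,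
      Units.val_pow_eq_pow_val]
  exact (hfu.pow n).mul_right_cancel h3

end Retraction

/-! ### The sheaves `𝒪(a)` over standard charts. -/

section StandardCharts

variable {A : Type u} [CommRing A] {Λ : Type} [AddCommGroup Λ] [DecidableEq Λ]
  {R : Type u} [CommRing R] [Algebra A R] {𝒜 : Λ → Submodule A R} [GradedAlgebra 𝒜]

instance (f : Relevant 𝒜) : IsOpenImmersion (projChart 𝒜 f) :=
  inferInstanceAs (IsOpenImmersion (chart 𝒜 f))

/-- The retraction turns into a section of the quotient morphism over a standard chart. Hence points
of the chart lift, and vanishing and invertibility of functions can be tested on the relevant locus.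
-/
lemma exists_section_quot [Module.Free ℤ Λ] {f : Relevant 𝒜} (hf : unitDegrees 𝒜 f.elem = ⊤) :
    ∃ s : Spec (.of (Away 𝒜 f.elem)) ⟶ relevantLocus 𝒜, s ≫ quot 𝒜 = projChart 𝒜 f := by
  obtain ⟨d, hd⟩ := f.homogeneous
  obtain ⟨ρ, hρ⟩ := exists_away_retraction hd hf
  refine ⟨Spec.map (CommRingCat.ofHom ρ) ≫ relChart 𝒜 f, ?_⟩
  rw [Category.assoc, relChart_quot, ← Category.assoc, ← Spec.map_comp, awayVal,
    ← CommRingCat.ofHom_comp, hρ]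
  exact (congr($(Spec.map_id _) ≫ projChart 𝒜 f)).trans (Category.id_comp _)

lemma exists_quot_eq [Module.Free ℤ Λ] {f : Relevant 𝒜} (hf : unitDegrees 𝒜 f.elem = ⊤)
    {y : multiProj 𝒜} (hy : y ∈ chartOpen 𝒜 f) : ∃ z, quot 𝒜 z = y := by
  obtain ⟨s, hs⟩ := exists_section_quot hf
  obtain ⟨p, rfl⟩ := hy
  exact ⟨s p, congr($hs p)⟩

lemma quot_app_eq_zero [Module.Free ℤ Λ] {f : Relevant 𝒜} (hf : unitDegrees 𝒜 f.elem = ⊤)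
    {V : (multiProj 𝒜).Opens} (hV : V ≤ chartOpen 𝒜 f) {r : Γ(multiProj 𝒜, V)}
    (h : (quot 𝒜).app V r = 0) : r = 0 := by
  obtain ⟨s, hs⟩ := exists_section_quot hf
  have h1 : (projChart 𝒜 f).app V r = 0 := by
    have h2 := Scheme.Hom.comp_app s (quot 𝒜) V
    have h3 : (s ≫ quot 𝒜).app V r = 0 := by
      rw [h2]
      exact (congr_arg (s.app _) h).trans (map_zero (s.app _).hom)
    generalize s ≫ quot 𝒜 = t at hs h3
    subst hs
    exact h3
  have h4 : IsIso ((projChart 𝒜 f).app V) := Scheme.Hom.isIso_app (projChart 𝒜 f) V hV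
  exact (ConcreteCategory.bijective_of_isIso ((projChart 𝒜 f).app V)).1
    (h1.trans (map_zero ((projChart 𝒜 f).app V).hom).symm)

/-- A function without zeros is a unit, and every point of `V` lifts to the relevant locus, where
the pulled back function has no zeros. -/
lemma isUnit_of_isUnit_quot_app [Module.Free ℤ Λ] {f : Relevant 𝒜}
    (hf : unitDegrees 𝒜 f.elem = ⊤)
    {V : (multiProj 𝒜).Opens} (hV : V ≤ chartOpen 𝒜 f) {r : Γ(multiProj 𝒜, V)}
    (h : IsUnit ((quot 𝒜).app V r)) : IsUnit r := by
  have h1 : (multiProj 𝒜).basicOpen r = V := by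
    refine le_antisymm ((multiProj 𝒜).basicOpen_le r) fun y hy ↦ ?_
    obtain ⟨z, rfl⟩ := exists_quot_eq hf (hV hy)
    have h2 : z ∈ (relevantLocus 𝒜).basicOpen ((quot 𝒜).app V r) := by
      rw [Scheme.basicOpen_of_isUnit _ h]
      exact hy
    rw [← Scheme.preimage_basicOpen] at h2
    exact h2
  have h3 := RingedSpace.isUnit_res_basicOpen _ r
  have h4 : IsUnit (res ((multiProj 𝒜).basicOpen_le r) r) := h3
  have h5 := h4.map (res h1.ge)
  simpa using h5

/-- The preimage of the chart is `Spec R[f⁻¹]`, so the inverse of `b` in `R[f⁻¹]` is a function on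
it. -/
lemma isUnit_toSection {f : Relevant 𝒜} {b : R}
    (hb : IsUnit (algebraMap R (Localization.Away f.elem) b)) :
    IsUnit (toSection 𝒜 (chartOpen 𝒜 f) b) := by
  have h := bijective_evalSpec (relChart 𝒜 f)
  obtain ⟨c, hc⟩ := hb.exists_right_inv
  obtain ⟨w, hw⟩ := h.2 c
  have he : quot 𝒜 ⁻¹ᵁ chartOpen 𝒜 f ≤ (relChart 𝒜 f).opensRange := (preimage_quot_chartOpen 𝒜 f).le
  have he' := (preimage_quot_chartOpen 𝒜 f).ge
  have h1 : res he' (toSection 𝒜 (chartOpen 𝒜 f) b) * w = 1 := by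
    refine h.1 ?_
    rw [map_mul, hw, evalSpec_res, evalSpec_toSection, map_one]
    exact hc
  have h2 := congr(res he $h1)
  rw [map_mul, res_res, res_refl, map_one] at h2
  exact isUnit_iff_exists_inv.2 ⟨_, h2⟩

/-- A degree zero fraction as a function on the chart. -/
lemma exists_function {f : Relevant 𝒜} {d : Λ} (hf : f.elem ∈ 𝒜 d) {m : ℕ} {c : R}
    (hc : c ∈ 𝒜 (m • d)) : ∃ w : Γ(multiProj 𝒜, chartOpen 𝒜 f),
      toSection 𝒜 _ f.elem ^ m * (quot 𝒜).app _ w = toSection 𝒜 _ c := by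
  obtain ⟨w, hw⟩ : ∃ w : Γ(multiProj 𝒜, chartOpen 𝒜 f),
      evalSpec (projChart 𝒜 f) (chartOpen 𝒜 f) (fun x _ ↦ ⟨x, rfl⟩) w = Away.mk 𝒜 hf m c hc :=
    (bijective_evalSpec (projChart 𝒜 f)).2 (Away.mk 𝒜 hf m c hc)
  refine ⟨w, ?_⟩
  have he : quot 𝒜 ⁻¹ᵁ chartOpen 𝒜 f ≤ (relChart 𝒜 f).opensRange := (preimage_quot_chartOpen 𝒜 f).le
  have he' := (preimage_quot_chartOpen 𝒜 f).ge
  have h1 : res he' (toSection 𝒜 _ f.elem ^ m * (quot 𝒜).app (chartOpen 𝒜 f) w) =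
      res he' (toSection 𝒜 _ c) := by
    refine (bijective_evalSpec (relChart 𝒜 f)).1 ?_
    rw [evalSpec_res, evalSpec_res, map_mul, map_pow, evalSpec_toSection, evalSpec_toSection,
      evalSpec_quot f (W := chartOpen 𝒜 f) _ (fun x _ ↦ ⟨x, rfl⟩), hw]
    change _ * (Away.mk 𝒜 hf m c hc).val = _
    rw [Away.val_mk, ← map_pow, ← Localization.mk_one_eq_algebraMap, Localization.mk_mul,
      ← Localization.mk_one_eq_algebraMap, Localization.mk_eq_mk_iff, Localization.r_iff_exists]
    exact ⟨1, by simp⟩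
  have h2 := congr(res he $h1)
  rwa [res_res, res_res, res_refl, res_refl] at h2

variable {a : Λ}

/-- A section of `𝒪(a)` as a function on the relevant locus. -/
def twistVal {V : (multiProj 𝒜).Opens} (s : Γ(twist 𝒜 a, V)) :
    Γ(relevantLocus 𝒜, quot 𝒜 ⁻¹ᵁ V) := (show twistSections 𝒜 a V from s).1

lemma twistVal_injective {V : (multiProj 𝒜).Opens} {s t : Γ(twist 𝒜 a, V)}
    (h : twistVal s = twistVal t) : s = t := Subtype.ext h

lemma twistVal_smul {V : (multiProj 𝒜).Opens} (r : Γ(multiProj 𝒜, V)) (s : Γ(twist 𝒜 a, V)) :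
    twistVal (r • s) = (quot 𝒜).app V r * twistVal s := rfl

lemma twistVal_zero {V : (multiProj 𝒜).Opens} : twistVal (0 : Γ(twist 𝒜 a, V)) = 0 := rfl

lemma twistVal_resM {V W : (multiProj 𝒜).Opens} (h : W ≤ V) (s : Γ(twist 𝒜 a, V)) :
    twistVal (resM _ h s) = res ((quot 𝒜).preimage_mono h) (twistVal s) := rfl

lemma res_toSection {V W : (multiProj 𝒜).Opens} (h : W ≤ V) (r : R) :
    res ((quot 𝒜).preimage_mono h) (toSection 𝒜 V r) = toSection 𝒜 W r :=
  map_toSection 𝒜 h r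

lemma res_quot_app {V W : (multiProj 𝒜).Opens} (h : W ≤ V) (r : Γ(multiProj 𝒜, V)) :
    res ((quot 𝒜).preimage_mono h) ((quot 𝒜).app V r) = (quot 𝒜).app W (res h r) :=
  congr($((quot 𝒜).naturality (homOfLE h).op) r).symm

/-- Fractions give sections. -/
lemma exists_twistVal_eq {V : (multiProj 𝒜).Opens} {e : Λ} {g b : R} (hg : g ∈ 𝒜 e)
    (hb : b ∈ 𝒜 (e + a)) (hu : IsUnit (toSection 𝒜 V g)) :
    ∃ s : Γ(twist 𝒜 a, V), toSection 𝒜 V g * twistVal s = toSection 𝒜 V b := by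
  obtain ⟨i, hi⟩ := hu.exists_right_inv
  have h : toSection 𝒜 V g * (i * toSection 𝒜 V b) = toSection 𝒜 V b := by
    rw [← mul_assoc, hi, one_mul]
  refine ⟨(⟨(i * toSection 𝒜 V b : Γ(relevantLocus 𝒜, quot 𝒜 ⁻¹ᵁ V)), fun x hx ↦
    ⟨V, le_rfl, hx, map_mem_span 𝒜 a le_rfl (Submodule.subset_span
      ⟨e, g, hg, b, hb, hu, h⟩)⟩⟩ : twistSections 𝒜 a V), h⟩

/-- A homogeneous unit of degree `a` of `R[f⁻¹]` generates `𝒪(a)` over the chart of `f`. -/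
lemma isGen_twist [Module.Free ℤ Λ] {f : Relevant 𝒜} (hstd : unitDegrees 𝒜 f.elem = ⊤)
    {d : Λ} (hf : f.elem ∈ 𝒜 d) {n : ℕ} {b : R} (hb : b ∈ 𝒜 (n • d + a))
    (hu : IsUnit (algebraMap R (Localization.Away f.elem) b))
    {s : Γ(twist 𝒜 a, chartOpen 𝒜 f)}
    (hs : toSection 𝒜 _ f.elem ^ n * twistVal s = toSection 𝒜 _ b) : IsGen _ s := by
  have hfu : IsUnit (toSection 𝒜 (chartOpen 𝒜 f) f.elem) :=
    isUnit_toSection (IsLocalization.Away.algebraMap_isUnit _)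
  have hbu := isUnit_toSection hu
  have hsu : IsUnit (twistVal s) := by
    rw [← hs] at hbu
    exact isUnit_of_mul_isUnit_right hbu
  refine isGen_of_local (fun V hV r hr ↦ ?_) fun V hV t x hx ↦ ?_
  -- On the relevant locus the generator is a unit, so `r • s = 0` forces the pull-back of `r` to
  -- vanish.
  · refine quot_app_eq_zero hstd hV ?_
    have h1 := congr(twistVal $hr)
    rw [twistVal_smul, twistVal_resM, twistVal_zero] at h1
    exact (hsu.map (res _)).mul_left_eq_zero.1 h1
  · obtain ⟨W, hW, hxW, ht⟩ := (show twistSections 𝒜 a V from t).2 x hx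
    have hWf := hW.trans hV
    refine ⟨W, hW, hxW, ?_⟩
    -- Being a multiple of `s` is linear over the functions on `W`, so only the fractions themselves
    -- need an argument.
    suffices H : ∀ t' ∈ Submodule.span Γ(multiProj 𝒜, W) (fractions 𝒜 a W),
        ∃ r : Γ(multiProj 𝒜, W), (show Γ(relevantLocus 𝒜, quot 𝒜 ⁻¹ᵁ W) from t') =
          (quot 𝒜).app W r * res ((quot 𝒜).preimage_mono hWf) (twistVal s) by
      obtain ⟨r, hr⟩ := H _ ht
      exact ⟨r, twistVal_injective hr⟩
    intro t' ht'
    induction ht' using Submodule.span_induction with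
    | zero => exact ⟨0, by rw [map_zero, zero_mul]; rfl⟩
    | add t₁ t₂ _ _ h1 h2 =>
      obtain ⟨r₁, h1⟩ := h1
      obtain ⟨r₂, h2⟩ := h2
      exact ⟨r₁ + r₂, by rw [map_add, add_mul, ← h1, ← h2]; rfl⟩
    | smul r t₁ _ h1 =>
      obtain ⟨r₁, h1⟩ := h1
      exact ⟨r * r₁, by rw [map_mul, mul_assoc, ← h1]; rfl⟩
    -- For the fraction `c / g` the coefficient is `(c / g) / s`. To write it with functions on
    -- `Proj R`, multiply numerator and denominator by a unit `v` that cancels the degree of `g`: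
    -- `w₁ = v g / f ^ k`, and `w₂ = (v c / f ^ k) * (b' f ^ n / f ^ l)`, where `b' f ^ n / f ^ l`
    -- is the inverse of `s = b / f ^ n`. The coefficient is then `w₂ / w₁`.
    | mem t₁ h1 =>
      obtain ⟨e, g, hg, c, hc, hgu, h1⟩ := h1
      -- a homogeneous unit of degree `-e`
      obtain ⟨k, v, hv, hvu⟩ := exists_unit_of_mem_unitDegrees hf
        (hstd ▸ AddSubgroup.mem_top (-e))
      obtain ⟨r', l, hr'⟩ := exists_mul_eq_pow hu
      obtain ⟨b', hb', hbb'⟩ := exists_homogeneous_cofactor hb (SetLike.pow_mem_graded l hf) hr'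
      obtain ⟨w₁, hw₁⟩ := exists_function hf (m := k) (c := v * g) (by
        convert SetLike.mul_mem_graded hv hg using 2; abel)
      obtain ⟨w₂, hw₂⟩ := exists_function hf (m := k + l) (c := v * c * b' * f.elem ^ n) (by
        convert SetLike.mul_mem_graded (SetLike.mul_mem_graded (SetLike.mul_mem_graded hv hc) hb')
          (SetLike.pow_mem_graded n hf) using 2
        rw [add_smul]; abel)
      have hfuW : IsUnit (toSection 𝒜 W f.elem) := res_toSection hWf f.elem ▸ hfu.map (res _)
      have hvuW : IsUnit (toSection 𝒜 W v) := res_toSection hWf v ▸ (isUnit_toSection hvu).map (res _)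
      have hbuW : IsUnit (toSection 𝒜 W b) := res_toSection hWf b ▸ hbu.map (res _)
      replace hw₁ := congr(res ((quot 𝒜).preimage_mono hWf) $hw₁)
      replace hw₂ := congr(res ((quot 𝒜).preimage_mono hWf) $hw₂)
      replace hs := congr(res ((quot 𝒜).preimage_mono hWf) $hs)
      have hbb := congr(toSection 𝒜 W $hbb')
      simp only [map_mul, map_pow, res_toSection hWf, res_quot_app hWf] at hw₁ hw₂ hs hbb
      have hw₁u : IsUnit (res hWf w₁) := by
        refine isUnit_of_isUnit_quot_app hstd hWf ?_
        have : IsUnit (toSection 𝒜 W v * toSection 𝒜 W g) := hvuW.mul hgu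
        rw [← hw₁] at this
        exact isUnit_of_mul_isUnit_right this
      obtain ⟨i, hi⟩ := hw₁u.exists_right_inv
      refine ⟨res hWf w₂ * i, ?_⟩
      have hi' := congr((quot 𝒜).app W $hi)
      rw [map_mul, map_one] at hi'
      rw [map_mul]
      generalize (quot 𝒜).app W (res hWf w₁) = q₁ at *
      generalize (quot 𝒜).app W (res hWf w₂) = q₂ at *
      generalize (quot 𝒜).app W i = i' at *
      generalize res ((quot 𝒜).preimage_mono hWf) (twistVal s) = S at *
      generalize (show Γ(relevantLocus 𝒜, quot 𝒜 ⁻¹ᵁ W) from t₁) = T at *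
      generalize toSection 𝒜 W f.elem = F at *
      generalize toSection 𝒜 W v = v' at *
      generalize toSection 𝒜 W b = B at *
      generalize toSection 𝒜 W b' = B' at *
      generalize toSection 𝒜 W c = C at *
      generalize toSection 𝒜 W g = G at *
      -- `F^k q₁ = v' G`, `F^(k+l) q₂ = v' C B' F^n`, `F^n S = B`, `B B' = F^l`, `G T = C`
      refine (((hfuW.pow (k + l)).mul hvuW).mul hgu).mul_left_cancel ?_
      linear_combination (F ^ (k + l) * v') * h1 - (v' * G * i' * S) * hw₂ -
        (v' * C * B' * v' * G * i') * hs - (v' * C * v' * G * i') * hbb +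
        (v' * C * F ^ l * i') * hw₁ - (v' * C * F ^ l * F ^ k) * hi'

end StandardCharts

/-! ### Invertibility, tensor products and nonvanishing over the standard locus. -/

section StandardLocus

variable {A : Type u} [CommRing A] {Λ : Type} [AddCommGroup Λ] [DecidableEq Λ]
  {R : Type u} [CommRing R] [Algebra A R] {𝒜 : Λ → Submodule A R} [GradedAlgebra 𝒜]

lemma mem_standardLocus {y : multiProj 𝒜} : y ∈ standardLocus 𝒜 ↔
    ∃ f : Relevant 𝒜, unitDegrees 𝒜 f.elem = ⊤ ∧ y ∈ chartOpen 𝒜 f := by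
  rw [standardLocus, TopologicalSpace.Opens.mem_iSup]
  exact ⟨fun ⟨f, hf⟩ ↦ ⟨f.1, f.2, hf⟩, fun ⟨f, h, hf⟩ ↦ ⟨⟨f, h⟩, hf⟩⟩

lemma isUnit_toSection_self (f : Relevant 𝒜) : IsUnit (toSection 𝒜 (chartOpen 𝒜 f) f.elem) :=
  isUnit_toSection (IsLocalization.Away.algebraMap_isUnit _)

lemma exists_twistVal_unit {f : Relevant 𝒜} (hstd : unitDegrees 𝒜 f.elem = ⊤) {d : Λ}
    (hf : f.elem ∈ 𝒜 d) (a : Λ) : ∃ (n : ℕ) (b : R) (s : Γ(twist 𝒜 a, chartOpen 𝒜 f)),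
      b ∈ 𝒜 (n • d + a) ∧ IsUnit (algebraMap R (Localization.Away f.elem) b) ∧
      toSection 𝒜 _ f.elem ^ n * twistVal s = toSection 𝒜 _ b := by
  obtain ⟨n, b, hb, hu⟩ := exists_unit_of_mem_unitDegrees hf (hstd ▸ AddSubgroup.mem_top a)
  rw [add_comm] at hb
  obtain ⟨s, hs⟩ := exists_twistVal_eq (V := chartOpen 𝒜 f) (SetLike.pow_mem_graded n hf) hb
    (by rw [map_pow]; exact (isUnit_toSection_self f).pow n)
  rw [map_pow] at hs
  exact ⟨n, b, s, hb, hu, hs⟩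

/-- The product of homogeneous units of degrees `a` and `b` is one of degree `a + b`, so the three
generators can be chosen compatibly. -/
lemma exists_twistVal_mul_units {f : Relevant 𝒜} (hstd : unitDegrees 𝒜 f.elem = ⊤)
    [Module.Free ℤ Λ] (a b : Λ) : ∃ (s : Γ(twist 𝒜 a, chartOpen 𝒜 f))
      (t : Γ(twist 𝒜 b, chartOpen 𝒜 f)) (v : Γ(twist 𝒜 (a + b), chartOpen 𝒜 f)),
      IsGen _ s ∧ IsGen _ t ∧ IsGen _ v ∧ twistVal v = twistVal s * twistVal t := by
  obtain ⟨d, hf⟩ := f.homogeneous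
  obtain ⟨n, c, s, hc, hu, hs⟩ := exists_twistVal_unit hstd hf a
  obtain ⟨n', c', t, hc', hu', ht⟩ := exists_twistVal_unit hstd hf b
  have hcc : c * c' ∈ 𝒜 ((n + n') • d + (a + b)) := by
    convert SetLike.mul_mem_graded hc hc' using 2
    rw [add_smul]; abel
  have hfu := isUnit_toSection_self f
  obtain ⟨v, hv⟩ := exists_twistVal_eq (V := chartOpen 𝒜 f) (SetLike.pow_mem_graded (n + n') hf) hcc
    (by rw [map_pow]; exact hfu.pow _)
  rw [map_pow] at hv
  refine ⟨s, t, v, isGen_twist hstd hf hc hu hs, isGen_twist hstd hf hc' hu' ht,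
    isGen_twist hstd hf hcc (by rw [map_mul]; exact hu.mul hu') hv, ?_⟩
  refine (hfu.pow (n + n')).mul_left_cancel ?_
  rw [hv, map_mul, ← hs, ← ht]
  ring

variable {X : Scheme.{u}} (φ : X ⟶ multiProj 𝒜)


lemma isInvertibleSheaf_pullback_twist [Module.Free ℤ Λ] (hφ : ∀ x, φ x ∈ standardLocus 𝒜) (a : Λ) :
    IsInvertibleSheaf ((Scheme.Modules.pullback φ).obj (twist 𝒜 a)) := by
  rw [isInvertibleSheaf_iff]
  intro x
  obtain ⟨f, hstd, hx⟩ := mem_standardLocus.1 (hφ x)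
  obtain ⟨s, -, -, hs, -⟩ := exists_twistVal_mul_units hstd a 0
  exact ⟨φ ⁻¹ᵁ chartOpen 𝒜 f, hx, pullSec φ s, hs.pullSec φ⟩

/-- With generators satisfying `v = s t` on each chart, the transition functions of `𝒪(a + b)` are
the products of those of `𝒪(a)` and `𝒪(b)`, which are the transition functions of `s ⊗ t`. -/
lemma nonempty_tensor_pullback_twist_iso [Module.Free ℤ Λ] (hφ : ∀ x, φ x ∈ standardLocus 𝒜)
    (a b : Λ) : Nonempty
      (tensorModules ((Scheme.Modules.pullback φ).obj (twist 𝒜 a))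
        ((Scheme.Modules.pullback φ).obj (twist 𝒜 b)) ≅
      (Scheme.Modules.pullback φ).obj (twist 𝒜 (a + b))) := by
  choose s t v hs ht hv hst using fun f : {f : Relevant 𝒜 // unitDegrees 𝒜 f.elem = ⊤} ↦
    exists_twistVal_mul_units f.2 a b
  refine nonempty_iso_of_gens (U := fun f : {f : Relevant 𝒜 // unitDegrees 𝒜 f.elem = ⊤} ↦
      φ ⁻¹ᵁ chartOpen 𝒜 f.1)
    (fun x ↦ let ⟨f, h, hx⟩ := mem_standardLocus.1 (hφ x); ⟨⟨f, h⟩, hx⟩)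
    (fun f ↦ ((hs f).pullSec φ).tensorSection ((ht f).pullSec φ))
    (fun f ↦ (hv f).pullSec φ) fun f g ↦ ?_
  obtain ⟨r₁, h₁⟩ := (hs g).exists_smul (inf_le_right : chartOpen 𝒜 f.1 ⊓ chartOpen 𝒜 g.1 ≤ _)
    (resM _ inf_le_left (s f))
  obtain ⟨r₂, h₂⟩ := (ht g).exists_smul (inf_le_right : chartOpen 𝒜 f.1 ⊓ chartOpen 𝒜 g.1 ≤ _)
    (resM _ inf_le_left (t f))
  have h₃ : resM _ inf_le_left (v f) = (r₁ * r₂) •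
      resM _ (inf_le_right : chartOpen 𝒜 f.1 ⊓ chartOpen 𝒜 g.1 ≤ _) (v g) := by
    refine twistVal_injective ?_
    have e₁ := congr(twistVal $h₁)
    have e₂ := congr(twistVal $h₂)
    rw [twistVal_smul, twistVal_resM, twistVal_resM] at e₁ e₂ ⊢
    rw [hst, hst, map_mul, map_mul, map_mul, e₁, e₂]
    ring
  have key : ∀ {c : Λ} {m : Γ(twist 𝒜 c, chartOpen 𝒜 f.1)} {n : Γ(twist 𝒜 c, chartOpen 𝒜 g.1)}
      {r : Γ(multiProj 𝒜, chartOpen 𝒜 f.1 ⊓ chartOpen 𝒜 g.1)},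
      resM _ inf_le_left m = r • resM _ inf_le_right n →
      resM _ (φ.preimage_mono (inf_le_left : chartOpen 𝒜 f.1 ⊓ chartOpen 𝒜 g.1 ≤ _))
        (pullSec φ m) = φ.app _ r • resM _ (φ.preimage_mono inf_le_right) (pullSec φ n) := by
    intro c m n r e
    rw [resM_pullSec φ inf_le_left, resM_pullSec φ inf_le_right, e, pullSec_smul]
  refine ⟨φ.app (chartOpen 𝒜 f.1 ⊓ chartOpen 𝒜 g.1) (r₁ * r₂), ?_, key h₃⟩
  rw [resM_tensorSection, resM_tensorSection, map_mul]
  exact (congr_arg₂ tensorSection (key h₁) (key h₂)).trans (tensorSection_smul_smul _ _ _ _)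

/-- A homogeneous element that does not vanish at a point over `φ x`, as a section. -/
lemma mem_nonvanishingLocus_homogeneousSection [Module.Free ℤ Λ] {f : Relevant 𝒜}
    (hstd : unitDegrees 𝒜 f.elem = ⊤) {x : X} (hx : φ x ∈ chartOpen 𝒜 f) {a : Λ} {r : R}
    (hr : r ∈ 𝒜 a) {z : relevantLocus 𝒜} (hz : quot 𝒜 z = φ x)
    (hrz : z ∈ (relevantLocus 𝒜).basicOpen (toSection 𝒜 (chartOpen 𝒜 f) r)) :
    x ∈ nonvanishingLocus _ (pullbackSection φ (homogeneousSection 𝒜 r hr)) := by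
  obtain ⟨s, -, -, hs, -⟩ := exists_twistVal_mul_units hstd a 0
  obtain ⟨w, hw⟩ := hs.exists_smul le_rfl (resM _ le_top (homogeneousSection 𝒜 r hr))
  rw [resM_refl] at hw
  -- In terms of the generator `s` the section is a function `w`, and `w` is invertible at the image
  -- of `z` because `r = w s` is invertible at `z`.
  have h1 : toSection 𝒜 (chartOpen 𝒜 f) r = (quot 𝒜).app _ w * twistVal s := by
    rw [← twistVal_smul, ← hw, twistVal_resM]
    exact (res_toSection le_top r).symm
  rw [h1, Scheme.basicOpen_mul] at hrz
  have h2 : φ x ∈ (multiProj 𝒜).basicOpen w := by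
    rw [← hz]
    have := hrz.1
    rw [← Scheme.preimage_basicOpen] at this
    exact this
  have h3 := (resM_pullSec φ le_top (homogeneousSection 𝒜 r hr)).trans (congr(pullSec φ $hw))
  rw [pullSec_smul] at h3
  refine (mem_nonvanishingLocus_iff (hs.pullSec φ) h3 hx).2 ?_
  rw [← Scheme.preimage_basicOpen]
  exact h2

end StandardLocus

/-! ### Coordinates of nonzero degree on a multi-projective space. -/

section Coordinates

attribute [local instance] MvPolynomial.weightedGradedAlgebra

variable {A : Type u} [CommRing A] {Λ : Type} [AddCommGroup Λ] [DecidableEq Λ]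

/-- In a local ring a sum is a unit only if one of its terms is. A monomial of nonzero degree
contains a variable of nonzero degree, which divides that unit. -/
lemma exists_isUnit_X_of_isUnit {S : Type*} [CommRing S] [IsLocalRing S] {σ : Type*} {d : σ → Λ}
    (κ : MvPolynomial σ A →+* S) {c : Λ} (hc : c ≠ 0) {b : MvPolynomial σ A}
    (hb : MvPolynomial.IsWeightedHomogeneous d b c) (hu : IsUnit (κ b)) :
    ∃ k, d k ≠ 0 ∧ IsUnit (κ (MvPolynomial.X k)) := by
  rw [b.as_sum, map_sum] at hu
  obtain ⟨m, hm, hmu⟩ := IsLocalRing.exists_of_isUnit_sum hu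
  have hw := hb (MvPolynomial.mem_support_iff.1 hm)
  rw [Finsupp.weight_apply] at hw
  obtain ⟨k, hk, hk'⟩ := Finset.exists_ne_zero_of_sum_ne_zero (hw.trans_ne hc)
  refine ⟨k, fun h ↦ hk' (by simp [h]), ?_⟩
  refine isUnit_of_dvd_unit (map_dvd κ ?_) hmu
  rw [MvPolynomial.monomial_eq]
  refine Dvd.dvd.mul_left ?_ _
  exact (dvd_pow_self _ (Finsupp.mem_support_iff.1 hk)).trans
    (Finset.dvd_prod_of_mem (fun i ↦ MvPolynomial.X (R := A) i ^ m i) hk)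

lemma exists_mem_nonvanishingLocus_coordinate [Module.Free ℤ Λ] [Nontrivial Λ] {p : ℕ}
    {d : Fin p → Λ} {X : Scheme.{u}} (φ : X ⟶ multiProjectiveSpace A d) {x : X}
    (hx : φ x ∈ multiProjectiveSpace.standard A d) : ∃ k, d k ≠ 0 ∧
      x ∈ nonvanishingLocus _ (pullbackSection φ (multiProjectiveSpace.coordinate A d k)) := by
  obtain ⟨f, hstd, hy⟩ := mem_standardLocus.1 hx
  obtain ⟨z, hz⟩ := exists_quot_eq hstd hy
  obtain ⟨c, hc, b, hb, hu⟩ : ∃ c ≠ 0, ∃ b ∈ MvPolynomial.weightedHomogeneousSubmodule A d c,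
      IsUnit (algebraMap _ (Localization.Away f.elem) b) := by
    -- If all homogeneous units had degree zero, the group of their degrees would be trivial, but it
    -- is all of the nontrivial group `Λ`.
    by_contra! H
    have : unitDegrees (MvPolynomial.weightedHomogeneousSubmodule A d) f.elem ≤ ⊥ := by
      refine (AddSubgroup.closure_le _).2 fun c ⟨b, hb, hu⟩ ↦ ?_
      by_contra hc
      exact H c hc b hb hu
    rw [hstd, top_le_iff] at this
    exact bot_ne_top this
  have hzf : z ∈ quot _ ⁻¹ᵁ chartOpen _ f := by
    change quot _ z ∈ chartOpen _ f
    rw [hz]; exact hy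
  obtain ⟨k, hk, hku⟩ := exists_isUnit_X_of_isUnit (((relevantLocus _).presheaf.germ _ z hzf).hom.comp
    (toSection (MvPolynomial.weightedHomogeneousSubmodule A d) (chartOpen _ f))) hc hb
    ((isUnit_toSection hu).map ((relevantLocus _).presheaf.germ _ z hzf).hom)
  exact ⟨k, hk, mem_nonvanishingLocus_homogeneousSection φ hstd hy _ hz
    ((Scheme.mem_basicOpen _ _ _ hzf).2 hku)⟩

namespace multiProjectiveSpace

variable [Module.Free ℤ Λ] {p : ℕ} {d : Fin p → Λ} {X : Scheme.{u}}
  (φ : X ⟶ multiProjectiveSpace A d)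

lemma isInvertibleSheaf_pullback (hφ : ∀ x, φ x ∈ standard A d) (a : Λ) :
    IsInvertibleSheaf ((Scheme.Modules.pullback φ).obj (𝒪 A d a)) :=
  isInvertibleSheaf_pullback_twist (𝒜 := MvPolynomial.weightedHomogeneousSubmodule A d) φ hφ a

lemma nonempty_tensor_pullback_iso (hφ : ∀ x, φ x ∈ standard A d) (a b : Λ) : Nonempty
    (tensorModules ((Scheme.Modules.pullback φ).obj (𝒪 A d a))
      ((Scheme.Modules.pullback φ).obj (𝒪 A d b)) ≅
    (Scheme.Modules.pullback φ).obj (𝒪 A d (a + b))) :=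
  nonempty_tensor_pullback_twist_iso (𝒜 := MvPolynomial.weightedHomogeneousSubmodule A d) φ hφ a b

end multiProjectiveSpace

end Coordinates

/-! ### Gluing morphisms and recognising immersions. -/

section Morphisms

variable {X Y : Scheme.{u}}

lemma exists_glue_hom {J : Type*} (V : J → X.Opens) (hV : iSup V = ⊤)
    (g : ∀ j, (V j).toScheme ⟶ Y)
    (H : ∀ j l, X.homOfLE (inf_le_left : V j ⊓ V l ≤ V j) ≫ g j =
      X.homOfLE inf_le_right ≫ g l) : ∃ φ : X ⟶ Y, ∀ j, (V j).ι ≫ φ = g j := by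
  let 𝒰 := X.openCoverOfIsOpenCover V hV
  refine ⟨Scheme.Cover.glueMorphisms 𝒰 g fun j l ↦ ?_, fun j ↦
    Scheme.Cover.ι_glueMorphisms 𝒰 g _ j⟩
  refine (cancel_epi (isPullback_opens_inf (V j) (V l)).isoPullback.hom).1 ?_
  have h1 := (isPullback_opens_inf (V j) (V l)).isoPullback_hom_fst
  have h2 := (isPullback_opens_inf (V j) (V l)).isoPullback_hom_snd
  exact (Category.assoc _ _ _).symm.trans ((congr_arg (· ≫ g j) h1).trans ((H j l).trans
    ((congr_arg (· ≫ g l) h2).symm.trans (Category.assoc _ _ _))))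

/-- Being a closed immersion is local on the target, so `φ` is a closed immersion into the union of
the `W j` followed by the inclusion of an open subset. -/
lemma isImmersion_of_restrict {J : Type*} (φ : X ⟶ Y) (W : J → Y.Opens)
    (hW : ∀ x, ∃ j, φ x ∈ W j) (h : ∀ j, IsClosedImmersion (φ ∣_ W j)) : IsImmersion φ := by
  let U := iSup W
  have hU : φ ⁻¹ᵁ U = ⊤ := by
    refine top_le_iff.1 fun x _ ↦ ?_
    obtain ⟨j, hj⟩ := hW x
    exact TopologicalSpace.Opens.mem_iSup.2 ⟨j, hj⟩
  have h1 : IsClosedImmersion (φ ∣_ U) := by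
    refine IsZariskiLocalAtTarget.of_iSup_eq_top (P := @IsClosedImmersion) (fun j ↦ U.ι ⁻¹ᵁ W j) ?_
      fun j ↦ ?_
    · refine top_le_iff.1 fun x _ ↦ ?_
      obtain ⟨j, hj⟩ := TopologicalSpace.Opens.mem_iSup.1 x.2
      exact TopologicalSpace.Opens.mem_iSup.2 ⟨j, hj⟩
    · have e := morphismRestrictRestrict φ U (U.ι ⁻¹ᵁ W j) ≪≫ morphismRestrictEq φ
        (show U.ι ''ᵁ U.ι ⁻¹ᵁ W j = W j by
          rw [Scheme.Hom.image_preimage_eq_opensRange_inf, Scheme.Opens.opensRange_ι]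
          exact inf_eq_right.2 (le_iSup W j))
      exact ((MorphismProperty.arrow_mk_iso_iff @IsClosedImmersion e).2 (h j))
  have h2 : IsIso (φ ⁻¹ᵁ U).ι := by
    rw [hU]; exact inferInstanceAs (IsIso X.topIso.hom)
  have h3 : φ = inv (φ ⁻¹ᵁ U).ι ≫ (φ ∣_ U) ≫ U.ι := by
    rw [morphismRestrict_ι, IsIso.inv_hom_id_assoc]
  rw [h3]
  infer_instance

/-- Up to the isomorphisms of `V` with its affine model and of `Spec B` with its image, the
restriction is `Spec` of a surjection. -/
lemma isClosedImmersion_restrict (φ : X ⟶ Y) {V : X.Opens} (hV : IsAffineOpen V)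
    {B : CommRingCat.{u}} (g : Spec B ⟶ Y) [IsOpenImmersion g] (σ : B ⟶ Γ(X, V))
    (hσ : Function.Surjective σ) (e : V.ι ≫ φ = V.toSpecΓ ≫ Spec.map σ ≫ g)
    (h : φ ⁻¹ᵁ g.opensRange = V) : IsClosedImmersion (φ ∣_ g.opensRange) := by
  subst h
  have h1 : φ ∣_ g.opensRange = (φ ⁻¹ᵁ g.opensRange).toSpecΓ ≫ Spec.map σ ≫
      g.isoOpensRange.hom := by
    rw [← cancel_mono g.opensRange.ι, morphismRestrict_ι, e]
    simp
  have h2 : IsIso (φ ⁻¹ᵁ g.opensRange).toSpecΓ := by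
    rw [← hV.isoSpec_hom]; infer_instance
  have h3 : IsClosedImmersion (Spec.map σ) := IsClosedImmersion.spec_of_surjective σ hσ
  rw [h1]
  infer_instance

lemma evalSpec_fromSpec {V : X.Opens} (hV : IsAffineOpen V) {W : X.Opens} (h : V ≤ W) (h')
    (w : Γ(X, W)) : evalSpec hV.fromSpec W h' w = res h w := by
  simp only [evalSpec, res, Scheme.Hom.appLE, hV.fromSpec_app_of_le W h, Category.assoc,
    ← Functor.map_comp_assoc]
  have : (Spec Γ(X, V)).presheaf.map ((homOfLE (le_top : hV.fromSpec ⁻¹ᵁ W ≤ ⊤)).op ≫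
      (homOfLE h').op) = 𝟙 _ := (Spec Γ(X, V)).presheaf.map_id _
  rw [this]
  simp

end Morphisms

/-! ### Morphisms from affine schemes to `Proj R`. -/

section ToProj

variable {A : Type u} [CommRing A] {Λ : Type} [AddCommGroup Λ] [DecidableEq Λ]
  {R : Type u} [CommRing R] [Algebra A R] {𝒜 : Λ → Submodule A R} [GradedAlgebra 𝒜]
  {B C : CommRingCat.{u}} (ψ : R →+* B) {f g : Relevant 𝒜}

/-- The extension of `ψ` to `R[f⁻¹]`. -/
def awayExt (hu : IsUnit (ψ f.elem)) : CommRingCat.of (Localization.Away f.elem) ⟶ B :=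
  CommRingCat.ofHom (Localization.awayLift ψ f.elem hu)

@[simp]
lemma awayExt_algebraMap (hu : IsUnit (ψ f.elem)) (r : R) :
    awayExt ψ hu (algebraMap R (Localization.Away f.elem) r) = ψ r :=
  IsLocalization.Away.lift_eq (S := Localization.Away f.elem) f.elem hu r

lemma awayExt_val_mk (hu : IsUnit (ψ f.elem)) {d : Λ} (hf : f.elem ∈ 𝒜 d) {n : ℕ} {c : R}
    (hc : c ∈ 𝒜 (n • d)) :
    ψ f.elem ^ n * awayExt ψ hu (Away.mk 𝒜 hf n c hc).val = ψ c := by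
  rw [← awayExt_algebraMap ψ hu f.elem, ← awayExt_algebraMap ψ hu c, ← map_pow, ← map_mul]
  congr 1
  change _ * (Away.mk 𝒜 hf n c hc).val = _
  rw [Away.val_mk, ← map_pow, ← Localization.mk_one_eq_algebraMap, Localization.mk_mul,
    ← Localization.mk_one_eq_algebraMap, Localization.mk_eq_mk_iff, Localization.r_iff_exists]
  exact ⟨1, by simp⟩

/-- The morphism `Spec B ⟶ Proj R` defined by a homomorphism `R → B` that maps `f` to a unit. -/
def toProj (hu : IsUnit (ψ f.elem)) : Spec B ⟶ multiProj 𝒜 :=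
  Spec.map (awayVal 𝒜 f ≫ awayExt ψ hu) ≫ projChart 𝒜 f

/-- The morphism lifts to the relevant locus through `Spec R[f⁻¹]`. Relations between sections of
`𝒪(a)`, which live on the relevant locus, can therefore be evaluated in `B`. -/
lemma toProj_eq (hu : IsUnit (ψ f.elem)) :
    (Spec.map (awayExt ψ hu) ≫ relChart 𝒜 f) ≫ quot 𝒜 = toProj ψ hu := by
  rw [Category.assoc, relChart_quot, ← Category.assoc, ← Spec.map_comp, toProj]

lemma specMap_awayExt_relevantLocusι (hu : IsUnit (ψ f.elem)) :
    (Spec.map (awayExt ψ hu) ≫ relChart 𝒜 f) ≫ relevantLocusι 𝒜 =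
      Spec.map (CommRingCat.ofHom ψ) := by
  rw [Category.assoc, relChart_ι]
  refine (Spec.map_comp _ _).symm.trans (congr_arg Spec.map ?_)
  ext r
  exact awayExt_algebraMap ψ hu r

lemma specMap_toProj (φ : B ⟶ C) (hu : IsUnit (ψ f.elem)) :
    Spec.map φ ≫ toProj ψ hu = toProj (φ.hom.comp ψ) (f := f) (hu.map φ.hom) := by
  rw [toProj, toProj, ← Category.assoc, ← Spec.map_comp, Category.assoc]
  congr 3
  refine CommRingCat.hom_ext (IsLocalization.ringHom_ext (Submonoid.powers f.elem)
    (RingHom.ext fun r ↦ ?_))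
  change φ (awayExt ψ hu (algebraMap R _ r)) =
    awayExt (φ.hom.comp ψ) (hu.map φ.hom) (algebraMap R _ r)
  rw [awayExt_algebraMap, awayExt_algebraMap]
  rfl

lemma toProj_of_le (h : g ≤ f) (hu : IsUnit (ψ f.elem)) (hv : IsUnit (ψ g.elem)) :
    toProj ψ hu = toProj ψ hv := by
  have h1 : (projDiagram 𝒜).map (homOfLE h) ≫ projChart 𝒜 f = projChart 𝒜 g :=
    chart_w 𝒜 (homOfLE h)
  rw [toProj, toProj, ← h1]
  refine Eq.trans ?_ (Category.assoc _ _ _)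
  congr 1
  refine Eq.trans (congr_arg Spec.map ?_) (Spec.map_comp _ _)
  ext z
  change awayExt ψ hu z.val = awayExt ψ hv (awayZeroLE h z).val
  rw [val_awayZeroLE]
  have h2 : (awayExt ψ hu).hom = (awayExt ψ hv).hom.comp (awayLE h) :=
    IsLocalization.ringHom_ext (Submonoid.powers f.elem) (RingHom.ext fun r ↦ by
      change awayExt ψ hu (algebraMap R _ r) = awayExt ψ hv (awayLE h (algebraMap R _ r))
      rw [awayLE_algebraMap, awayExt_algebraMap, awayExt_algebraMap])
  exact congr($h2 z.val)

/-- Only fractions `c / f ^ n` of degree zero matter. Numerator and denominator have the same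
degree, so they are scaled by the same unit. -/
lemma toProj_congr {ψ ψ' : R →+* B} (hu : IsUnit (ψ f.elem)) (hv : IsUnit (ψ' f.elem))
    (h : ∀ a, ∃ u : B, IsUnit u ∧ ∀ r ∈ 𝒜 a, ψ' r = u * ψ r) : toProj ψ hu = toProj ψ' hv := by
  rw [toProj, toProj]
  congr 2
  ext z
  obtain ⟨d, hd⟩ := f.homogeneous
  obtain ⟨n, c, hc, rfl⟩ := Away.mk_surjective 𝒜 hd z
  change awayExt ψ hu (Away.mk 𝒜 hd n c hc).val = awayExt ψ' hv (Away.mk 𝒜 hd n c hc).val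
  obtain ⟨u, hun, h⟩ := h (n • d)
  have h1 := awayExt_val_mk ψ hu hd hc
  have h2 := awayExt_val_mk ψ' hv hd hc
  have h3 := h _ (SetLike.pow_mem_graded n hd)
  rw [map_pow, map_pow] at h3
  rw [h3, h c hc, ← h1, mul_assoc] at h2
  exact ((hu.pow n).mul_left_cancel (hun.mul_left_cancel h2)).symm

lemma toProj_structureMorphism (hu : IsUnit (ψ f.elem)) : toProj ψ hu ≫ structureMorphism 𝒜 =
    Spec.map (CommRingCat.ofHom (ψ.comp (algebraMap A R))) := by
  rw [toProj, Category.assoc]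
  refine (congr_arg _ (chart_structureMorphism 𝒜 f)).trans ?_
  refine (Spec.map_comp _ _).symm.trans (congr_arg Spec.map ?_)
  ext r
  change awayExt ψ hu (fromZeroRingHom 𝒜 _ (algebraMap A (𝒜 0) r)).val = ψ (algebraMap A R r)
  rw [← awayExt_algebraMap ψ hu]
  congr 1

lemma map_eq_evalSpec_mul (hu : IsUnit (ψ f.elem)) {W : (multiProj 𝒜).Opens}
    (h : ⊤ ≤ toProj ψ hu ⁻¹ᵁ W) {w : Γ(multiProj 𝒜, W)} {p q : R}
    (e : toSection 𝒜 W p = (quot 𝒜).app W w * toSection 𝒜 W q) :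
    ψ p = evalSpec (toProj ψ hu) W h w * ψ q := by
  have h' : ⊤ ≤ (Spec.map (awayExt ψ hu) ≫ relChart 𝒜 f) ⁻¹ᵁ quot 𝒜 ⁻¹ᵁ W := by
    intro x hx
    have := h hx
    rwa [← toProj_eq] at this
  have e1 := evalSpec_toSection_of_eq (specMap_awayExt_relevantLocusι ψ hu) h'
  have e2 := congr(evalSpec (Spec.map (awayExt ψ hu) ≫ relChart 𝒜 f) (quot 𝒜 ⁻¹ᵁ W) h' $e)
  rw [map_mul, e1, e1, evalSpec_app (toProj_eq ψ hu)] at e2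
  exact e2

/-- The lift to the relevant locus lands in the preimage of the chart of `g`, which is `Spec
R[g⁻¹]`, where `g` is invertible. -/
lemma mem_basicOpen_of_toProj_mem (hu : IsUnit (ψ f.elem)) {P : Spec B}
    (h : toProj ψ hu P ∈ chartOpen 𝒜 g) : P ∈ PrimeSpectrum.basicOpen (ψ g.elem) := by
  rw [← toProj_eq] at h
  have h1 : (Spec.map (awayExt ψ hu) ≫ relChart 𝒜 f) P ∈ quot 𝒜 ⁻¹ᵁ chartOpen 𝒜 g := h
  rw [preimage_quot_chartOpen] at h1
  obtain ⟨p, hp⟩ := h1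
  have h2 := congr(relevantLocusι 𝒜 $hp)
  rw [← Scheme.Hom.comp_apply, ← Scheme.Hom.comp_apply, relChart_ι,
    specMap_awayExt_relevantLocusι] at h2
  intro h3
  have h4 : g.elem ∈ (Spec.map (CommRingCat.ofHom ψ) P).asIdeal := h3
  rw [← h2] at h4
  exact p.isPrime.ne_top (Ideal.eq_top_of_isUnit_mem _ h4
    (IsLocalization.Away.algebraMap_isUnit (S := Localization.Away g.elem) g.elem))

end ToProj

/-! ### Morphisms to `Proj R` from local homomorphisms. -/

section LocalPresentation

variable {A : Type u} [CommRing A] {Λ : Type} [AddCommGroup Λ] [DecidableEq Λ]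
  {R : Type u} [CommRing R] [Algebra A R] (𝒜 : Λ → Submodule A R) [GradedAlgebra 𝒜]

/-- Homomorphisms from `R` to the rings of functions on an affine cover of `X`, which differ on
the intersections by units that are multiplicative in the degree. -/
structure LocalPresentation (X : Scheme.{u}) (J : Type*) where
  V : J → X.Opens
  isAffineOpen : ∀ j, IsAffineOpen (V j)
  iSup_eq_top : iSup V = ⊤
  ψ : ∀ j, R →+* Γ(X, V j)
  f : J → Relevant 𝒜
  std : ∀ j, unitDegrees 𝒜 (f j).elem = ⊤
  isUnit : ∀ j, IsUnit (ψ j (f j).elem)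
  u : ∀ j l, Λ → Γ(X, V j ⊓ V l)
  isUnit_u : ∀ j l a, IsUnit (u j l a)
  u_add : ∀ j l a b, u j l (a + b) = u j l a * u j l b
  res_ψ : ∀ j l a, ∀ r ∈ 𝒜 a, res inf_le_right (ψ l r) = u j l a * res inf_le_left (ψ j r)
  inf_eq : ∀ j l, V j ⊓ V l = X.basicOpen (ψ j (f l).elem)

variable {𝒜}

namespace LocalPresentation

variable {X : Scheme.{u}} {J : Type*} (D : LocalPresentation 𝒜 X J)

lemma isAffineOpen_inf (j l : J) : IsAffineOpen (D.V j ⊓ D.V l) := by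
  rw [D.inf_eq]
  exact (D.isAffineOpen j).basicOpen _

/-- The restriction of `ψ j`. -/
def ψRes (j : J) {W : X.Opens} (h : W ≤ D.V j) : R →+* Γ(X, W) := (res h).comp (D.ψ j)

lemma isUnit_ψRes (j : J) {W : X.Opens} (h : W ≤ D.V j) : IsUnit (D.ψRes j h (D.f j).elem) :=
  (D.isUnit j).map (res h)

/-- On the overlap both `f j` and `f l` become units under either homomorphism, so both morphisms
factor through the chart of the product, and there the homomorphisms differ by a unit in each
degree. -/
lemma toProj_ψRes_eq (j l : J) :
    toProj (B := Γ(X, D.V j ⊓ D.V l)) (D.ψRes j inf_le_left) (D.isUnit_ψRes j inf_le_left) =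
      toProj (B := Γ(X, D.V j ⊓ D.V l)) (D.ψRes l inf_le_right) (D.isUnit_ψRes l inf_le_right) := by
  have h1 := D.isUnit_ψRes j (inf_le_left : D.V j ⊓ D.V l ≤ _)
  have h2 := D.isUnit_ψRes l (inf_le_right : D.V j ⊓ D.V l ≤ _)
  obtain ⟨a, ha⟩ := (D.f j).homogeneous
  obtain ⟨b, hb⟩ := (D.f l).homogeneous
  have h3 : IsUnit (D.ψRes j (inf_le_left : D.V j ⊓ D.V l ≤ _) (D.f l).elem) := by
    have : D.ψRes l inf_le_right (D.f l).elem =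
      D.u j l b * D.ψRes j inf_le_left (D.f l).elem := D.res_ψ j l b _ hb
    rw [this] at h2
    exact isUnit_of_mul_isUnit_right h2
  have h4 : IsUnit (D.ψRes l (inf_le_right : D.V j ⊓ D.V l ≤ _) (D.f j).elem) := by
    have : D.ψRes l inf_le_right (D.f j).elem =
      D.u j l a * D.ψRes j inf_le_left (D.f j).elem := D.res_ψ j l a _ ha
    rw [this]
    exact (D.isUnit_u j l a).mul h1
  have h5 : IsUnit (D.ψRes j (inf_le_left : D.V j ⊓ D.V l ≤ _) (D.f j * D.f l).elem) :=
    (map_mul (D.ψRes j inf_le_left) _ _).symm ▸ h1.mul h3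
  have h6 : IsUnit (D.ψRes l (inf_le_right : D.V j ⊓ D.V l ≤ _) (D.f j * D.f l).elem) :=
    (map_mul (D.ψRes l inf_le_right) _ _).symm ▸ h4.mul h2
  rw [toProj_of_le (B := Γ(X, D.V j ⊓ D.V l)) _ ((D.f j).mul_le_left (D.f l)) h1 h5,
    toProj_of_le (B := Γ(X, D.V j ⊓ D.V l)) _ ((D.f j).mul_le_right (D.f l)) h2 h6]
  exact toProj_congr (B := Γ(X, D.V j ⊓ D.V l)) h5 h6 fun a ↦
    ⟨D.u j l a, D.isUnit_u j l a, D.res_ψ j l a⟩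

lemma specMap_res_toProj (j : J) {W : X.Opens} (h : W ≤ D.V j) :
    Spec.map (X.presheaf.map (homOfLE h).op) ≫ toProj (D.ψ j) (D.isUnit j) =
      toProj (B := Γ(X, W)) (D.ψRes j h) (D.isUnit_ψRes j h) :=
  specMap_toProj (D.ψ j) (X.presheaf.map (homOfLE h).op) (D.isUnit j)

lemma exists_hom : ∃ φ : X ⟶ multiProj 𝒜, ∀ j,
    (D.V j).ι ≫ φ = (D.V j).toSpecΓ ≫ toProj (D.ψ j) (D.isUnit j) := by
  refine exists_glue_hom D.V D.iSup_eq_top _ fun j l ↦ ?_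
  have h (j : J) {W : X.Opens} (h : W ≤ D.V j) :
      X.homOfLE h ≫ (D.V j).toSpecΓ ≫ toProj (D.ψ j) (D.isUnit j) =
        W.toSpecΓ ≫ toProj (B := Γ(X, W)) (D.ψRes j h) (D.isUnit_ψRes j h) := by
    rw [← specMap_res_toProj, ← Category.assoc, ← Category.assoc,
      Scheme.Opens.toSpecΓ_SpecMap_presheaf_map]
  rw [h, h, toProj_ψRes_eq]

/-- The morphism `X ⟶ Proj R`. -/
def hom : X ⟶ multiProj 𝒜 := D.exists_hom.choose

lemma ι_hom (j : J) : (D.V j).ι ≫ D.hom = (D.V j).toSpecΓ ≫ toProj (D.ψ j) (D.isUnit j) :=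
  D.exists_hom.choose_spec j

lemma fromSpec_hom (j : J) :
    (D.isAffineOpen j).fromSpec ≫ D.hom = toProj (D.ψ j) (D.isUnit j) := by
  rw [← IsAffineOpen.isoSpec_inv_ι, Category.assoc, ι_hom, IsAffineOpen.isoSpec_inv_toSpecΓ_assoc]

lemma fromSpec_hom_of_le (j : J) {W : X.Opens} (hW : IsAffineOpen W) (h : W ≤ D.V j) :
    hW.fromSpec ≫ D.hom = toProj (B := Γ(X, W)) (D.ψRes j h) (D.isUnit_ψRes j h) := by
  rw [← specMap_res_toProj, ← fromSpec_hom, ← Category.assoc]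
  congr 1
  exact ((D.isAffineOpen j).map_fromSpec hW (homOfLE h).op).symm

lemma exists_mem (x : X) : ∃ j, x ∈ D.V j :=
  TopologicalSpace.Opens.mem_iSup.1 (D.iSup_eq_top.symm ▸ TopologicalSpace.Opens.mem_top x)

lemma exists_fromSpec {j : J} {x : X} (hx : x ∈ D.V j) :
    ∃ P, (D.isAffineOpen j).fromSpec P = x := by
  have : x ∈ Set.range (D.isAffineOpen j).fromSpec := by
    rw [IsAffineOpen.range_fromSpec]; exact hx
  exact this

lemma le_preimage_chartOpen (j : J) : D.V j ≤ D.hom ⁻¹ᵁ chartOpen 𝒜 (D.f j) := by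
  intro x hx
  obtain ⟨P, rfl⟩ := D.exists_fromSpec hx
  change (D.hom ((D.isAffineOpen j).fromSpec P)) ∈ chartOpen 𝒜 (D.f j)
  rw [← Scheme.Hom.comp_apply, fromSpec_hom]
  exact ⟨_, rfl⟩

/-- A point of `V l` that maps to the chart of `f j` is one where `ψ l (f j)` is invertible, and
`inf_eq` places it in `V j`. The exact preimage is what allows closedness to be checked chart by
chart. -/
lemma preimage_chartOpen (j : J) : D.hom ⁻¹ᵁ chartOpen 𝒜 (D.f j) = D.V j := by
  refine le_antisymm (fun x hx ↦ ?_) (D.le_preimage_chartOpen j)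
  obtain ⟨l, hl⟩ := D.exists_mem x
  obtain ⟨P, rfl⟩ := D.exists_fromSpec hl
  have h1 : D.hom ((D.isAffineOpen l).fromSpec P) ∈ chartOpen 𝒜 (D.f j) := hx
  rw [← Scheme.Hom.comp_apply, fromSpec_hom] at h1
  have h2 := mem_basicOpen_of_toProj_mem (D.ψ l) (D.isUnit l) h1
  have h3 : P ∈ (D.isAffineOpen l).fromSpec ⁻¹ᵁ X.basicOpen (D.ψ l (D.f j).elem) := by
    rw [IsAffineOpen.fromSpec_preimage_basicOpen]; exact h2
  have h4 : (D.isAffineOpen l).fromSpec P ∈ X.basicOpen (D.ψ l (D.f j).elem) := h3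
  rw [← D.inf_eq] at h4
  exact h4.2

lemma hom_mem_standardLocus (x : X) : D.hom x ∈ standardLocus 𝒜 :=
  let ⟨j, hj⟩ := D.exists_mem x
  mem_standardLocus.2 ⟨D.f j, D.std j, D.le_preimage_chartOpen j hj⟩

lemma hom_structureMorphism (π : X ⟶ Spec (.of A))
    (h : ∀ j, (D.V j).toSpecΓ ≫ Spec.map (CommRingCat.ofHom ((D.ψ j).comp (algebraMap A R))) =
      (D.V j).ι ≫ π) : D.hom ≫ structureMorphism 𝒜 = π := by
  refine Scheme.Cover.hom_ext (X.openCoverOfIsOpenCover D.V D.iSup_eq_top) _ _ fun j ↦ ?_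
  refine (Category.assoc _ _ _).symm.trans ?_
  refine (congr_arg (· ≫ structureMorphism 𝒜) (D.ι_hom j)).trans ?_
  refine (Category.assoc _ _ _).trans ?_
  rw [toProj_structureMorphism]
  exact h j

/-- The hypothesis says that each function on `V j` is the image of a fraction `c / f ^ n` of degree
zero, so `R[f⁻¹]₀ → Γ(X, V j)` is onto. -/
lemma isImmersion_hom (h : ∀ j, ∀ y : Γ(X, D.V j), ∃ (d : Λ) (n : ℕ), (D.f j).elem ∈ 𝒜 d ∧
    ∃ c ∈ 𝒜 (n • d), D.ψ j c = D.ψ j (D.f j).elem ^ n * y) : IsImmersion D.hom := by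
  refine isImmersion_of_restrict D.hom (fun j ↦ chartOpen 𝒜 (D.f j))
    (fun x ↦ let ⟨j, hj⟩ := D.exists_mem x; ⟨j, D.le_preimage_chartOpen j hj⟩) fun j ↦ ?_
  refine isClosedImmersion_restrict D.hom (D.isAffineOpen j) (projChart 𝒜 (D.f j))
    (awayVal 𝒜 (D.f j) ≫ awayExt (D.ψ j) (D.isUnit j)) (fun y ↦ ?_) (D.ι_hom j)
    (D.preimage_chartOpen j)
  obtain ⟨d, n, hd, c, hc, e⟩ := h j y
  refine ⟨Away.mk 𝒜 hd n c hc, ?_⟩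
  change awayExt (D.ψ j) (D.isUnit j) (Away.mk 𝒜 hd n c hc).val = y
  rw [← awayExt_val_mk (D.ψ j) (D.isUnit j) hd hc] at e
  exact ((D.isUnit j).pow n).mul_left_cancel e

lemma u_zero (j l : J) : D.u j l 0 = 1 :=
  (D.isUnit_u j l 0).mul_left_cancel (by rw [← D.u_add, add_zero, mul_one])

lemma u_nsmul (j l : J) (a : Λ) (n : ℕ) : D.u j l (n • a) = D.u j l a ^ n := by
  induction n with
  | zero => rw [zero_smul, u_zero, pow_zero]
  | succ n ih => rw [succ_nsmul, D.u_add, ih, pow_succ]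

/-- Over the chart of `f j` the sheaf `𝒪(a)` is generated by a unit `b j / f j ^ n j`; its pull-back
is matched with `β j • τ j`, where `β j` is the value of this unit under `ψ j`. The transition
functions agree because `ψ j` and `ψ l` differ in degree `a` by the transition function of `τ`. -/
lemma nonempty_pullback_twist_iso [Module.Free ℤ Λ] {L : X.Modules} {a : Λ}
    {τ : ∀ j, Γ(L, D.V j)} (hτ : ∀ j, IsGen L (τ j))
    (h : ∀ j l, resM L inf_le_left (τ j) = D.u j l a • resM L inf_le_right (τ l)) :
    Nonempty ((Scheme.Modules.pullback D.hom).obj (twist 𝒜 a) ≅ L) := by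
  choose d hd using fun j ↦ (D.f j).homogeneous
  choose n b s hb hu hs using fun j ↦ exists_twistVal_unit (D.std j) (hd j) a
  have hβ (j) : ∃ β : Γ(X, D.V j), IsUnit β ∧ D.ψ j (D.f j).elem ^ n j * β = D.ψ j (b j) := by
    obtain ⟨i, hi⟩ := ((D.isUnit j).pow (n j)).exists_right_inv
    obtain ⟨r, k, hr⟩ := exists_mul_eq_pow (hu j)
    have hbu : IsUnit (D.ψ j (b j)) := by
      refine isUnit_of_mul_isUnit_left (y := D.ψ j r) ?_
      rw [← map_mul, hr, map_pow]
      exact (D.isUnit j).pow k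
    exact ⟨i * D.ψ j (b j), (isUnit_iff_exists_inv'.2 ⟨_, hi⟩).mul hbu, by rw [← mul_assoc, hi, one_mul]⟩
  choose β hβu hβ using hβ
  have hs' (j) := isGen_twist (D.std j) (hd j) (hb j) (hu j) (hs j)
  refine nonempty_iso_of_gens (U := D.V) D.exists_mem
    (fun j ↦ ((hs' j).pullSec D.hom).resM (D.le_preimage_chartOpen j))
    (fun j ↦ (hτ j).smul (hβu j)) fun j l ↦ ?_
  obtain ⟨w, hw⟩ := (hs' l).exists_smul
    (inf_le_right : chartOpen 𝒜 (D.f j) ⊓ chartOpen 𝒜 (D.f l) ≤ _) (resM _ inf_le_left (s j))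
  have hle : D.V j ⊓ D.V l ≤ D.hom ⁻¹ᵁ (chartOpen 𝒜 (D.f j) ⊓ chartOpen 𝒜 (D.f l)) :=
    fun x hx ↦ ⟨D.le_preimage_chartOpen j hx.1, D.le_preimage_chartOpen l hx.2⟩
  refine ⟨res hle (D.hom.app _ w), ?_, ?_⟩
  · have h1 := congr(resM _ hle (pullSec D.hom $hw))
    rw [pullSec_smul, resM_smul, ← resM_pullSec D.hom inf_le_left,
      ← resM_pullSec D.hom inf_le_right, resM_resM, resM_resM] at h1
    rw [resM_resM, resM_resM]
    exact h1
  · rw [resM_smul, resM_smul, h j l, smul_smul, smul_smul]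
    congr 1
    have e1 := congr(twistVal $hw)
    rw [twistVal_smul, twistVal_resM, twistVal_resM] at e1
    have e2 := congr(res ((quot 𝒜).preimage_mono
      (inf_le_left : chartOpen 𝒜 (D.f j) ⊓ chartOpen 𝒜 (D.f l) ≤ _)) $(hs j))
    have e3 := congr(res ((quot 𝒜).preimage_mono
      (inf_le_right : chartOpen 𝒜 (D.f j) ⊓ chartOpen 𝒜 (D.f l) ≤ _)) $(hs l))
    rw [map_mul, map_pow, res_toSection inf_le_left, res_toSection inf_le_left] at e2
    rw [map_mul, map_pow, res_toSection inf_le_right, res_toSection inf_le_right] at e3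
    -- The relation `s j = w s l` with denominators cleared, so that it becomes a relation between
    -- elements of `R`.
    have e4 : toSection 𝒜 (chartOpen 𝒜 (D.f j) ⊓ chartOpen 𝒜 (D.f l))
        ((D.f l).elem ^ n l * b j) = (quot 𝒜).app _ w * toSection 𝒜 _ ((D.f j).elem ^ n j * b l) := by
      rw [map_mul, map_mul, map_pow, map_pow, ← e2, ← e3, e1]
      ring
    have e5 := D.fromSpec_hom_of_le l (D.isAffineOpen_inf j l) inf_le_right
    have h'' : ⊤ ≤ (D.isAffineOpen_inf j l).fromSpec ⁻¹ᵁ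
        D.hom ⁻¹ᵁ (chartOpen 𝒜 (D.f j) ⊓ chartOpen 𝒜 (D.f l)) := by
      intro P _
      refine hle ?_
      have : (D.isAffineOpen_inf j l).fromSpec P ∈ Set.range (D.isAffineOpen_inf j l).fromSpec :=
        ⟨P, rfl⟩
      rwa [IsAffineOpen.range_fromSpec] at this
    have h' : ⊤ ≤ toProj (B := Γ(X, D.V j ⊓ D.V l)) (D.ψRes l inf_le_right)
        (D.isUnit_ψRes l inf_le_right) ⁻¹ᵁ (chartOpen 𝒜 (D.f j) ⊓ chartOpen 𝒜 (D.f l)) := by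
      rw [← e5]
      exact h''
    -- The relation is evaluated through `ψ l` alone. Then `e7` and `e8` rewrite `f j` and `b j` in
    -- terms of `ψ j`; the powers of `u (d j)` cancel and a single factor `u a` remains.
    have e6 := map_eq_evalSpec_mul (B := Γ(X, D.V j ⊓ D.V l)) (D.ψRes l inf_le_right)
      (D.isUnit_ψRes l inf_le_right) h' e4
    rw [← evalSpec_app e5 _ h'', evalSpec_fromSpec _ hle] at e6
    have e7 := D.res_ψ j l _ _ (hd j)
    have e8 := D.res_ψ j l _ _ (hb j)
    rw [D.u_add, D.u_nsmul] at e8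
    have e9 := congr(res (inf_le_left : D.V j ⊓ D.V l ≤ _) $(hβ j))
    have e10 := congr(res (inf_le_right : D.V j ⊓ D.V l ≤ _) $(hβ l))
    have u1 := (D.isUnit j).map (res (inf_le_left : D.V j ⊓ D.V l ≤ _))
    have u2 := (D.isUnit l).map (res (inf_le_right : D.V j ⊓ D.V l ≤ _))
    have u3 := D.isUnit_u j l (d j)
    simp only [map_mul, map_pow] at e9 e10
    rw [map_mul, map_mul, map_pow, map_pow] at e6
    change res inf_le_right (D.ψ l _) ^ n l * res inf_le_right (D.ψ l _) = _ *
      (res inf_le_right (D.ψ l _) ^ n j * res inf_le_right (D.ψ l _)) at e6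
    rw [e7, e8, ← e9, ← e10] at e6
    refine (((u1.pow (n j)).mul (u2.pow (n l))).mul (u3.pow (n j))).mul_left_cancel ?_
    linear_combination e6

end LocalPresentation

end LocalPresentation

/-! ### Sections of all degrees as families of functions. -/

section Families

/-- An affine cover with invertible functions on the intersections that satisfy the cocycle
condition and are multiplicative in the degree. -/
structure Transition (Λ : Type) [AddCommGroup Λ] (X : Scheme.{u}) (K : Type*) where
  U : K → X.Opens
  isAffineOpen : ∀ k, IsAffineOpen (U k)
  exists_mem : ∀ x, ∃ k, x ∈ U k
  u : ∀ k l, Λ → Γ(X, U k ⊓ U l)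
  isUnit_u : ∀ k l a, IsUnit (u k l a)
  u_add : ∀ k l a b, u k l (a + b) = u k l a * u k l b
  cocycle : ∀ k l m a (W : X.Opens) (h₁ : W ≤ U k ⊓ U l) (h₂ : W ≤ U l ⊓ U m)
    (h₃ : W ≤ U k ⊓ U m), res h₁ (u k l a) * res h₂ (u l m a) = res h₃ (u k m a)

namespace Transition

variable {Λ : Type} [AddCommGroup Λ] {X : Scheme.{u}} {K : Type*} (D : Transition Λ X K)

lemma u_zero (k l : K) : D.u k l 0 = 1 :=
  (D.isUnit_u k l 0).mul_left_cancel (by rw [← D.u_add, add_zero, mul_one])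

lemma u_nsmul (k l : K) (a : Λ) (n : ℕ) : D.u k l (n • a) = D.u k l a ^ n := by
  induction n with
  | zero => rw [zero_smul, u_zero, pow_zero]
  | succ n ih => rw [succ_nsmul, D.u_add, ih, pow_succ]

lemma u_sum (k l : K) {σ : Type*} (s : Finset σ) (a : σ → Λ) :
    D.u k l (∑ i ∈ s, a i) = ∏ i ∈ s, D.u k l (a i) := by
  classical
  induction s using Finset.induction_on with
  | empty => simp [u_zero]
  | insert i s hi ih => rw [Finset.sum_insert hi, Finset.prod_insert hi, D.u_add, ih]

/-- A family of functions that is a section of the invertible sheaf of degree `a`. -/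
def IsHomogeneous (a : Λ) (g : ∀ k, Γ(X, D.U k)) : Prop :=
  ∀ k l, res inf_le_right (g l) = D.u k l a * res inf_le_left (g k)

variable {D}

lemma IsHomogeneous.mul {a b : Λ} {g h : ∀ k, Γ(X, D.U k)} (hg : D.IsHomogeneous a g)
    (hh : D.IsHomogeneous b h) : D.IsHomogeneous (a + b) (g * h) := fun k l ↦ by
  rw [Pi.mul_apply, Pi.mul_apply, map_mul, map_mul, hg k l, hh k l, D.u_add]
  ring

lemma isHomogeneous_zero (a : Λ) : D.IsHomogeneous a 0 := fun k l ↦ by simp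

lemma IsHomogeneous.res_eq {a : Λ} {g : ∀ k, Γ(X, D.U k)} (hg : D.IsHomogeneous a g) {k l : K}
    {W : X.Opens} (h : W ≤ D.U k ⊓ D.U l) :
    res (h.trans inf_le_right) (g l) = res h (D.u k l a) * res (h.trans inf_le_left) (g k) := by
  have := congr(res h $(hg k l))
  rwa [res_res, map_mul, res_res] at this

/-- The open subset where a section does not vanish. -/
def locus (D : Transition Λ X K) (g : ∀ k, Γ(X, D.U k)) : X.Opens := ⨆ k, X.basicOpen (g k)

/-- The functions of the family differ on overlaps by units, so they have the same zeros there. -/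
lemma IsHomogeneous.basicOpen_eq {a : Λ} {g : ∀ k, Γ(X, D.U k)} (hg : D.IsHomogeneous a g) (k : K) :
    X.basicOpen (g k) = D.U k ⊓ D.locus g := by
  refine le_antisymm (le_inf (X.basicOpen_le _) (le_iSup (fun k ↦ X.basicOpen (g k)) k)) ?_
  intro x ⟨hx, hx'⟩
  obtain ⟨l, hl⟩ := TopologicalSpace.Opens.mem_iSup.1 hx'
  have hx'' : x ∈ D.U l := X.basicOpen_le _ hl
  have h1 : x ∈ X.basicOpen (res (inf_le_right : D.U k ⊓ D.U l ≤ _) (g l)) := by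
    rw [res, Scheme.basicOpen_res]; exact ⟨⟨hx, hx''⟩, hl⟩
  rw [hg k l, Scheme.basicOpen_mul, res, Scheme.basicOpen_res] at h1
  exact h1.2.2

lemma IsHomogeneous.basicOpen_res_eq {a : Λ} {g : ∀ k, Γ(X, D.U k)} (hg : D.IsHomogeneous a g)
    {k : K} {W : X.Opens} (hW : W ≤ D.U k) : X.basicOpen (res hW (g k)) = W ⊓ D.locus g := by
  rw [res, Scheme.basicOpen_res, hg.basicOpen_eq, ← inf_assoc, inf_eq_left.2 hW]

lemma locus_mul {a b : Λ} {g h : ∀ k, Γ(X, D.U k)} (hg : D.IsHomogeneous a g)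
    (hh : D.IsHomogeneous b h) : D.locus (g * h) = D.locus g ⊓ D.locus h := by
  ext x
  obtain ⟨k, hk⟩ := D.exists_mem x
  have h1 := congr(x ∈ $((hg.mul hh).basicOpen_eq k))
  rw [Pi.mul_apply, Scheme.basicOpen_mul, hg.basicOpen_eq, hh.basicOpen_eq] at h1
  have h2 : x ∈ D.U k ⊓ D.locus g ⊓ (D.U k ⊓ D.locus h) ↔ x ∈ D.U k ⊓ D.locus (g * h) :=
    Iff.of_eq h1
  exact ⟨fun h ↦ ⟨(h2.2 ⟨hk, h⟩).1.2, (h2.2 ⟨hk, h⟩).2.2⟩, fun h ↦ (h2.1 ⟨⟨hk, h.1⟩, ⟨hk, h.2⟩⟩).2⟩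

/-- A section on the locus of `g` extends after the multiplication by a power of `g`. -/
lemma IsHomogeneous.exists_extension [Finite K] [TopologicalSpace.NoetherianSpace X] {a b : Λ}
    {g : ∀ k, Γ(X, D.U k)} (hg : D.IsHomogeneous b g) (t : ∀ k, Γ(X, X.basicOpen (g k)))
    (ht : ∀ k l (W : X.Opens) (h₁ : W ≤ X.basicOpen (g k)) (h₂ : W ≤ X.basicOpen (g l))
      (h : W ≤ D.U k ⊓ D.U l), res h₂ (t l) = res h (D.u k l a) * res h₁ (t k)) :
    ∃ (N : ℕ) (T : ∀ k, Γ(X, D.U k)), D.IsHomogeneous (a + N • b) T ∧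
      ∀ k, res (X.basicOpen_le _) (T k) = res (X.basicOpen_le _) (g k) ^ N * t k := by
  -- On each affine `U k` a power of `g k` clears the denominator of `t k`; as there are finitely
  -- many `k`, one exponent `N` serves for all.
  have h1 (k) : ∃ (n : ℕ) (y : Γ(X, D.U k)), res (X.basicOpen_le _) y =
      res (X.basicOpen_le _) (g k) ^ n * t k :=
    exists_eq_pow_mul_of_isAffineOpen X (D.U k) (D.isAffineOpen k) (g k) (t k)
  choose n y hy using h1
  obtain ⟨N, hN⟩ := Finite.exists_le n
  let s (k) := g k ^ (N - n k) * y k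
  have hs (k) : res (X.basicOpen_le _) (s k) = res (X.basicOpen_le _) (g k) ^ N * t k := by
    rw [map_mul, map_pow, hy, ← mul_assoc, ← pow_add, Nat.sub_add_cancel (hN k)]
  -- The extensions are compatible only on the locus of `g`. On the compact overlap the defect is
  -- killed by a power of `g`, and finitely many pairs need only one exponent `M`.
  have h2 (p : K × K) : ∃ m : ℕ, res inf_le_right (g p.2) ^ m * (res inf_le_right (s p.2) -
      D.u p.1 p.2 (a + N • b) * res inf_le_left (s p.1)) = 0 := by
    obtain ⟨k, l⟩ := p
    refine exists_pow_mul_eq_zero_of_res_basicOpen_eq_zero_of_isCompact X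
      (TopologicalSpace.NoetherianSpace.isCompact _) _ _ ?_
    change res (X.basicOpen_le _) _ = 0
    set W := X.basicOpen (res (inf_le_right : D.U k ⊓ D.U l ≤ _) (g l)) with hW
    have hWl : W ≤ X.basicOpen (g l) := by
      rw [hW, res, Scheme.basicOpen_res]; exact inf_le_right
    have hWk : W ≤ X.basicOpen (g k) := by
      rw [hW, hg k l, Scheme.basicOpen_mul]
      refine inf_le_right.trans ?_
      rw [res, Scheme.basicOpen_res]; exact inf_le_right
    have hWU : W ≤ D.U k ⊓ D.U l := X.basicOpen_le _
    have e1 := ht k l W hWk hWl hWU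
    have e2 := congr(res hWl $(hs l))
    have e3 := congr(res hWk $(hs k))
    have e4 := hg.res_eq hWU
    simp only [map_mul, map_pow, res_res, map_sub, D.u_add, D.u_nsmul] at e1 e2 e3 e4 ⊢
    rw [e2, e3, e4, e1]
    ring
  choose m hm using h2
  obtain ⟨M, hM⟩ := Finite.exists_le m
  refine ⟨N + M, fun k ↦ g k ^ M * s k, fun k l ↦ ?_, fun k ↦ ?_⟩
  · have e1 : res inf_le_right (g l) ^ M * (res inf_le_right (s l) -
      D.u k l (a + N • b) * res inf_le_left (s k)) = 0 := by
      rw [← Nat.sub_add_cancel (hM (k, l)), pow_add, mul_assoc, hm (k, l), mul_zero]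
    have e2 := hg k l
    simp only [map_mul, map_pow, D.u_add, D.u_nsmul, add_smul] at e1 ⊢
    rw [mul_sub, sub_eq_zero] at e1
    rw [e1, e2]
    ring
  · rw [map_mul, map_pow, hs]
    ring

end Transition

end Families

/-! ### Constants from the base ring. -/

section Base

variable {A : Type u} [CommRing A] {X : Scheme.{u}} (π : X ⟶ Spec (.of A))

/-- The constants. -/
def base (V : X.Opens) : A →+* Γ(X, V) :=
  ((Scheme.ΓSpecIso (.of A)).inv ≫
    π.appLE ⊤ V ((le_top : V ≤ ⊤).trans (Scheme.Hom.preimage_top π).ge)).hom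

lemma res_base {V W : X.Opens} (h : W ≤ V) (a : A) : res h (base π V a) = base π W a := by
  have := π.appLE_map (U := ⊤) (V := V) (V' := W)
    ((le_top : V ≤ ⊤).trans (Scheme.Hom.preimage_top π).ge) (homOfLE h).op
  exact congr($this ((Scheme.ΓSpecIso (.of A)).inv a))

lemma toSpecΓ_base (V : X.Opens) :
    V.toSpecΓ ≫ Spec.map (CommRingCat.ofHom (base π V)) = V.ι ≫ π := by
  have h1 := Scheme.Opens.toSpecΓ_SpecMap_appLE π (U := ⊤) (V := V)
    ((le_top : V ≤ ⊤).trans (Scheme.Hom.preimage_top π).ge)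
  have h2 : CommRingCat.ofHom (base π V) = (Scheme.ΓSpecIso (.of A)).inv ≫
    π.appLE ⊤ V ((le_top : V ≤ ⊤).trans (Scheme.Hom.preimage_top π).ge) := rfl
  rw [h2, Spec.map_comp, reassoc_of% h1, Scheme.Opens.toSpecΓ_top, Category.assoc]
  simp

end Base

lemma isUnit_of_le_basicOpen {X : Scheme.{u}} {V : X.Opens} {r : Γ(X, V)}
    (h : V ≤ X.basicOpen r) : IsUnit r := by
  have h1 : IsUnit (res (X.basicOpen_le r) r) := RingedSpace.isUnit_res_basicOpen _ r
  have h2 := h1.map (res h)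
  rwa [res_res, res_refl] at h2

/-! ### Embedding charts and the substitution homomorphisms. -/

section Charts

variable {A : Type u} [CommRing A] {Λ : Type} [AddCommGroup Λ] {X : Scheme.{u}}
  (π : X ⟶ Spec (.of A)) {K : Type*} (D : Transition Λ X K) {I : Type} (e : I → Λ)
  {σ : Type*} (d : σ → Λ) (F : σ → ∀ k, Γ(X, D.U k))

/-- An affine open subset `V` that is the locus of one of the sections `F v`, on which there are
nonvanishing sections `F v` whose degrees generate, and functions on `V` generated by fractions. -/
structure EmbeddingChart (V : X.Opens) where
  isAffineOpen : IsAffineOpen V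
  k : K
  le : V ≤ D.U k
  h : σ
  locus_eq : D.locus (F h) = V
  t : I → σ
  M : I → ℕ
  d_t : ∀ i, d (t i) = e i + M i • d h
  le_locus : ∀ i, V ≤ D.locus (F (t i))
  -- For homogeneous sections `F h` is invertible on `V`, so `y` is the degree zero fraction of `F
  -- v` by `F h ^ N`; the condition says that these fractions and the constants generate `Γ(X, V)`.
  eq_top : ∀ S : Subring Γ(X, V), (∀ a, base π V a ∈ S) → (∀ v N y, d v = N • d h →
    res le (F v k) = res le (F h k) ^ N * y → y ∈ S) → S = ⊤

variable {π D e d F}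

/-- A larger set of sections. -/
def EmbeddingChart.map {V : X.Opens} (c : EmbeddingChart π D e d F V) {σ' : Type*} {d' : σ' → Λ}
    {F' : σ' → ∀ k, Γ(X, D.U k)} (j : σ → σ') (hd : ∀ v, d' (j v) = d v)
    (hF : ∀ v, F' (j v) = F v) : EmbeddingChart π D e d' F' V where
  isAffineOpen := c.isAffineOpen
  k := c.k
  le := c.le
  h := j c.h
  locus_eq := by rw [hF, c.locus_eq]
  t i := j (c.t i)
  M := c.M
  d_t i := by rw [hd, hd, c.d_t]
  le_locus i := by rw [hF]; exact c.le_locus i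
  eq_top S h1 h2 := c.eq_top S h1 fun v N y hv hy ↦ h2 (j v) N y (by rw [hd, hd, hv])
    (by rw [hF, hF, hy])

namespace Transition

lemma locus_one : D.locus 1 = ⊤ := by
  refine top_le_iff.1 fun x _ ↦ ?_
  obtain ⟨k, hk⟩ := D.exists_mem x
  refine TopologicalSpace.Opens.mem_iSup.2 ⟨k, ?_⟩
  rw [Pi.one_apply, Scheme.basicOpen_of_isUnit _ isUnit_one]
  exact hk

lemma isHomogeneous_prod {s : Finset I} {a : I → Λ} {g : I → ∀ k, Γ(X, D.U k)}
    (hg : ∀ i, D.IsHomogeneous (a i) (g i)) : D.IsHomogeneous (∑ i ∈ s, a i) (∏ i ∈ s, g i) := by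
  classical
  induction s using Finset.induction_on with
  | empty => intro k l; simp [u_zero]
  | insert i s hi ih => rw [Finset.sum_insert hi, Finset.prod_insert hi]; exact (hg i).mul ih

lemma le_locus_prod {s : Finset I} {a : I → Λ} {g : I → ∀ k, Γ(X, D.U k)}
    (hg : ∀ i, D.IsHomogeneous (a i) (g i)) {V : X.Opens} (h : ∀ i, V ≤ D.locus (g i)) :
    V ≤ D.locus (∏ i ∈ s, g i) := by
  classical
  induction s using Finset.induction_on with
  | empty => rw [Finset.prod_empty, locus_one]; exact le_top
  | insert i s hi ih =>
    rw [Finset.prod_insert hi, locus_mul (hg i) (isHomogeneous_prod hg)]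
    exact le_inf (h i) ih

end Transition

namespace EmbeddingChart

variable {V : X.Opens} (c : EmbeddingChart π D e d F V)

/-- The substitution of the sections for the variables. -/
def evalHom : MvPolynomial σ A →+* Γ(X, V) :=
  MvPolynomial.eval₂Hom (base π V) fun v ↦ res c.le (F v c.k)

@[simp]
lemma evalHom_X (v : σ) : c.evalHom (.X v) = res c.le (F v c.k) :=
  MvPolynomial.eval₂Hom_X' _ _ _

lemma evalHom_comp_algebraMap : c.evalHom.comp (algebraMap A _) = base π V :=
  RingHom.ext fun a ↦ MvPolynomial.eval₂Hom_C _ _ a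

variable {V' : X.Opens} (c' : EmbeddingChart π D e d F V')

/-- Each variable is replaced by a section of its own degree and `u` is multiplicative in the
degree, so every monomial of degree `a` acquires the same factor. -/
lemma res_evalHom (hF : ∀ v, D.IsHomogeneous (d v) (F v)) {a : Λ} {r : MvPolynomial σ A}
    (hr : MvPolynomial.IsWeightedHomogeneous d r a) :
    res (inf_le_right : V ⊓ V' ≤ V') (c'.evalHom r) =
      res (inf_le_inf c.le c'.le) (D.u c.k c'.k a) * res inf_le_left (c.evalHom r) := by
  rw [r.as_sum, map_sum, map_sum, map_sum, map_sum, Finset.mul_sum]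
  refine Finset.sum_congr rfl fun m hm ↦ ?_
  have ha := hr (MvPolynomial.mem_support_iff.1 hm)
  rw [Finsupp.weight_apply, Finsupp.sum] at ha
  rw [evalHom, evalHom, MvPolynomial.coe_eval₂Hom, MvPolynomial.coe_eval₂Hom,
    MvPolynomial.eval₂_monomial, MvPolynomial.eval₂_monomial, map_mul, map_mul, res_base, res_base,
    ← ha, D.u_sum, mul_left_comm, Finsupp.prod, Finsupp.prod, map_prod, map_prod, map_prod,
    ← Finset.prod_mul_distrib]
  congr 1
  refine Finset.prod_congr rfl fun v _ ↦ ?_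
  rw [D.u_nsmul, map_pow, map_pow, map_pow, res_res, res_res, ← mul_pow]
  congr 1
  exact (hF v).res_eq (inf_le_inf c.le c'.le)

end EmbeddingChart

end Charts

/-! ### The immersion defined by embedding charts. -/

section Embedding

attribute [local instance] MvPolynomial.weightedGradedAlgebra

variable {A : Type u} [CommRing A] {Λ : Type} [AddCommGroup Λ] {X : Scheme.{u}}
  {π : X ⟶ Spec (.of A)} {K : Type*} {D : Transition Λ X K} {I : Type} [Fintype I] {e : I → Λ}
  {p : ℕ} {d : Fin p → Λ} {F : Fin p → ∀ k, Γ(X, D.U k)}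

namespace EmbeddingChart

section

variable {V : X.Opens} (c : EmbeddingChart π D e d F V)

/-- The product of the variables for the nonvanishing sections. -/
def poly : MvPolynomial (Fin p) A := .X c.h * ∏ i, .X (c.t i)

/-- The degree of `poly`. -/
def deg : Λ := d c.h + ∑ i, d (c.t i)

/-- The product of the nonvanishing sections. -/
def prodSection : ∀ k, Γ(X, D.U k) := F c.h * ∏ i, F (c.t i)

lemma poly_mem : MvPolynomial.IsWeightedHomogeneous d c.poly c.deg :=
  (MvPolynomial.isWeightedHomogeneous_X A d _).mul
    (MvPolynomial.IsWeightedHomogeneous.prod _ _ _ fun _ _ ↦ MvPolynomial.isWeightedHomogeneous_X A d _)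

lemma evalHom_poly {V' : X.Opens} (c' : EmbeddingChart π D e d F V') :
    c.evalHom c'.poly = res c.le (c'.prodSection c.k) := by
  simp [poly, prodSection]

lemma isHomogeneous_section (hF : ∀ v, D.IsHomogeneous (d v) (F v)) :
    D.IsHomogeneous c.deg c.prodSection :=
  (hF _).mul (Transition.isHomogeneous_prod fun _ ↦ hF _)

/-- The additional factors have no zeros on `V`, so they do not shrink the locus of the first one.
-/
lemma locus_prodSection (hF : ∀ v, D.IsHomogeneous (d v) (F v)) : D.locus c.prodSection = V := by
  rw [prodSection, Transition.locus_mul (hF _) (Transition.isHomogeneous_prod fun _ ↦ hF _),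
    c.locus_eq]
  exact inf_eq_left.2 (Transition.le_locus_prod (fun i ↦ hF (c.t i)) c.le_locus)

lemma isUnit_evalHom_poly (hF : ∀ v, D.IsHomogeneous (d v) (F v)) :
    IsUnit (c.evalHom c.poly) := by
  rw [evalHom_poly]
  refine isUnit_of_le_basicOpen ?_
  rw [(c.isHomogeneous_section hF).basicOpen_res_eq, c.locus_prodSection hF, inf_idem]

lemma inf_eq_basicOpen (hF : ∀ v, D.IsHomogeneous (d v) (F v)) {V' : X.Opens}
    (c' : EmbeddingChart π D e d F V') : V ⊓ V' = X.basicOpen (c.evalHom c'.poly) := by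
  rw [evalHom_poly, (c'.isHomogeneous_section hF).basicOpen_res_eq, c'.locus_prodSection hF]

/-- Fractions of degree zero with a power of `poly` as denominator form a subring, so the generators
in `eq_top` suffice. This is the surjectivity behind the immersion. -/
lemma exists_evalHom_eq (y : Γ(X, V)) :
    ∃ n, ∃ q : MvPolynomial (Fin p) A, MvPolynomial.IsWeightedHomogeneous d q (n • c.deg) ∧
      c.evalHom q = c.evalHom c.poly ^ n * y := by
  let S : Subring Γ(X, V) :=
    { carrier := {y | ∃ n, ∃ q : MvPolynomial (Fin p) A,
        MvPolynomial.IsWeightedHomogeneous d q (n • c.deg) ∧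
        c.evalHom q = c.evalHom c.poly ^ n * y}
      zero_mem' := ⟨0, 0, MvPolynomial.isWeightedHomogeneous_zero A d _, by simp⟩
      one_mem' := ⟨0, 1, by rw [zero_smul]; exact MvPolynomial.isWeightedHomogeneous_one A d, by simp⟩
      add_mem' := by
        rintro y z ⟨n, q, hq, h⟩ ⟨m, r, hr, h'⟩
        refine ⟨n + m, q * c.poly ^ m + r * c.poly ^ n, ?_, ?_⟩
        · rw [add_smul]
          refine (hq.mul (c.poly_mem.pow m)).add ?_
          rw [add_comm]
          exact hr.mul (c.poly_mem.pow n)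
        · simp only [map_add, map_mul, map_pow, h, h']
          ring
      mul_mem' := by
        rintro y z ⟨n, q, hq, h⟩ ⟨m, r, hr, h'⟩
        refine ⟨n + m, q * r, ?_, ?_⟩
        · rw [add_smul]
          exact hq.mul hr
        · simp only [map_mul, h, h']
          ring
      neg_mem' := by
        rintro y ⟨n, q, hq, h⟩
        exact ⟨n, -q, neg_mem (S := Submodule A _)
          (s := MvPolynomial.weightedHomogeneousSubmodule A d _) hq, by rw [map_neg, h, mul_neg]⟩ }
  have hS : S = ⊤ := by
    -- The fraction `F v / F h ^ N` is expanded by the `N`-th power of the other variables of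
    -- `poly`, so that its denominator becomes `poly ^ N`.
    refine c.eq_top S (fun a ↦ ⟨0, .C a, ?_, ?_⟩) fun v N y hv hy ↦ ⟨N,
      .X v * (∏ i, .X (c.t i)) ^ N, ?_, ?_⟩
    · rw [zero_smul]; exact MvPolynomial.isWeightedHomogeneous_C d a
    · rw [pow_zero, one_mul]; exact MvPolynomial.eval₂Hom_C _ _ a
    · rw [deg, smul_add, ← hv]
      exact (MvPolynomial.isWeightedHomogeneous_X A d _).mul
        ((MvPolynomial.IsWeightedHomogeneous.prod _ _ _
          fun _ _ ↦ MvPolynomial.isWeightedHomogeneous_X A d _).pow N)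
    · rw [poly, map_mul, map_mul, map_pow, evalHom_X, hy, evalHom_X, mul_pow]
      ring
  exact (hS ▸ Subring.mem_top y : y ∈ S)

variable [DecidableEq Λ]

/-- All variables dividing `poly` become units, and `e i` is the degree of `t i` minus `M i` times
the degree of `h`. -/
lemma unitDegrees_poly (he : AddSubgroup.closure (Set.range e) = ⊤) :
    unitDegrees (MvPolynomial.weightedHomogeneousSubmodule A d) c.poly = ⊤ := by
  have h (v : Fin p) (hv : .X v ∣ c.poly) :
      d v ∈ unitDegrees (MvPolynomial.weightedHomogeneousSubmodule A d) c.poly := by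
    obtain ⟨r, hr⟩ := hv
    exact AddSubgroup.subset_closure ⟨.X v, MvPolynomial.isWeightedHomogeneous_X A d v,
      isUnit_of_mul_eq_pow (r := r) (n := 1) (by rw [pow_one, hr])⟩
  rw [← top_le_iff, ← he, AddSubgroup.closure_le]
  rintro _ ⟨i, rfl⟩
  rw [show e i = d (c.t i) - c.M i • d c.h by rw [c.d_t]; abel]
  exact sub_mem (h _ (Dvd.dvd.mul_left (Finset.dvd_prod_of_mem _ (Finset.mem_univ i)) _))
    (nsmul_mem (h _ (Dvd.intro _ rfl)) _)

/-- `poly` as a relevant element. -/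
def relevant (he : AddSubgroup.closure (Set.range e) = ⊤) :
    Relevant (MvPolynomial.weightedHomogeneousSubmodule A d) where
  elem := c.poly
  homogeneous := ⟨_, c.poly_mem⟩
  finiteIndex := by rw [c.unitDegrees_poly he]; infer_instance

end

variable [DecidableEq Λ] {J : Type*} {V : J → X.Opens}

/-- The local presentation defined by embedding charts that cover `X`. -/
def localPresentation (c : ∀ j, EmbeddingChart π D e d F (V j)) (hV : iSup V = ⊤) (hF : ∀ v, D.IsHomogeneous (d v) (F v))
    (he : AddSubgroup.closure (Set.range e) = ⊤) :
    LocalPresentation (MvPolynomial.weightedHomogeneousSubmodule A d) X J where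
  V := V
  isAffineOpen j := (c j).isAffineOpen
  iSup_eq_top := hV
  ψ j := (c j).evalHom
  f j := (c j).relevant he
  std j := (c j).unitDegrees_poly he
  isUnit j := (c j).isUnit_evalHom_poly hF
  u j l a := res (inf_le_inf (c j).le (c l).le) (D.u (c j).k (c l).k a)
  isUnit_u j l a := (D.isUnit_u _ _ a).map _
  u_add j l a b := by rw [D.u_add, map_mul]
  res_ψ j l a r hr := (c j).res_evalHom (c l) hF hr
  inf_eq j l := (c j).inf_eq_basicOpen hF (c l)

theorem exists_immersion [Module.Free ℤ Λ] (c : ∀ j, EmbeddingChart π D e d F (V j)) (hV : iSup V = ⊤)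
    (hF : ∀ v, D.IsHomogeneous (d v) (F v)) (he : AddSubgroup.closure (Set.range e) = ⊤) :
    ∃ φ : X ⟶ multiProjectiveSpace A d, IsImmersion φ ∧
      φ ≫ multiProjectiveSpace.toSpec A d = π ∧
      (∀ x, φ x ∈ multiProjectiveSpace.standard A d) ∧
      ∀ (L : X.Modules) (a : Λ) (τ : ∀ k, Γ(L, D.U k)), (∀ k, IsGen L (τ k)) →
        (∀ k l, resM L inf_le_left (τ k) = D.u k l a • resM L inf_le_right (τ l)) →
        Nonempty ((Scheme.Modules.pullback φ).obj (multiProjectiveSpace.𝒪 A d a) ≅ L) := by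
  let P := localPresentation c hV hF he
  refine ⟨P.hom, P.isImmersion_hom fun j y ↦ ?_, P.hom_structureMorphism π fun j ↦ ?_,
    P.hom_mem_standardLocus, fun L a τ hτ h ↦ ?_⟩
  · obtain ⟨n, q, hq, h⟩ := (c j).exists_evalHom_eq y
    exact ⟨(c j).deg, n, (c j).poly_mem, q, hq, h⟩
  · refine Eq.trans ?_ (toSpecΓ_base π (V j))
    exact congr((V j).toSpecΓ ≫ Spec.map (CommRingCat.ofHom $((c j).evalHom_comp_algebraMap)))
  · refine P.nonempty_pullback_twist_iso (τ := fun j ↦ resM L (c j).le (τ (c j).k))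
      (fun j ↦ (hτ _).resM _) fun j l ↦ ?_
    have := congr(resM L (inf_le_inf (c j).le (c l).le) $(h (c j).k (c l).k))
    rw [resM_smul, resM_resM, resM_resM] at this
    change resM L (inf_le_left : V j ⊓ V l ≤ V j) (resM L (c j).le (τ (c j).k)) =
      res (inf_le_inf (c j).le (c l).le) (D.u (c j).k (c l).k a) •
        resM L (inf_le_right : V j ⊓ V l ≤ V l) (resM L (c l).le (τ (c l).k))
    rw [resM_resM, resM_resM]
    exact this

end EmbeddingChart

end Embedding

/-! ### Construction of embedding charts on a Noetherian scheme. -/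

section ExistsCharts

namespace Transition

variable {Λ : Type} [AddCommGroup Λ] {X : Scheme.{u}} [TopologicalSpace.NoetherianSpace X]
  {K : Type*} [Finite K] {D : Transition Λ X K} {b : Λ} {g : ∀ k, Γ(X, D.U k)}

/-- A function on the locus of `g` extends after the multiplication by a power of `g`. -/
lemma IsHomogeneous.exists_extension_function (hg : D.IsHomogeneous b g)
    (y : Γ(X, D.locus g)) : ∃ (N : ℕ) (T : ∀ k, Γ(X, D.U k)), D.IsHomogeneous (N • b) T ∧
      ∀ (k) (W : X.Opens) (h : W ≤ D.U k) (h' : W ≤ D.locus g),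
        res h (T k) = res h (g k) ^ N * res h' y := by
  have hle (k) : X.basicOpen (g k) ≤ D.locus g := le_iSup (fun k ↦ X.basicOpen (g k)) k
  obtain ⟨N, T, hT, h⟩ := hg.exists_extension (a := 0) (fun k ↦ res (hle k) y)
    fun k l W h₁ h₂ h ↦ by rw [D.u_zero, map_one, one_mul, res_res, res_res]
  refine ⟨N, T, by rwa [zero_add] at hT, fun k W hW hW' ↦ ?_⟩
  have h1 : W ≤ X.basicOpen (g k) := by
    rw [hg.basicOpen_eq]; exact le_inf hW hW'
  have h2 := congr(res h1 $(h k))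
  rwa [res_res, map_mul, map_pow, res_res, res_res] at h2

/-- If `T` extends `g ^ N y`, then on the locus of `g` it vanishes exactly where `y` does. The
product `g T` therefore has the required locus. -/
lemma IsHomogeneous.exists_basicOpen_eq_locus (hg : D.IsHomogeneous b g) (y : Γ(X, D.locus g)) :
    ∃ b' g', D.IsHomogeneous b' g' ∧ D.locus g' = X.basicOpen y := by
  obtain ⟨N, T, hT, h⟩ := hg.exists_extension_function y
  refine ⟨_, _, hg.mul hT, ?_⟩
  rw [locus_mul hg hT]
  have key (k) : D.U k ⊓ D.locus g ⊓ D.locus T = D.U k ⊓ X.basicOpen y := by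
    have h1 := h k (D.U k ⊓ D.locus g) inf_le_left inf_le_right
    have h2 : IsUnit (res (inf_le_left : D.U k ⊓ D.locus g ≤ _) (g k)) := by
      refine isUnit_of_le_basicOpen ?_
      rw [hg.basicOpen_res_eq, inf_assoc, inf_idem]
    have h3 := congr(X.basicOpen $h1)
    rw [hT.basicOpen_res_eq, Scheme.basicOpen_mul, Scheme.basicOpen_of_isUnit _ (h2.pow N), res,
      Scheme.basicOpen_res] at h3
    rw [h3, ← inf_assoc, inf_idem, inf_assoc, inf_eq_right.2 (X.basicOpen_le y)]
  ext x
  obtain ⟨k, hk⟩ := D.exists_mem x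
  have h1 : x ∈ D.U k ⊓ D.locus g ⊓ D.locus T ↔ x ∈ D.U k ⊓ X.basicOpen y := by rw [key]
  exact ⟨fun h ↦ (h1.1 ⟨⟨hk, h.1⟩, h.2⟩).2, fun h ↦ ⟨(h1.2 ⟨hk, h⟩).1.2, (h1.2 ⟨hk, h⟩).2⟩⟩

/-- Some basic open subset of the affine locus contains `x` and lies in a trivialising `U k`, and it
is again a locus. -/
lemma IsHomogeneous.exists_small_locus (hg : D.IsHomogeneous b g) (ha : IsAffineOpen (D.locus g))
    {x : X} (hx : x ∈ D.locus g) : ∃ b' g' k, D.IsHomogeneous b' g' ∧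
      IsAffineOpen (D.locus g') ∧ x ∈ D.locus g' ∧ D.locus g' ≤ D.U k := by
  obtain ⟨k, hk⟩ := D.exists_mem x
  obtain ⟨y, hy, hxy⟩ := ha.exists_basicOpen_le ⟨x, hk⟩ hx
  obtain ⟨b', g', hg', h⟩ := hg.exists_basicOpen_eq_locus y
  exact ⟨b', g', k, hg', h ▸ ha.basicOpen y, h ▸ hxy, h ▸ hy⟩

/-- The invertible sheaf of degree `a` is trivial on a small locus, so it has a section that does
not vanish there. -/
lemma IsHomogeneous.exists_nonvanishing (hg : D.IsHomogeneous b g) {k : K}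
    (hk : D.locus g ≤ D.U k) (a : Λ) : ∃ (M : ℕ) (T : ∀ k, Γ(X, D.U k)),
      D.IsHomogeneous (a + M • b) T ∧ D.locus g ≤ D.locus T := by
  have hle (l) : X.basicOpen (g l) ≤ D.U k ⊓ D.U l :=
    le_inf ((le_iSup (fun k ↦ X.basicOpen (g k)) l).trans hk) (X.basicOpen_le _)
  -- The generator over `U k` has coordinate `1` on `U k`, hence `u k l a` on `U l`; the cocycle
  -- condition says that this is a homogeneous family.
  obtain ⟨M, T, hT, h⟩ := hg.exists_extension (a := a) (fun l ↦ res (hle l) (D.u k l a))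
    fun l m W h₁ h₂ h ↦ by
      rw [res_res, res_res, mul_comm]
      exact (D.cocycle k l m a W _ _ _).symm
  refine ⟨M, T, hT, iSup_le fun l ↦ ?_⟩
  have h1 : IsUnit (res (X.basicOpen_le (g l)) (g l)) := RingedSpace.isUnit_res_basicOpen _ (g l)
  have h2 := (h1.pow M).mul ((D.isUnit_u k l a).map (res (hle l)))
  rw [← h] at h2
  have h3 := Scheme.basicOpen_of_isUnit _ h2
  rw [hT.basicOpen_res_eq] at h3
  exact h3.ge.trans inf_le_right

end Transition

variable {A : Type u} [CommRing A] {X : Scheme.{u}} (π : X ⟶ Spec (.of A))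

/-- Finite type over `A`, in the form required by `EmbeddingChart.eq_top`. -/
lemma exists_generators [LocallyOfFiniteType π] {V : X.Opens} (hV : IsAffineOpen V) :
    ∃ G : Finset Γ(X, V), ∀ S : Subring Γ(X, V), (∀ a, base π V a ∈ S) → (∀ y ∈ G, y ∈ S) →
      S = ⊤ := by
  have h1 : (base π V).FiniteType := by
    refine RingHom.FiniteType.comp (Scheme.Hom.finiteType_appLE π (isAffineOpen_top _) hV _)
      (RingHom.FiniteType.of_surjective _ ?_)
    exact (ConcreteCategory.bijective_of_isIso (Scheme.ΓSpecIso (.of A)).inv).2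
  let := (base π V).toAlgebra
  have h2 : Algebra.FiniteType A Γ(X, V) := h1
  obtain ⟨G, hG⟩ := h2.out
  refine ⟨G, fun S hS hGS ↦ top_le_iff.1 fun y _ ↦ ?_⟩
  have hy : y ∈ Algebra.adjoin A (G : Set Γ(X, V)) := hG ▸ Algebra.mem_top
  induction hy using Algebra.adjoin_induction with
  | mem y hy => exact hGS y hy
  | algebraMap a => exact hS a
  | add y z _ _ h h' => exact add_mem (h trivial) (h' trivial)
  | mul y z _ _ h h' => exact mul_mem (h trivial) (h' trivial)

variable {Λ : Type} [AddCommGroup Λ] [TopologicalSpace.NoetherianSpace X]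
  {K : Type*} [Finite K] {D : Transition Λ X K} {I : Type} [Finite I] (e : I → Λ)

lemma Transition.IsHomogeneous.exists_embeddingChart [LocallyOfFiniteType π] {b : Λ}
    {g : ∀ k, Γ(X, D.U k)} (hg : D.IsHomogeneous b g) (ha : IsAffineOpen (D.locus g)) {k : K}
    (hk : D.locus g ≤ D.U k) : ∃ S : Set (Λ × ∀ k, Γ(X, D.U k)), S.Finite ∧
      (∀ s ∈ S, D.IsHomogeneous s.1 s.2) ∧
      Nonempty (EmbeddingChart π D e (fun s : S ↦ s.1.1) (fun s : S ↦ s.1.2) (D.locus g)) := by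
  choose M T hT hle using fun i ↦ hg.exists_nonvanishing hk (e i)
  obtain ⟨G, hG⟩ := exists_generators π ha
  choose N Y hY h using fun y ↦ hg.exists_extension_function y
  -- The section that cuts out the chart, a nonvanishing section for each `e i`, and an extension of
  -- `g ^ N y` for each generator `y` of the functions.
  let S : Set (Λ × ∀ k, Γ(X, D.U k)) := {(b, g)} ∪ Set.range (fun i ↦ (e i + M i • b, T i)) ∪
    (fun y ↦ (N y • b, Y y)) '' G
  have h1 : (b, g) ∈ S := .inl (.inl rfl)
  have h2 (i) : (e i + M i • b, T i) ∈ S := .inl (.inr ⟨i, rfl⟩)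
  have h3 (y) (hy : y ∈ G) : (N y • b, Y y) ∈ S := .inr ⟨y, hy, rfl⟩
  refine ⟨S, (((Set.finite_singleton _).union (Set.finite_range _)).union
    (G.finite_toSet.image _)), ?_, ⟨?_⟩⟩
  · rintro s ((rfl | ⟨i, rfl⟩) | ⟨y, hy, rfl⟩)
    exacts [hg, hT i, hY y]
  · exact
      { isAffineOpen := ha
        k := k
        le := hk
        h := ⟨_, h1⟩
        locus_eq := rfl
        t i := ⟨_, h2 i⟩
        M := M
        d_t i := rfl
        le_locus := hle
        eq_top S hS hS' := hG S hS fun y hy ↦ hS' ⟨_, h3 y hy⟩ (N y) y rfl (by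
          have := h y k (D.locus g) hk le_rfl
          rwa [res_refl _ y] at this) }

/-- Finitely many sections define embedding charts that cover `X`. -/
lemma exists_embeddingCharts [LocallyOfFiniteType π]
    (hX : ∀ x, ∃ b g, D.IsHomogeneous b g ∧ x ∈ D.locus g ∧ IsAffineOpen (D.locus g)) :
    ∃ (p : ℕ) (d : Fin p → Λ) (F : Fin p → ∀ k, Γ(X, D.U k)),
      (∀ v, D.IsHomogeneous (d v) (F v)) ∧ (∀ i, ∃ v, d v = e i) ∧
      ∃ (J : Type u) (V : J → X.Opens), iSup V = ⊤ ∧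
        Nonempty (∀ j, EmbeddingChart π D e d F (V j)) := by
  have H (x : X) : ∃ V : X.Opens, x ∈ V ∧ ∃ S : Set (Λ × ∀ k, Γ(X, D.U k)), S.Finite ∧
      (∀ s ∈ S, D.IsHomogeneous s.1 s.2) ∧
      Nonempty (EmbeddingChart π D e (fun s : S ↦ s.1.1) (fun s : S ↦ s.1.2) V) := by
    obtain ⟨b, g, hg, hx, ha⟩ := hX x
    obtain ⟨b', g', k, hg', ha', hx', hk⟩ := hg.exists_small_locus ha hx
    exact ⟨_, hx', hg'.exists_embeddingChart π e ha' hk⟩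
  choose V hV S hS hSh c using H
  obtain ⟨t, ht⟩ := isCompact_univ.elim_finite_subcover (fun x ↦ (V x : Set X))
    (fun x ↦ (V x).2) fun x _ ↦ Set.mem_iUnion.2 ⟨x, hV x⟩
  -- The zero sections of degree `e i` are added only to ensure that every `e i` is the degree of a
  -- variable.
  let S' : Set (Λ × ∀ k, Γ(X, D.U k)) := (⋃ x ∈ t, S x) ∪ Set.range fun i ↦ (e i, 0)
  have hS' : S'.Finite := (t.finite_toSet.biUnion fun x _ ↦ hS x).union (Set.finite_range _)
  have hS'h : ∀ s ∈ S', D.IsHomogeneous s.1 s.2 := by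
    rintro s (hs | ⟨i, rfl⟩)
    · obtain ⟨x, hx⟩ := Set.mem_iUnion.1 hs
      obtain ⟨hx, hs⟩ := Set.mem_iUnion.1 hx
      exact hSh x s hs
    · exact Transition.isHomogeneous_zero _
  have : Finite S' := hS'
  let E := Finite.equivFin S'
  refine ⟨Nat.card S', fun v ↦ (E.symm v).1.1, fun v ↦ (E.symm v).1.2, fun v ↦ ?_, fun i ↦ ?_,
    t, fun x ↦ V x, ?_, ⟨fun x ↦ (c x).some.map (fun s ↦ E ⟨s, ?_⟩) (fun s ↦ ?_) fun s ↦ ?_⟩⟩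
  · exact hS'h _ (E.symm v).2
  · exact ⟨E ⟨_, .inr (Set.mem_range_self i)⟩, congr_arg (fun s : S' ↦ s.1.1) (E.symm_apply_apply _)⟩
  · refine top_le_iff.1 fun x _ ↦ ?_
    obtain ⟨y, hy⟩ := Set.mem_iUnion.1 (ht (Set.mem_univ x))
    obtain ⟨hy, hx⟩ := Set.mem_iUnion.1 hy
    exact TopologicalSpace.Opens.mem_iSup.2 ⟨⟨y, hy⟩, hx⟩
  · exact .inl (Set.mem_biUnion x.2 s.2)
  · rw [Equiv.symm_apply_apply]
  · rw [Equiv.symm_apply_apply]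

end ExistsCharts

/-! ### From ample families to immersions. -/

section AmpleFamily

variable {X : Scheme.{u}} {I : Type} [Fintype I] [DecidableEq I] {L : I → X.Modules}

/-- Local generators of invertible sheaves over a finite affine cover. -/
lemma exists_gens [CompactSpace X] (hL : ∀ i, IsInvertibleSheaf (L i)) :
    ∃ (K : Type u) (_ : Finite K) (U : K → X.Opens) (τ : ∀ i k, Γ(L i, U k)),
      (∀ k, IsAffineOpen (U k)) ∧ (∀ x, ∃ k, x ∈ U k) ∧ ∀ i k, IsGen (L i) (τ i k) := by
  have H (x : X) : ∃ (W : X.Opens) (τ : ∀ i, Γ(L i, W)), x ∈ W ∧ IsAffineOpen W ∧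
      ∀ i, IsGen (L i) (τ i) := by
    choose U hU m hm using fun i ↦ isInvertibleSheaf_iff.1 (hL i) x
    obtain ⟨W, hW, hxW, hWU⟩ := exists_isAffineOpen_mem_and_subset (x := x) (U := ⨅ i, U i)
      (by rw [← SetLike.mem_coe, TopologicalSpace.Opens.coe_iInf]; simpa using hU)
    have hle (i) : W ≤ U i := fun y hy ↦ (iInf_le U i) (hWU hy)
    exact ⟨W, fun i ↦ resM (L i) (hle i) (m i), hxW, hW, fun i ↦ (hm i).resM _⟩
  choose W τ hx hW hτ using H
  obtain ⟨t, ht⟩ := isCompact_univ.elim_finite_subcover (fun x ↦ (W x : Set X))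
    (fun x ↦ (W x).2) fun x _ ↦ Set.mem_iUnion.2 ⟨x, hx x⟩
  refine ⟨t, inferInstance, fun x ↦ W x, fun i x ↦ τ x i, fun x ↦ hW x, fun x ↦ ?_,
    fun i x ↦ hτ x i⟩
  obtain ⟨y, hy⟩ := Set.mem_iUnion.1 (ht (Set.mem_univ x))
  obtain ⟨hy, hx⟩ := Set.mem_iUnion.1 hy
  exact ⟨⟨y, hy⟩, hx⟩

/-- The transition functions of finitely many invertible sheaves. -/
lemma exists_transition {K : Type u} {U : K → X.Opens} {τ : ∀ i k, Γ(L i, U k)}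
    (hU : ∀ k, IsAffineOpen (U k)) (hx : ∀ x, ∃ k, x ∈ U k) (hτ : ∀ i k, IsGen (L i) (τ i k)) :
    ∃ (D : Transition (I → ℤ) X K) (τ : ∀ i k, Γ(L i, D.U k)), (∀ i k, IsGen (L i) (τ i k)) ∧
      ∀ i k l, resM (L i) inf_le_left (τ i k) =
        D.u k l (Pi.single i 1) • resM (L i) inf_le_right (τ i l) := by
  -- The transition functions are taken as units, because degrees in `I → ℤ` require negative
  -- powers.
  have H (i k l) : ∃ r : Γ(X, U k ⊓ U l)ˣ,
      resM (L i) inf_le_left (τ i k) = r.1 • resM (L i) inf_le_right (τ i l) := by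
    obtain ⟨r, hr⟩ := (hτ i l).exists_smul inf_le_right (resM (L i) inf_le_left (τ i k))
    have h1 := (hτ i k).resM (inf_le_left : U k ⊓ U l ≤ _)
    rw [hr] at h1
    obtain ⟨r, rfl⟩ := ((hτ i l).resM _).isUnit_of_smul h1
    exact ⟨r, hr⟩
  choose t ht using H
  have hW (i k l) {W : X.Opens} (h₁ : W ≤ U k) (h₂ : W ≤ U l) :
      resM (L i) h₁ (τ i k) = res (le_inf h₁ h₂) (t i k l).1 • resM (L i) h₂ (τ i l) := by
    have := congr(resM (L i) (le_inf h₁ h₂) $(ht i k l))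
    rwa [resM_smul, resM_resM, resM_resM] at this
  have hc (i k l m) {W : X.Opens} (h₁ : W ≤ U k ⊓ U l) (h₂ : W ≤ U l ⊓ U m) (h₃ : W ≤ U k ⊓ U m) :
      Units.map (res h₁ : _ →* Γ(X, W)) (t i k l) * Units.map (res h₂ : _ →* Γ(X, W)) (t i l m) =
        Units.map (res h₃ : _ →* Γ(X, W)) (t i k m) := by
    refine Units.ext ((hτ i m).cancel (h₂.trans inf_le_right) ?_)
    change (res h₁ (t i k l).1 * res h₂ (t i l m).1) • _ = res h₃ (t i k m).1 • _
    rw [mul_smul, ← hW i l m (h₂.trans inf_le_left), ← hW i k l (h₁.trans inf_le_left),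
      ← hW i k m]
  obtain ⟨u, hu⟩ : ∃ u : ∀ k l, (I → ℤ) → Γ(X, U k ⊓ U l)ˣ,
    ∀ k l a, u k l a = ∏ i, t i k l ^ a i := ⟨_, fun _ _ _ ↦ rfl⟩
  have hadd (k l) (a b : I → ℤ) : u k l (a + b) = u k l a * u k l b := by
    rw [hu, hu, hu, ← Finset.prod_mul_distrib]
    simp only [Pi.add_apply, zpow_add]
  have hcoc (k l m a) (W : X.Opens) (h₁ : W ≤ U k ⊓ U l) (h₂ : W ≤ U l ⊓ U m)
      (h₃ : W ≤ U k ⊓ U m) : Units.map (res h₁ : _ →* Γ(X, W)) (u k l a) *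
      Units.map (res h₂ : _ →* Γ(X, W)) (u l m a) =
        Units.map (res h₃ : _ →* Γ(X, W)) (u k m a) := by
    simp only [hu, map_prod, map_zpow, ← Finset.prod_mul_distrib, ← mul_zpow]
    exact Finset.prod_congr rfl fun i _ ↦ by rw [hc i k l m h₁ h₂ h₃]
  have hsingle (i k l) : u k l (Pi.single i 1) = t i k l := by
    rw [hu, Finset.prod_eq_single i]
    · rw [Pi.single_eq_same, zpow_one]
    · intro j _ hj
      rw [Pi.single_eq_of_ne hj, zpow_zero]
    · exact fun h ↦ (h (Finset.mem_univ i)).elim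
  exact ⟨
    { U := U
      isAffineOpen := hU
      exists_mem := hx
      u k l a := (u k l a).1
      isUnit_u k l a := Units.isUnit _
      u_add k l a b := by rw [hadd, Units.val_mul]
      cocycle k l m a W h₁ h₂ h₃ := congr_arg Units.val (hcoc k l m a W h₁ h₂ h₃) },
    τ, hτ, fun i k l ↦ (ht i k l).trans (by rw [← hsingle])⟩

/-- A section of a tensor power as a family of functions. -/
lemma exists_isHomogeneous_locus_eq {K : Type u} {D : Transition (I → ℤ) X K}
    {τ : ∀ i k, Γ(L i, D.U k)} (hτ : ∀ i k, IsGen (L i) (τ i k))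
    (h : ∀ i k l, resM (L i) inf_le_left (τ i k) =
      D.u k l (Pi.single i 1) • resM (L i) inf_le_right (τ i l)) {i : I} {n : ℕ}
    (g : Γ(tensorPower (L i) n, ⊤)) : ∃ f, D.IsHomogeneous (n • Pi.single i 1) f ∧
      D.locus f = nonvanishingLocus _ g := by
  have hn (k) := (hτ i k).sectionPow n
  choose f hf using fun k ↦ (hn k).exists_smul le_rfl (resM _ le_top g)
  simp only [resM_refl] at hf
  refine ⟨f, fun k l ↦ ?_, ?_⟩
  -- The family consists of the coordinates of `g` with respect to the powers of the generators,
  -- whose transition functions are the `n`-th powers of `u`.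
  · refine (hn l).cancel inf_le_right ?_
    have h1 := congr(resM _ (inf_le_left : D.U k ⊓ D.U l ≤ _) $(hf k))
    have h2 := congr(resM _ (inf_le_right : D.U k ⊓ D.U l ≤ _) $(hf l))
    rw [resM_resM, resM_smul] at h1 h2
    rw [← h2, h1, resM_sectionPow, h, sectionPow_smul, smul_smul, ← resM_sectionPow, D.u_nsmul,
      mul_comm]
  · have key (k) {x} (hx : x ∈ D.U k) : x ∈ nonvanishingLocus _ g ↔ x ∈ X.basicOpen (f k) :=
      mem_nonvanishingLocus_iff (hn k) (hf k) hx
    ext x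
    refine ⟨fun hx ↦ ?_, fun hx ↦ ?_⟩
    · obtain ⟨k, hk⟩ := TopologicalSpace.Opens.mem_iSup.1 hx
      exact (key k (X.basicOpen_le _ hk)).2 hk
    · obtain ⟨k, hk⟩ := D.exists_mem x
      exact TopologicalSpace.Opens.mem_iSup.2 ⟨k, (key k hk).1 hx⟩

/-- No power of `L i` beyond the first is needed: the extra sections have degree `e i + M i b`, so
the degrees of homogeneous units on each chart already fill `I → ℤ`. -/
theorem exists_immersion_of_isAmpleFamily {A : Type u} [CommRing A] [IsNoetherianRing A]
    (π : X ⟶ Spec (.of A)) [LocallyOfFiniteType π] [QuasiCompact π]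
    (hL : ∀ i, IsInvertibleSheaf (L i)) (hA : IsAmpleFamily L) :
    ∃ (p : ℕ) (d : Fin p → (I → ℤ)), ContainsBasis d ∧
      ∃ ι : X ⟶ multiProjectiveSpace A d, IsImmersion ι ∧
        ι ≫ multiProjectiveSpace.toSpec A d = π ∧
        (∀ x : X, ι x ∈ multiProjectiveSpace.standard A d) ∧
        ∀ i : I, Nonempty ((Scheme.Modules.pullback ι).obj
          (multiProjectiveSpace.𝒪 A d (Pi.single i 1)) ≅ tensorPower (L i) 1) := by
  have : IsLocallyNoetherian X := LocallyOfFiniteType.isLocallyNoetherian π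
  have : CompactSpace X := QuasiCompact.compactSpace_of_compactSpace π
  have : IsNoetherian X := { }
  obtain ⟨K, _, U, τ, hU, hx, hτ⟩ := exists_gens hL
  obtain ⟨D, τ, hτ, h⟩ := exists_transition hU hx hτ
  let e (i : I) : I → ℤ := Pi.single i 1
  obtain ⟨p, d, F, hF, hd, J, V, hV, ⟨c⟩⟩ := exists_embeddingCharts (D := D) π e fun x ↦ by
    obtain ⟨i, n, g, -, hx, ha⟩ := hA x
    obtain ⟨f, hf, hfg⟩ := exists_isHomogeneous_locus_eq hτ h g
    exact ⟨_, f, hf, hfg ▸ hx, hfg ▸ ha⟩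
  let b := Pi.basisFun ℤ I
  have hb (i) : b i = e i := Pi.basisFun_apply ℤ I i
  have he : AddSubgroup.closure (Set.range e) = ⊤ := by
    rw [← funext hb, ← Submodule.span_int_eq_addSubgroupClosure, b.span_eq]
    rfl
  obtain ⟨ι, h1, h2, h3, h4⟩ := EmbeddingChart.exists_immersion c hV hF he
  refine ⟨p, d, ⟨I, b, ?_⟩, ι, h1, h2, h3, fun i ↦ ?_⟩
  · rintro _ ⟨i, rfl⟩
    rw [hb]
    exact hd i
  -- The first tensor power is the structure sheaf tensored with `L i`, generated by `1 ⊗ τ`, with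
  -- the same transition functions as `L i`.
  · refine h4 _ _ (fun k ↦ sectionPow (τ i k) 1) (fun k ↦ (hτ i k).sectionPow 1) fun k l ↦ ?_
    rw [resM_sectionPow, resM_sectionPow, h, sectionPow_smul, pow_one]

end AmpleFamily

end MultiProj

end

theorem mainTheorem12 {A : Type u} [CommRing A] [IsNoetherianRing A] {X : Scheme.{u}}
    (π : X ⟶ Spec (.of A)) [LocallyOfFiniteType π] [QuasiCompact π] :
    (∀ (q : ℕ) (L : Fin q → X.Modules), (∀ i, MultiProj.IsInvertibleSheaf (L i)) →
      MultiProj.IsAmpleFamily L →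
      ∃ I : Finset (Fin q), MultiProj.IsAmpleFamily (fun i : I ↦ L i) ∧
      ∃ (p : ℕ) (d : Fin p → (I → ℤ)), MultiProj.ContainsBasis d ∧
      ∃ ι : X ⟶ MultiProj.multiProjectiveSpace A d, IsImmersion ι ∧
        ι ≫ MultiProj.multiProjectiveSpace.toSpec A d = π ∧
        (∀ x : X, ι x ∈ MultiProj.multiProjectiveSpace.standard A d) ∧
        ∀ i : I, ∃ n : ℕ, 0 < n ∧
          Nonempty ((Scheme.Modules.pullback ι).obj
              (MultiProj.multiProjectiveSpace.𝒪 A d (Pi.single i 1)) ≅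
            MultiProj.tensorPower (L i) n)) ∧
    (∀ (q p : ℕ) (d : Fin p → (Fin q → ℤ)), 0 < q → MultiProj.ContainsBasis d →
      ∀ ι : X ⟶ MultiProj.multiProjectiveSpace A d, IsImmersion ι →
        ι ≫ MultiProj.multiProjectiveSpace.toSpec A d = π →
        (∀ x : X, ι x ∈ MultiProj.multiProjectiveSpace.standard A d) →
        (∀ a : Fin q → ℤ, MultiProj.IsInvertibleSheaf
          ((Scheme.Modules.pullback ι).obj (MultiProj.multiProjectiveSpace.𝒪 A d a))) ∧
        (∀ a b : Fin q → ℤ, Nonempty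
          (MultiProj.tensorModules
              ((Scheme.Modules.pullback ι).obj (MultiProj.multiProjectiveSpace.𝒪 A d a))
              ((Scheme.Modules.pullback ι).obj (MultiProj.multiProjectiveSpace.𝒪 A d b)) ≅
            (Scheme.Modules.pullback ι).obj (MultiProj.multiProjectiveSpace.𝒪 A d (a + b)))) ∧
        ∀ x : X, ∃ k : Fin p, d k ≠ 0 ∧
          x ∈ MultiProj.nonvanishingLocus _ (MultiProj.pullbackSection ι
            (MultiProj.multiProjectiveSpace.coordinate A d k))) := by
  -- The whole index set serves as `I`, with all exponents `n` equal to `1`.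
  refine ⟨fun q L hL hA ↦ ⟨Finset.univ, fun x ↦ ?_, ?_⟩, fun q p d hq _ ι _ _ hι ↦ ?_⟩
  · obtain ⟨i, h⟩ := hA x
    exact ⟨⟨i, Finset.mem_univ i⟩, h⟩
  · have hA' : MultiProj.IsAmpleFamily fun i : (Finset.univ : Finset (Fin q)) ↦ L i := fun x ↦
      let ⟨i, h⟩ := hA x
      ⟨⟨i, Finset.mem_univ i⟩, h⟩
    obtain ⟨p, d, hd, ι, h1, h2, h3, h4⟩ :=
      MultiProj.exists_immersion_of_isAmpleFamily π
        (L := fun i : (Finset.univ : Finset (Fin q)) ↦ L i) (fun i ↦ hL i) hA'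
    exact ⟨p, d, hd, ι, h1, h2, h3, fun i ↦ ⟨1, one_pos, h4 i⟩⟩
  -- This makes `Fin q → ℤ` nontrivial, without which no coordinate could have nonzero degree.
  · have : Nonempty (Fin q) := ⟨⟨0, hq⟩⟩
    exact ⟨MultiProj.multiProjectiveSpace.isInvertibleSheaf_pullback ι hι,
      MultiProj.multiProjectiveSpace.nonempty_tensor_pullback_iso ι hι,
      fun x ↦ MultiProj.exists_mem_nonvanishingLocus_coordinate ι (hι x)⟩
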